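/- For $\gamma\in\mathbb R$ let $C^\gamma=C^\gamma(\mathbb R)$ be the Besov space $\{f\in\mathcal S'(\mathbb R):\|f\|_{C^\gamma}=\sup_{j\ge-1}2^{j\gamma}\|(\phi_j\hat f)^\vee\|_{L^\infty}<\infty\}$, where $(\phi_j)_{j\ge -1}$ is a fixed dyadic partition of unity. For a space $E$ with norm $\|\cdot\|_E$ and $T>0$, let $C_TE$ be the space of continuous $f:[0,T]\to E$ with the sup norm, put $[f]_{\kappa,E}=\sup_{s\ne t\in[0,T]}\|f(t)-f(s)\|_E/|t-s|^\kappa$, and let $C^\kappa_TE$ be the set of $f\in C_TE$ with $[f]_{\kappa,E}<\infty$. Let $(P_t)_{t\ge0}$ be the heat semigroup on $\mathcal S'(\mathbb R)$ generated by $\frac12\partial_{xx}$. Let $T>0$, $\nu>0$, $0<\hat\beta<\beta<\frac12$ with $\beta-\hat\beta<\nu$. Let $\rho_0\in C^{1+\nu}$ be a probability density with $\int x^2\rho_0(x)\,dx<\infty$, and let $b\in C^{1/2}_TC^{-\hat\beta}$ be real-valued. Let $F:\mathbb R\to\mathbb R$ be bounded, and let $F$ and $\tilde F(z)=zF(z)$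 be differentiable with bounded and Lipschitz derivatives. For $N\ge1$ put $b^N=P_{1/N}b$, and let $\rho^N$ be the mild solution of $\partial_t\rho^N=\frac12\partial_{xx}\rho^N-\partial_x[\tilde F(\rho^N)b^N]$, $\rho^N(0)=\rho_0$; that is, $\rho^N\in C_TC^\alpha$ for some $\alpha>\beta$, and for $t\in[0,T]$ $$\rho^N(t)=P_t\rho_0-\int_0^tP_{t-s}\,\partial_x\big[\tilde F(\rho^N(s))\,b^N(s)\big]\,ds .$$ (i) We have $\rho^N\in C^{1/2}_TL^\infty$, and for every $\eta\in(0,(1-\beta)\wedge\nu)$ and every $N\ge1$ $$[\rho^N]_{1/2,L^\infty}\le c_5+c_6N^{\frac{\eta+\hat\beta}2}.$$ Here $c_5=c\,\|\rho_0\|_{C^{1+\nu}}$ with $c$ depending only on $\eta,\nu,T$ (and the dyadic partition), and $c_6$ depends only on $\eta,\nu,T,\beta,\hat\beta,F$ (and the dyadic partition), $\|\rho_0\|_{C^{\frac12\vee\eta}}$ and $\|b\|_{C_TC^{-\hat\beta}}$. In particular neither depends on $N$. (ii) For every $\eta\in(0,(1-\beta)\wedge\nu)$ we have $\rho^N\in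 C^{1/2}_TC^\eta$, and for every $\delta>0$ and every $N\ge1$ $$[\rho^N]_{1/2,C^\eta}\le c_5+c_6N^{\frac{\eta+\hat\beta+\delta}2}.$$ Here $c_5=c\,\|\rho_0\|_{C^{1+\nu}}$ with $c$ depending only on $\eta,\delta,\nu,T$ (and the dyadic partition). For any chosen $\theta\in(0,\delta]$ with $\eta+\theta<(1-\beta)\wedge\nu$, the constant $c_6$ can be taken to depend only on $\eta,\delta,\theta,\nu,T,\beta,\hat\beta,F$ (and the dyadic partition), $\|\rho_0\|_{C^{\frac12\vee(\eta+\theta)}}$ and $\|b\|_{C_TC^{-\hat\beta}}$. -/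

import Mathlib

open MeasureTheory Filter Topology Set
open scoped ENNReal NNReal ContDiff SchwartzMap BoundedContinuousFunction

namespace SingularFP

noncomputable section

/-! ### Besov–Hölder spaces on the real line -/

/-- A (radial, smooth) dyadic partition of unity on the frequency line: `χ` lives on the ball of
radius `4/3`, `φ` on the annulus `3/4 ≤ |ξ| ≤ 8/3`, and `χ(ξ) + ∑_{j ≥ 0} φ(2^{-j} ξ) = 1`. -/
structure DyadicPartition where
  χ : ℝ → ℝ
  φ : ℝ → ℝ
  χ_smooth : ContDiff ℝ ∞ χ
  φ_smooth : ContDiff ℝ ∞ φ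
  χ_even : ∀ ξ, χ (-ξ) = χ ξ
  φ_even : ∀ ξ, φ (-ξ) = φ ξ
  χ_mem : ∀ ξ, χ ξ ∈ Icc (0 : ℝ) 1
  φ_mem : ∀ ξ, φ ξ ∈ Icc (0 : ℝ) 1
  χ_supp : tsupport χ ⊆ {ξ | |ξ| ≤ 4 / 3}
  φ_supp : tsupport φ ⊆ {ξ | 3 / 4 ≤ |ξ| ∧ |ξ| ≤ 8 / 3}
  sum_eq : ∀ ξ, HasSum (fun j : ℕ => φ ((2 : ℝ)⁻¹ ^ j * ξ)) (1 - χ ξ)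

theorem DyadicPartition.nonempty : Nonempty DyadicPartition := by
  let f : ContDiffBump (0 : ℝ) := ⟨1, 5 / 4, by norm_num, by norm_num⟩
  have one : ∀ x : ℝ, |x| ≤ 1 → f x = 1 := fun x hx =>
    f.one_of_mem_closedBall (by simpa [f] using hx)
  have zer : ∀ x : ℝ, 5 / 4 ≤ |x| → f x = 0 := fun x hx =>
    f.zero_of_le_dist (by simpa [f] using hx)
  have hd : ∀ x : ℝ, 0 ≤ f (x / 2) - f x ∧ f (x / 2) - f x ≤ 1 := by
    intro x
    refine ⟨?_, by linarith [f.le_one (x := x / 2), f.nonneg (x := x)]⟩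
    rcases le_total |x| 2 with h | h
    · rw [one (x / 2) (by rw [abs_div]; norm_num; linarith)]
      linarith [f.le_one (x := x)]
    · rw [zer x (by linarith)]
      linarith [f.nonneg (x := x / 2)]
  refine ⟨⟨f, fun x => f (x / 2) - f x, f.contDiff,
    (f.contDiff.comp (contDiff_id.div_const 2)).sub f.contDiff, f.neg, ?_,
    fun x => ⟨f.nonneg, f.le_one⟩, hd, ?_, ?_, ?_⟩⟩
  · intro x
    simp only [neg_div, f.neg]
  · rw [f.tsupport_eq]
    intro x hx
    have : |x| ≤ 5 / 4 := by simpa [f] using hx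
    simp only [mem_ofPred_eq]
    linarith
  · refine closure_minimal ?_ ?_
    · intro x hx
      simp only [Function.mem_support] at hx
      simp only [mem_ofPred_eq]
      constructor
      · by_contra! h
        apply hx
        rw [one x (by linarith), one (x / 2) (by rw [abs_div]; norm_num; linarith)]
        simp
      · by_contra! h
        apply hx
        rw [zer x (by linarith), zer (x / 2) (by rw [abs_div]; norm_num; linarith)]
        simp
    · exact (isClosed_le continuous_const continuous_abs).inter
        (isClosed_le continuous_abs continuous_const)
  · intro x
    have hlim : Tendsto (fun n : ℕ => f ((2 : ℝ)⁻¹ ^ n * x)) atTop (𝓝 1) := by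
      have h0 : Tendsto (fun n : ℕ => (2 : ℝ)⁻¹ ^ n * x) atTop (𝓝 0) := by
        simpa using (tendsto_pow_atTop_nhds_zero_of_lt_one
          (by norm_num : (0 : ℝ) ≤ 2⁻¹) (by norm_num)).mul_const x
      have h1 := (f.continuous.tendsto 0).comp h0
      rwa [one 0 (by simp)] at h1
    rw [hasSum_iff_tendsto_nat_of_nonneg (fun i => (hd _).1)]
    have hsum : ∀ n : ℕ, ∑ i ∈ Finset.range n,
        (f ((2 : ℝ)⁻¹ ^ i * x / 2) - f ((2 : ℝ)⁻¹ ^ i * x)) = f ((2 : ℝ)⁻¹ ^ n * x) - f x := by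
      intro n
      have := Finset.sum_range_sub (fun i : ℕ => f ((2 : ℝ)⁻¹ ^ i * x)) n
      simp only [pow_zero, one_mul] at this
      rw [← this]
      refine Finset.sum_congr rfl fun i _ => ?_
      congr 2
      rw [pow_succ]
      ring
    simp only [hsum]
    exact hlim.sub_const _

/-- The functions of the partition, with the index shifted by one: `symbol 0 = χ = φ_{-1}` and
`symbol (j + 1) = φ(2^{-j} ·) = φ_j`. -/
def DyadicPartition.symbol (D : DyadicPartition) : ℕ → ℝ → ℝ
  | 0 => D.χ
  | j + 1 => fun ξ => D.φ ((2 : ℝ)⁻¹ ^ j * ξ)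

/-- The Littlewood–Paley block `u ↦ (φ_{j-1} û)^∨`. Mathlib's Fourier transform uses the kernel
`e^{-2πixξ}`; the dilation by `2π` turns the multiplier into the one for the kernel `e^{-ixξ}`. -/
def DyadicPartition.block (D : DyadicPartition) (j : ℕ) (u : 𝓢'(ℝ, ℂ)) : 𝓢'(ℝ, ℂ) :=
  TemperedDistribution.fourierMultiplierCLM ℂ
    (fun ξ : ℝ => ((D.symbol j (2 * Real.pi * ξ) : ℝ) : ℂ)) u

/-- The `L^∞` norm of a tempered distribution (`∞` if it is not an essentially bounded function). -/
def distLinftyNorm (u : 𝓢'(ℝ, ℂ)) : ℝ≥0∞ :=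
  ⨅ (g : Lp ℂ ⊤ (volume : Measure ℝ)) (_ : Lp.toTemperedDistribution g = u), ‖g‖ₑ

/-- The norm of `C^γ`, `sup_{j ≥ -1} 2^{jγ} ‖(φ_j û)^∨‖_{L^∞}`, for any real `γ`. -/
def besovNorm (D : DyadicPartition) (γ : ℝ) (u : 𝓢'(ℝ, ℂ)) : ℝ≥0∞ :=
  ⨆ j : ℕ, ENNReal.ofReal ((2 : ℝ) ^ (((j : ℝ) - 1) * γ)) * distLinftyNorm (D.block j u)

/-- A distribution is real if it is real on real test functions. -/
def IsRealDist (u : 𝓢'(ℝ, ℂ)) : Prop :=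
  ∀ ψ : 𝓢(ℝ, ℂ), (∀ x, (ψ x).im = 0) → (u ψ).im = 0

/-! ### Functions as distributions -/

open Classical in
/-- The tempered distribution `ψ ↦ ∫ ψ f` of an essentially bounded function `f`. -/
def toDist (f : ℝ → ℝ) : 𝓢'(ℝ, ℂ) :=
  if h : MemLp (fun x => (f x : ℂ)) ⊤ (volume : Measure ℝ)
    then Lp.toTemperedDistribution (h.toLp _) else 0

open Classical in
/-- The (unique) bounded continuous real function that a distribution is given by, if any. -/
def reprFun (u : 𝓢'(ℝ, ℂ)) : ℝ →ᵇ ℝ :=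
  if h : ∃ g : ℝ →ᵇ ℝ, toDist g = u then h.choose else 0

/-- The `C^γ` norm of a bounded continuous function. -/
def funNorm (D : DyadicPartition) (γ : ℝ) (f : ℝ →ᵇ ℝ) : ℝ≥0∞ := besovNorm D γ (toDist f)

/-- The `L^∞` norm of a bounded continuous function. -/
def linftyNorm (f : ℝ →ᵇ ℝ) : ℝ≥0∞ := eLpNorm f ⊤ (volume : Measure ℝ)

/-! ### Curves on `[0, T]`, with values measured by an extended norm `n` -/

section Curves

variable {X : Type*} [AddCommGroup X]

/-- `‖f‖_{C_T E}`. -/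
def supNorm (T : ℝ) (n : X → ℝ≥0∞) (f : ℝ → X) : ℝ≥0∞ := ⨆ t ∈ Icc 0 T, n (f t)

/-- `[f]_{κ,E}`, the supremum over `t ≠ s` in `[0, T]` of `‖f(t) - f(s)‖_E / |t - s|^κ`. -/
def holderSeminorm (T κ : ℝ) (n : X → ℝ≥0∞) (f : ℝ → X) : ℝ≥0∞ :=
  ⨆ t ∈ Icc 0 T, ⨆ s ∈ Icc 0 T, ⨆ _ : t ≠ s, n (f t - f s) / ENNReal.ofReal (|t - s| ^ κ)

/-- `f ∈ C_T E`. -/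
def MemC (T : ℝ) (n : X → ℝ≥0∞) (f : ℝ → X) : Prop :=
  ∀ t ∈ Icc 0 T, n (f t) < ⊤ ∧ Tendsto (fun s => n (f s - f t)) (𝓝[Icc 0 T] t) (𝓝 0)

/-- `f ∈ C^κ_T E`. -/
def MemCHolder (T κ : ℝ) (n : X → ℝ≥0∞) (f : ℝ → X) : Prop :=
  MemC T n f ∧ holderSeminorm T κ n f < ⊤

end Curves

/-! ### The regularised Fokker–Planck equation -/

/-- The heat semigroup `P_t = e^{(t/2) ∂_xx}` on tempered distributions; in the convention
`e^{-2πixξ}` the operator `(1/2) ∂_xx` has the symbol `-2π²ξ²`. -/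
def heat (t : ℝ) (u : 𝓢'(ℝ, ℂ)) : 𝓢'(ℝ, ℂ) :=
  TemperedDistribution.fourierMultiplierCLM ℂ
    (fun ξ : ℝ => ((Real.exp (-2 * Real.pi ^ 2 * t * ξ ^ 2) : ℝ) : ℂ)) u

/-- The mollified drift `b^N(t) = P_{1/N} b(t)`, as a function of `x`. -/
def mollified (N : ℝ) (b : ℝ → 𝓢'(ℝ, ℂ)) (t : ℝ) : ℝ →ᵇ ℝ := reprFun (heat (1 / N) (b t))

/-- The flux `H^N(t) = F̃(ρ(t)) b^N(t)`, where `F̃(z) = z F(z)`. -/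
def flux (F : ℝ → ℝ) (N : ℝ) (b : ℝ → 𝓢'(ℝ, ℂ)) (ρ : ℝ → ℝ →ᵇ ℝ) (t x : ℝ) : ℝ :=
  (ρ t x * F (ρ t x)) * mollified N b t x

/-- `ρ` is a mild solution on `[0, T]` of
`∂_t ρ = (1/2) ∂_xx ρ - ∂_x [F̃(ρ) b^N]`, `ρ(0) = ρ₀`:
it lies in `C_T C^α` for some `α > β`, and
`ρ(t) = P_t ρ₀ - ∫_0^t P_{t-s} ∂_x [F̃(ρ(s)) b^N(s)] ds` as tempered distributions. -/
structure IsMildSolution (D : DyadicPartition) (T β : ℝ) (F : ℝ → ℝ) (N : ℝ)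
    (b : ℝ → 𝓢'(ℝ, ℂ)) (ρ₀ : ℝ →ᵇ ℝ) (ρ : ℝ → ℝ →ᵇ ℝ) : Prop where
  mem : ∃ α, β < α ∧ MemC T (funNorm D α) ρ
  eq : ∀ t ∈ Icc 0 T, ∀ ψ : 𝓢(ℝ, ℂ),
    toDist (ρ t) ψ = heat t (toDist ρ₀) ψ
      - ∫ s in (0 : ℝ)..t,
          heat (t - s) (TemperedDistribution.derivCLM ℂ (toDist (flux F N b ρ s))) ψ

/-! ### Assumptions on the data -/

/-- `ρ₀` is a probability density in `C^{1+ν}` with finite second moment. -/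
structure IsInitialDensity (D : DyadicPartition) (ν : ℝ) (ρ₀ : ℝ →ᵇ ℝ) : Prop where
  mem : funNorm D (1 + ν) ρ₀ < ⊤
  nonneg : ∀ x, 0 ≤ ρ₀ x
  integrable : Integrable ρ₀
  integral_eq : ∫ x, ρ₀ x = 1
  moment : Integrable fun x => x ^ 2 * ρ₀ x

/-- `b` is a curve of real distributions in `C^{1/2}_T C^{-β'}`. -/
structure IsDrift (D : DyadicPartition) (T β' : ℝ) (b : ℝ → 𝓢'(ℝ, ℂ)) : Prop where
  real : ∀ t ∈ Icc 0 T, IsRealDist (b t)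
  mem : MemCHolder T (1 / 2) (besovNorm D (-β')) b

/-- `F` is differentiable with bounded and Lipschitz derivative. -/
structure HasBoundedLipschitzDeriv (F : ℝ → ℝ) : Prop where
  diff : Differentiable ℝ F
  bounded : ∃ C, ∀ x, |deriv F x| ≤ C
  lipschitz : ∃ K, LipschitzWith K (deriv F)

/-- The nonlinearity: `F` is bounded, and both `F` and `F̃(z) = z F(z)` are differentiable with
bounded and Lipschitz derivatives. -/
structure IsNonlinearity (F : ℝ → ℝ) : Prop where
  bounded : ∃ C, ∀ x, |F x| ≤ C
  left : HasBoundedLipschitzDeriv F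
  right : HasBoundedLipschitzDeriv fun z => z * F z

end

end SingularFP

open SingularFP

/-!
The solution is compared with the free heat flow of `ρ₀`. By `besovNorm_heat_sub_le` the free part
is `1/2`-Hölder in time with values in `C^η`, because `ρ₀ ∈ C^{1+ν}` and `η ≤ ν`; this gives the
constant `cS`. The remainder is the Duhamel integral of the flux `H = F̃(ρ) b^N`, and
`SmoothedMild.HB_time` bounds its time increments in any Hölder space by `√(t - s)` times the norm
of `H` there. No power of `t - s` and no logarithm is lost: the increments of `∂_x P_τ` are dominated
by the increments of `τ ↦ τ^{-1/2}` (`min_mul_rpow_le`), so the time integral telescopes. Both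
parts therefore hold with the exponent `(η + β') / 2` of `N`, which is at most `(η + β' + δ) / 2`.

The norm of `H` in the Hölder space of order `η` is controlled by two facts. The mollified drift
`b^N = P_{1/N} b` has norm of order `N^{(η+β')/2}` (`drift_bounds`). The solution is bounded in the
Hölder space of order `γ = max(1/2, η)`, respectively `max(1/2, η + θ)`, uniformly in `N`: here `b^N`
may only be used through `‖P_τ b^N‖ ≲ τ^{-β'/2}`. Multiplication by a `γ`-Hölder function with
`γ > β'` preserves such a bound (`norm_P_mul_le`, by a commutator estimate summed over dyadic times),
the operator `∂_x P_τ` then loses `τ^{-(1+β'+γ)/2}` (`HB_Q`), which is integrable since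
`γ < 1 - β'`, and a singular Gronwall argument closes the estimate
(`SmoothedMild.HB_of_singular_gronwall`).

The mild equation is an identity of distributions. Testing it with the Gaussian of variance `ε`
centred at `x` gives an identity for `P_ε ρ(t)(x)` in which the singularity of `∂_x P_{t-s}` at
`s = t` is removed (`IsMildSolution.smoothedMild`); all estimates are uniform in `ε`, and `ε → 0` at
the end.

The Besov spaces enter through Gaussian and Hölder norms. Littlewood–Paley blocks are convolutions
with Schwartz kernels, a fattened partition reproduces them, and their sum converges weakly to the
distribution (`tendsto_sum_block`). Hence `C^γ` with `0 < γ < 1` is the Hölder space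
(`HB_of_besovNorm_le`, `besovNorm_le_of_HB`), and in negative regularity
`‖P_τ u‖ ≲ τ^{-a/2} ‖u‖_{C^{-a}}` (`exists_heat_of_besovNorm_le`).
-/

namespace SingularFP

open FourierTransform

noncomputable section

/-! ### Schwartz kernels and their dilations -/

/-- The kernel `x ↦ λ k(λ x)`, an `L¹`-preserving dilation (`0` in the irrelevant case `λ = 0`). -/
def dil (l : ℝ) (k : 𝓢(ℝ, ℂ)) : 𝓢(ℝ, ℂ) :=
  if h : l = 0 then 0 else
    (l : ℂ) • SchwartzMap.compCLMOfContinuousLinearEquiv ℂ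
      (ContinuousLinearEquiv.unitsEquivAut ℝ (Units.mk0 l h)) k

theorem dil_apply {l : ℝ} (hl : 0 < l) (k : 𝓢(ℝ, ℂ)) (x : ℝ) : dil l k x = l * k (l * x) := by
  simp [dil, hl.ne', mul_comm]

/-- The derivative of a Schwartz kernel. -/
def dk (k : 𝓢(ℝ, ℂ)) : 𝓢(ℝ, ℂ) := SchwartzMap.derivCLM ℂ ℂ k

theorem dk_apply (k : 𝓢(ℝ, ℂ)) (x : ℝ) : dk k x = deriv k x := rfl

theorem hasDerivAt_kernel (k : 𝓢(ℝ, ℂ)) (x : ℝ) : HasDerivAt k (dk k x) x := k.hasDerivAt x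

theorem dk_dil {l : ℝ} (hl : 0 < l) (k : 𝓢(ℝ, ℂ)) : dk (dil l k) = (l : ℂ) • dil l (dk k) := by
  ext x
  have h1 : HasDerivAt (fun x => (l : ℂ) * k (l * x)) ((l : ℂ) * (l • dk k (l * x))) x := by
    have h2 : HasDerivAt (fun x : ℝ => l * x) l x := by
      simpa using (hasDerivAt_id x).const_mul l
    exact ((hasDerivAt_kernel k (l * x)).scomp x h2).const_mul (l : ℂ)
  have h3 : (dil l k : ℝ → ℂ) = fun x => (l : ℂ) * k (l * x) := funext (dil_apply hl k)
  rw [dk_apply, h3, h1.deriv, _root_.smul_apply, dil_apply hl]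
  simp

theorem fourier_dk (k : 𝓢(ℝ, ℂ)) (ξ : ℝ) :
    𝓕 (dk k) ξ = 2 * Real.pi * Complex.I * ξ * 𝓕 k ξ := by
  rw [SchwartzMap.fourier_coe, SchwartzMap.fourier_coe]
  have := Real.fourier_deriv (f := k) k.integrable k.differentiable (dk k).integrable
  exact (congrFun this ξ).trans (by simp)

theorem fourier_dil {l : ℝ} (hl : 0 < l) (k : 𝓢(ℝ, ℂ)) (ξ : ℝ) :
    𝓕 (dil l k) ξ = 𝓕 k (ξ / l) := by
  rw [SchwartzMap.fourier_coe, SchwartzMap.fourier_coe, Real.fourier_eq', Real.fourier_eq']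
  have h := Measure.integral_comp_mul_left
    (fun v : ℝ => Complex.exp (↑(-2 * Real.pi * inner ℝ v (ξ / l)) * Complex.I) • k v) l
  have h2 : ∀ x : ℝ, Complex.exp (↑(-2 * Real.pi * inner ℝ x ξ) * Complex.I) • dil l k x
      = (l : ℂ) • (fun v : ℝ =>
        Complex.exp (↑(-2 * Real.pi * inner ℝ v (ξ / l)) * Complex.I) • k v) (l * x) := by
    intro x
    have : inner ℝ (l * x) (ξ / l) = inner ℝ x ξ := by
      simp only [RCLike.inner_apply, conj_trivial]
      field_simp
    simp only [this, dil_apply hl, smul_eq_mul]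
    ring
  simp_rw [h2]
  rw [integral_smul, h, abs_of_pos (inv_pos.mpr hl), Complex.real_smul, smul_eq_mul, ← mul_assoc]
  push_cast
  rw [mul_inv_cancel₀ (by exact_mod_cast hl.ne'), one_mul]

/-- The `L¹` norm of a kernel. -/
def L1 (k : 𝓢(ℝ, ℂ)) : ℝ := ∫ x, ‖k x‖

theorem L1_nonneg (k : 𝓢(ℝ, ℂ)) : 0 ≤ L1 k := integral_nonneg fun _ => norm_nonneg _

theorem L1_dil {l : ℝ} (hl : 0 < l) (k : 𝓢(ℝ, ℂ)) : L1 (dil l k) = L1 k := by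
  have h := Measure.integral_comp_mul_left (fun v : ℝ => ‖k v‖) l
  unfold L1
  simp_rw [dil_apply hl, norm_mul]
  rw [integral_const_mul, h, Complex.norm_real, Real.norm_of_nonneg hl.le,
    abs_of_pos (inv_pos.mpr hl), smul_eq_mul, mul_inv_cancel_left₀ hl.ne']

theorem L1_smul (c : ℂ) (k : 𝓢(ℝ, ℂ)) : L1 (c • k) = ‖c‖ * L1 k := by
  unfold L1
  simp_rw [_root_.smul_apply, norm_smul]
  rw [integral_const_mul]

theorem L1_dk_dil {l : ℝ} (hl : 0 < l) (k : 𝓢(ℝ, ℂ)) : L1 (dk (dil l k)) = l * L1 (dk k) := by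
  rw [dk_dil hl, L1_smul, L1_dil hl, Complex.norm_real, Real.norm_of_nonneg hl.le]

/-- The absolute moment of order `γ` of a kernel. -/
def mom (γ : ℝ) (k : 𝓢(ℝ, ℂ)) : ℝ := ∫ x, ‖k x‖ * |x| ^ γ

theorem mom_nonneg (γ : ℝ) (k : 𝓢(ℝ, ℂ)) : 0 ≤ mom γ k := integral_nonneg fun _ => by positivity

theorem rpow_abs_le_one_add_sq {γ : ℝ} (h0 : 0 ≤ γ) (h2 : γ ≤ 2) (x : ℝ) : |x| ^ γ ≤ 1 + x ^ 2 := by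
  rcases le_total |x| 1 with h | h
  · have := Real.rpow_le_one (abs_nonneg x) h h0
    nlinarith [sq_nonneg x]
  · have := Real.rpow_le_rpow_of_exponent_le h h2
    rw [Real.rpow_two, sq_abs] at this
    linarith

theorem integrable_mom {γ : ℝ} (h0 : 0 ≤ γ) (h2 : γ ≤ 2) (k : 𝓢(ℝ, ℂ)) :
    Integrable fun x => ‖k x‖ * |x| ^ γ := by
  have h : Integrable fun x => ‖k x‖ + ‖x‖ ^ 2 * ‖k x‖ :=
    k.integrable.norm.add (k.integrable_pow_mul volume 2)
  refine h.mono' (by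
    refine Continuous.aestronglyMeasurable (k.continuous.norm.mul
      (continuous_abs.rpow_const fun x => Or.inr h0))) (ae_of_all _ fun x => ?_)
  have := rpow_abs_le_one_add_sq h0 h2 x
  rw [Real.norm_of_nonneg (by positivity), Real.norm_eq_abs, sq_abs]
  nlinarith [norm_nonneg (k x)]

theorem mom_dil {l : ℝ} (hl : 0 < l) (γ : ℝ) (k : 𝓢(ℝ, ℂ)) :
    mom γ (dil l k) = l ^ (-γ) * mom γ k := by
  have h := Measure.integral_comp_mul_left (fun v : ℝ => l ^ (-γ) * (‖k v‖ * |v| ^ γ)) l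
  have h2 : ∀ x : ℝ, ‖dil l k x‖ * |x| ^ γ
      = l * (fun v : ℝ => l ^ (-γ) * (‖k v‖ * |v| ^ γ)) (l * x) := by
    intro x
    simp only [dil_apply hl, norm_mul, Complex.norm_real, Real.norm_of_nonneg hl.le, abs_mul,
      abs_of_pos hl]
    rw [Real.mul_rpow hl.le (abs_nonneg x), Real.rpow_neg hl.le]
    have : l ^ γ ≠ 0 := (Real.rpow_pos_of_pos hl γ).ne'
    field_simp
  unfold mom
  simp_rw [h2]
  rw [integral_const_mul, h, abs_of_pos (inv_pos.mpr hl), smul_eq_mul, mul_inv_cancel_left₀ hl.ne',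
    integral_const_mul]

/-- The reflected and translated kernel `y ↦ k(x - y)`, so that `u (refl x k) = (k ⋆ u)(x)`. -/
def refl (x : ℝ) (k : 𝓢(ℝ, ℂ)) : 𝓢(ℝ, ℂ) :=
  SchwartzMap.compSubConstCLM ℂ x (SchwartzMap.compCLMOfContinuousLinearEquiv ℂ
    (LinearIsometryEquiv.neg ℝ (E := ℝ)).toContinuousLinearEquiv k)

theorem refl_apply (x : ℝ) (k : 𝓢(ℝ, ℂ)) (y : ℝ) : refl x k y = k (x - y) := by
  simp [refl]

theorem fourierInv_refl (x : ℝ) (k : 𝓢(ℝ, ℂ)) (ξ : ℝ) :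
    𝓕⁻ (refl x k) ξ = Complex.exp (↑(2 * Real.pi * (x * ξ)) * Complex.I) * 𝓕 k ξ := by
  rw [SchwartzMap.fourier_coe, SchwartzMap.fourierInv_coe, Real.fourier_eq', Real.fourierInv_eq']
  rw [← integral_sub_left_eq_self _ volume x, ← integral_const_mul]
  congr 1
  ext y
  rw [refl_apply, smul_eq_mul, smul_eq_mul, ← mul_assoc, ← Complex.exp_add]
  congr 2
  · simp only [RCLike.inner_apply, conj_trivial]
    push_cast
    ring
  · simp

/-- Fourier multipliers commute with the reflected translations. -/
theorem fourier_smulLeft_fourierInv_refl (m : ℝ → ℂ) (hm : m.HasTemperateGrowth) (x : ℝ)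
    {k l : 𝓢(ℝ, ℂ)} (h : ∀ ξ, 𝓕 l ξ = m ξ * 𝓕 k ξ) :
    𝓕 (SchwartzMap.smulLeftCLM ℂ m (𝓕⁻ (refl x k))) = refl x l := by
  have : SchwartzMap.smulLeftCLM ℂ m (𝓕⁻ (refl x k)) = 𝓕⁻ (refl x l) := by
    ext ξ
    rw [SchwartzMap.smulLeftCLM_apply_apply hm, fourierInv_refl, fourierInv_refl, h, smul_eq_mul]
    ring
  rw [this, FourierTransform.fourier_fourierInv_eq]

theorem dk_refl (x : ℝ) (k : 𝓢(ℝ, ℂ)) : SchwartzMap.derivCLM ℂ ℂ (refl x k) = - refl x (dk k) := by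
  ext y
  have h3 : (refl x k : ℝ → ℂ) = fun y => k (x - y) := funext (refl_apply x k)
  have h1 : HasDerivAt (fun y => k (x - y)) ((-1 : ℝ) • dk k (x - y)) y := by
    have h2 : HasDerivAt (fun y : ℝ => x - y) (-1) y := by
      simpa using (hasDerivAt_id y).const_sub x
    exact (hasDerivAt_kernel k (x - y)).scomp y h2
  rw [SchwartzMap.derivCLM_apply, h3, h1.deriv, _root_.neg_apply, refl_apply]
  simp

/-! ### The Gaussian kernel -/

/-- The derivatives of the Gaussian are Hermite polynomials times the Gaussian, hence decay. -/
theorem decay_gaussian (k n : ℕ) : ∃ C, ∀ x : ℝ,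
    ‖x‖ ^ k * ‖iteratedFDeriv ℝ n (fun y : ℝ => Real.exp (-(y ^ 2 / 2))) x‖ ≤ C := by
  set p : Polynomial ℝ := Polynomial.X ^ k * (Polynomial.hermite n).map (Int.castRingHom ℝ)
  have hc : Continuous fun x : ℝ => p.eval x * Real.exp (-(x ^ 2 / 2)) := by fun_prop
  have hl : Tendsto (fun x : ℝ => p.eval x * Real.exp (-(x ^ 2 / 2))) (cocompact ℝ) (𝓝 0) := by
    have h1 : ∀ q : Polynomial ℝ,
        Tendsto (fun x : ℝ => q.eval x * Real.exp (-(x ^ 2 / 2))) (cocompact ℝ) (𝓝 0) := by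
      intro q
      induction q using Polynomial.induction_on' with
      | add q r hq hr => simpa [add_mul] using hq.add hr
      | monomial m a =>
        have := (tendsto_rpow_abs_mul_exp_neg_mul_sq_cocompact (a := 1 / 2) (by norm_num) m)
        have h2 := (this.const_mul |a|)
        rw [mul_zero] at h2
        refine squeeze_zero_norm (fun x => le_of_eq ?_) h2
        simp only [Polynomial.eval_monomial, norm_mul, Real.norm_eq_abs, Real.abs_exp, abs_pow,
          Real.rpow_natCast, mul_assoc]
        congr 3
        ring_nf
    exact h1 p
  let f : ZeroAtInftyContinuousMap ℝ ℝ := ⟨⟨_, hc⟩, hl⟩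
  refine ⟨‖f.toBCF‖, fun x => le_trans (le_of_eq ?_) (f.toBCF.norm_coe_le_norm x)⟩
  rw [norm_iteratedFDeriv_eq_norm_iteratedDeriv, iteratedDeriv_eq_iterate,
    Polynomial.deriv_gaussian_eq_hermite_mul_gaussian, ← norm_pow, ← norm_mul]
  change _ = ‖p.eval x * Real.exp (-(x ^ 2 / 2))‖
  simp only [p, Polynomial.eval_mul, Polynomial.eval_pow, Polynomial.eval_X, norm_mul, norm_pow,
    norm_neg, norm_one, one_pow, one_mul, Polynomial.eval_map, Polynomial.aeval_def, mul_assoc]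
  rfl

/-- The real Gaussian `e^{-x²/2}` as a Schwartz function. -/
def expNegHalfSq : 𝓢(ℝ, ℝ) where
  toFun := fun y => Real.exp (-(y ^ 2 / 2))
  smooth' := by fun_prop
  decay' := decay_gaussian

/-- The standard Gaussian density. -/
def g1 : 𝓢(ℝ, ℂ) :=
  (((√(2 * Real.pi))⁻¹ : ℝ) : ℂ) • SchwartzMap.postcompCLM (𝕜 := ℝ) Complex.ofRealCLM expNegHalfSq

theorem g1_apply (x : ℝ) :
    g1 x = (((√(2 * Real.pi))⁻¹ * Real.exp (-(x ^ 2 / 2)) : ℝ) : ℂ) := by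
  have h : SchwartzMap.postcompCLM (𝕜 := ℝ) Complex.ofRealCLM expNegHalfSq x
      = ((Real.exp (-(x ^ 2 / 2)) : ℝ) : ℂ) := rfl
  rw [g1, _root_.smul_apply, h, smul_eq_mul, Complex.ofReal_mul]

/-- The Gaussian density of variance `τ > 0`, the kernel of `P_τ`. -/
def gk (τ : ℝ) : 𝓢(ℝ, ℂ) := dil (√τ)⁻¹ g1

/-- The values of `gk τ`. -/
def gr (τ x : ℝ) : ℝ := (√τ)⁻¹ * ((√(2 * Real.pi))⁻¹ * Real.exp (-(((√τ)⁻¹ * x) ^ 2 / 2)))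

theorem inv_sqrt_pos {τ : ℝ} (h : 0 < τ) : 0 < (√τ)⁻¹ := inv_pos.mpr (Real.sqrt_pos.mpr h)

theorem gk_apply {τ : ℝ} (h : 0 < τ) (x : ℝ) : gk τ x = (gr τ x : ℂ) := by
  rw [gk, dil_apply (inv_sqrt_pos h), g1_apply, gr]
  push_cast
  ring

theorem gr_nonneg (τ x : ℝ) : 0 ≤ gr τ x := by unfold gr; positivity

theorem gr_neg (τ x : ℝ) : gr τ (-x) = gr τ x := by simp [gr]

theorem norm_gk {τ : ℝ} (h : 0 < τ) (x : ℝ) : ‖gk τ x‖ = gr τ x := by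
  rw [gk_apply h, Complex.norm_real, Real.norm_of_nonneg (gr_nonneg _ _)]

theorem L1_g1 : L1 g1 = 1 := by
  unfold L1
  have h : ∀ x, ‖g1 x‖ = (√(2 * Real.pi))⁻¹ * Real.exp (-(1 / 2) * x ^ 2) := fun x => by
    rw [g1_apply, Complex.norm_real, Real.norm_of_nonneg (by positivity)]
    congr 2
    ring
  simp_rw [h]
  rw [integral_const_mul, integral_gaussian, div_div_eq_mul_div, div_one, mul_comm Real.pi,
    inv_mul_cancel₀ (by positivity)]

theorem L1_gk {τ : ℝ} (h : 0 < τ) : L1 (gk τ) = 1 := by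
  rw [gk, L1_dil (inv_sqrt_pos h), L1_g1]

theorem integral_gr {τ : ℝ} (h : 0 < τ) : ∫ x, gr τ x = 1 := by
  rw [← L1_gk h]
  unfold L1
  simp_rw [norm_gk h]

theorem integral_gk {τ : ℝ} (h : 0 < τ) : ∫ x, gk τ x = 1 := by
  simp_rw [gk_apply h]
  rw [integral_complex_ofReal, integral_gr h, Complex.ofReal_one]

theorem L1_dk_gk {τ : ℝ} (h : 0 < τ) : L1 (dk (gk τ)) = (√τ)⁻¹ * L1 (dk g1) :=
  L1_dk_dil (inv_sqrt_pos h) g1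

theorem mom_gk {τ : ℝ} (h : 0 < τ) (γ : ℝ) : mom γ (gk τ) = τ ^ (γ / 2) * mom γ g1 := by
  rw [gk, mom_dil (inv_sqrt_pos h), Real.sqrt_eq_rpow, ← Real.rpow_neg h.le, ← Real.rpow_mul h.le]
  congr 2
  ring

theorem fourier_g1 (ξ : ℝ) : 𝓕 g1 ξ = ((Real.exp (-2 * Real.pi ^ 2 * ξ ^ 2) : ℝ) : ℂ) := by
  have hpi := Real.pi_pos
  have hb : 0 < ((1 / (2 * Real.pi) : ℝ) : ℂ).re := by rw [Complex.ofReal_re]; positivity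
  have h := congrFun (fourier_gaussian_pi hb) ξ
  have h1 : (g1 : ℝ → ℂ) = fun x : ℝ => (((√(2 * Real.pi))⁻¹ : ℝ) : ℂ) •
      Complex.exp (-Real.pi * ((1 / (2 * Real.pi) : ℝ) : ℂ) * x ^ 2) := by
    ext x
    rw [g1_apply, smul_eq_mul, Complex.ofReal_mul, Complex.ofReal_exp]
    congr 2
    push_cast
    field_simp
  have h2 : 𝓕 (fun x : ℝ => (((√(2 * Real.pi))⁻¹ : ℝ) : ℂ) •
      Complex.exp (-Real.pi * ((1 / (2 * Real.pi) : ℝ) : ℂ) * x ^ 2)) ξ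
      = (((√(2 * Real.pi))⁻¹ : ℝ) : ℂ) • 𝓕 (fun x : ℝ =>
      Complex.exp (-Real.pi * ((1 / (2 * Real.pi) : ℝ) : ℂ) * x ^ 2)) ξ := by
    rw [Real.fourier_eq', Real.fourier_eq', ← integral_smul]
    congr 1
    ext v
    exact smul_comm _ _ _
  rw [SchwartzMap.fourier_coe, h1, h2, h]
  have h3 : ((1 / (2 * Real.pi) : ℝ) : ℂ) ^ (1 / 2 : ℂ) = (((√(2 * Real.pi))⁻¹ : ℝ) : ℂ) := by
    rw [show (1 / 2 : ℂ) = ((1 / 2 : ℝ) : ℂ) by norm_num, ← Complex.ofReal_cpow (by positivity),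
      ← Real.sqrt_eq_rpow, Real.sqrt_div zero_le_one, Real.sqrt_one, one_div]
  rw [h3, smul_eq_mul, ← mul_assoc, mul_one_div, div_self, one_mul, Complex.ofReal_exp]
  · congr 1
    rw [show (-2 * Real.pi ^ 2 * ξ ^ 2 : ℝ) = -Real.pi / (1 / (2 * Real.pi)) * ξ ^ 2 by
      rw [div_div_eq_mul_div, div_one]; ring]
    push_cast
    rfl
  · rw [Complex.ofReal_ne_zero]
    positivity

/-- The Fourier transform of the Gaussian density is the heat multiplier. -/
theorem fourier_gk {τ : ℝ} (h : 0 < τ) (ξ : ℝ) :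
    𝓕 (gk τ) ξ = ((Real.exp (-2 * Real.pi ^ 2 * τ * ξ ^ 2) : ℝ) : ℂ) := by
  rw [gk, fourier_dil (inv_sqrt_pos h), fourier_g1, div_inv_eq_mul, mul_pow, Real.sq_sqrt h.le]
  congr 2
  ring

/-! ### Convolution of bounded functions with Schwartz kernels -/

/-- A bounded continuous function as an element of `L^∞`. -/
def toLinf (f : ℝ →ᵇ ℂ) : Lp ℂ ⊤ (volume : Measure ℝ) := f.memLp_top.toLp f

theorem toLinf_coe (f : ℝ →ᵇ ℂ) : toLinf f =ᵐ[volume] f := MemLp.coeFn_toLp _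

theorem ae_norm_le (g : Lp ℂ ⊤ (volume : Measure ℝ)) : ∀ᵐ x, ‖g x‖ ≤ ‖g‖ := by
  filter_upwards [ae_le_eLpNormEssSup (f := g) (μ := volume)] with x hx
  rw [Lp.norm_def, eLpNorm_exponent_top]
  have hfin := Lp.eLpNorm_ne_top g
  rw [eLpNorm_exponent_top] at hfin
  simpa using ENNReal.toReal_mono hfin hx

theorem norm_toLinf_le (f : ℝ →ᵇ ℂ) : ‖toLinf f‖ ≤ ‖f‖ := by
  rw [toLinf, Lp.norm_toLp, eLpNorm_exponent_top]
  exact ENNReal.toReal_le_of_le_ofReal (norm_nonneg f)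
    (eLpNormEssSup_le_of_ae_bound (ae_of_all _ f.norm_coe_le_norm))

theorem integrable_conv (k : 𝓢(ℝ, ℂ)) (g : Lp ℂ ⊤ (volume : Measure ℝ)) (x : ℝ) :
    Integrable fun y => k (x - y) * g y := by
  refine Integrable.mul_bdd (c := ‖g‖) (k.integrable.comp_sub_left x)
    (Lp.aestronglyMeasurable g) (ae_norm_le g)

theorem norm_conv_le (k : 𝓢(ℝ, ℂ)) (g : Lp ℂ ⊤ (volume : Measure ℝ)) (x : ℝ) :
    ‖∫ y, k (x - y) * g y‖ ≤ L1 k * ‖g‖ := by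
  have h : ∫ y, ‖k (x - y)‖ * ‖g‖ = L1 k * ‖g‖ := by
    rw [integral_mul_const, integral_sub_left_eq_self (fun y => ‖k y‖) volume x, L1]
  rw [← h]
  refine norm_integral_le_of_norm_le ((k.integrable.comp_sub_left x).norm.mul_const _) ?_
  filter_upwards [ae_norm_le g] with y hy
  rw [norm_mul]
  gcongr

theorem kernel_bound (k : 𝓢(ℝ, ℂ)) : ∃ C, 0 ≤ C ∧ ∀ x, ‖k x‖ ≤ C * (1 + x ^ 2)⁻¹ := by
  obtain ⟨C₀, h0, hC₀⟩ := k.decay 0 0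
  obtain ⟨C₂, h2, hC₂⟩ := k.decay 2 0
  refine ⟨C₀ + C₂, by positivity, fun x => ?_⟩
  have a := hC₀ x
  have b := hC₂ x
  simp only [norm_iteratedFDeriv_zero, pow_zero, one_mul, Real.norm_eq_abs, sq_abs] at a b
  rw [← div_eq_mul_inv, le_div_iff₀ (by positivity)]
  linarith

theorem hasDerivAt_conv (k : 𝓢(ℝ, ℂ)) (g : Lp ℂ ⊤ (volume : Measure ℝ)) (x : ℝ) :
    HasDerivAt (fun x => ∫ y, k (x - y) * g y) (∫ y, dk k (x - y) * g y) x := by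
  obtain ⟨C, hC0, hC⟩ := kernel_bound (dk k)
  have hb : Integrable fun y : ℝ => C * (3 * (1 + (x - y) ^ 2)⁻¹) * ‖g‖ :=
    (((integrable_inv_one_add_sq.comp_sub_left x).const_mul 3).const_mul C).mul_const _
  refine (hasDerivAt_integral_of_dominated_loc_of_deriv_le (Metric.ball_mem_nhds x one_pos)
    (F' := fun z y => dk k (z - y) * g y)
    (Eventually.of_forall fun x => (integrable_conv k g x).aestronglyMeasurable)
    (integrable_conv k g x) (integrable_conv (dk k) g x).aestronglyMeasurable ?_ hb ?_).2
  · filter_upwards [ae_norm_le g] with y hy z hz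
    rw [norm_mul]
    have h1 : (1 + (z - y) ^ 2)⁻¹ ≤ 3 * (1 + (x - y) ^ 2)⁻¹ := by
      rw [Metric.mem_ball, Real.dist_eq, abs_lt] at hz
      rw [← div_eq_mul_inv, inv_eq_one_div, div_le_div_iff₀ (by positivity) (by positivity)]
      nlinarith [sq_nonneg (x - y - 2 * (z - y)), mul_pos (sub_pos.mpr hz.1) (sub_pos.mpr hz.2)]
    have := hC (z - y)
    gcongr
    exact this.trans (by gcongr)
  · refine ae_of_all _ fun y z _ => ?_
    have h2 : HasDerivAt (fun z : ℝ => z - y) 1 z := (hasDerivAt_id z).sub_const y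
    have := ((hasDerivAt_kernel k (z - y)).scomp z h2).mul_const (g y)
    simpa using this

/-- Convolution of an `L^∞` function with a Schwartz kernel. -/
def convL (k : 𝓢(ℝ, ℂ)) (g : Lp ℂ ⊤ (volume : Measure ℝ)) : ℝ →ᵇ ℂ :=
  BoundedContinuousFunction.ofNormedAddCommGroup (fun x => ∫ y, k (x - y) * g y)
    (continuous_iff_continuousAt.mpr fun x => (hasDerivAt_conv k g x).continuousAt)
    (L1 k * ‖g‖) (norm_conv_le k g)

theorem norm_convL_le (k : 𝓢(ℝ, ℂ)) (g : Lp ℂ ⊤ (volume : Measure ℝ)) :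
    ‖convL k g‖ ≤ L1 k * ‖g‖ :=
  (BoundedContinuousFunction.norm_le (mul_nonneg (L1_nonneg k) (norm_nonneg g))).mpr
    (norm_conv_le k g)

/-- Convolution of a bounded continuous function with a Schwartz kernel. -/
def conv (k : 𝓢(ℝ, ℂ)) (f : ℝ →ᵇ ℂ) : ℝ →ᵇ ℂ := convL k (toLinf f)

theorem conv_apply (k : 𝓢(ℝ, ℂ)) (f : ℝ →ᵇ ℂ) (x : ℝ) : conv k f x = ∫ y, k (x - y) * f y := by
  refine integral_congr_ae ?_
  filter_upwards [toLinf_coe f] with y hy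
  rw [hy]

theorem conv_apply' (k : 𝓢(ℝ, ℂ)) (f : ℝ →ᵇ ℂ) (x : ℝ) : conv k f x = ∫ y, k y * f (x - y) := by
  rw [conv_apply, ← integral_sub_left_eq_self _ volume x]
  simp

theorem integrable_kernel_mul (k : 𝓢(ℝ, ℂ)) (f : ℝ →ᵇ ℂ) (x : ℝ) :
    Integrable fun y => k y * f (x - y) :=
  Integrable.mul_bdd (c := ‖f‖) k.integrable (by fun_prop)
    (ae_of_all _ fun y => f.norm_coe_le_norm _)

theorem norm_conv_le_L1 (k : 𝓢(ℝ, ℂ)) (f : ℝ →ᵇ ℂ) : ‖conv k f‖ ≤ L1 k * ‖f‖ :=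
  (norm_convL_le k _).trans (mul_le_mul_of_nonneg_left (norm_toLinf_le f) (L1_nonneg k))

theorem hasDerivAt_conv_apply (k : 𝓢(ℝ, ℂ)) (f : ℝ →ᵇ ℂ) (x : ℝ) :
    HasDerivAt (conv k f) (conv (dk k) f x) x := hasDerivAt_conv k (toLinf f) x

theorem conv_smul (k : 𝓢(ℝ, ℂ)) (c : ℂ) (f : ℝ →ᵇ ℂ) : conv k (c • f) = c • conv k f := by
  ext x
  simp only [conv_apply', BoundedContinuousFunction.smul_apply, smul_eq_mul, mul_left_comm _ c]
  exact integral_const_mul _ _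

theorem conv_sub (k : 𝓢(ℝ, ℂ)) (f g : ℝ →ᵇ ℂ) : conv k (f - g) = conv k f - conv k g := by
  ext x
  simp only [conv_apply', BoundedContinuousFunction.sub_apply, mul_sub]
  exact integral_sub (integrable_kernel_mul k f x) (integrable_kernel_mul k g x)

theorem smul_conv (c : ℂ) (k : 𝓢(ℝ, ℂ)) (f : ℝ →ᵇ ℂ) : conv (c • k) f = c • conv k f := by
  ext x
  simp only [conv_apply', BoundedContinuousFunction.smul_apply, _root_.smul_apply, smul_eq_mul,
    mul_assoc]
  exact integral_const_mul _ _

/-- Smoothing: a convolution is Lipschitz with the `L¹` norm of the derivative of the kernel. -/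
theorem norm_conv_sub_le (k : 𝓢(ℝ, ℂ)) (f : ℝ →ᵇ ℂ) (x y : ℝ) :
    ‖conv k f x - conv k f y‖ ≤ L1 (dk k) * ‖f‖ * |x - y| :=
  Convex.norm_image_sub_le_of_norm_hasDerivWithin_le (s := univ)
    (fun z _ => (hasDerivAt_conv_apply k f z).hasDerivWithinAt)
    (fun z _ => ((conv (dk k) f).norm_coe_le_norm z).trans (norm_conv_le_L1 _ _))
    convex_univ (mem_univ y) (mem_univ x)

/-- The translate `x ↦ f(x + h)`. -/
def shift (h : ℝ) (f : ℝ →ᵇ ℂ) : ℝ →ᵇ ℂ :=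
  f.compContinuous ⟨fun x => x + h, by fun_prop⟩

@[simp] theorem shift_apply (h : ℝ) (f : ℝ →ᵇ ℂ) (x : ℝ) : shift h f x = f (x + h) := rfl

theorem conv_shift (k : 𝓢(ℝ, ℂ)) (h : ℝ) (f : ℝ →ᵇ ℂ) :
    conv k (shift h f) = shift h (conv k f) := by
  ext x
  simp only [conv_apply', shift_apply]
  congr 1
  ext y
  rw [sub_add_eq_add_sub]

/-! ### Bounded functions as distributions -/

/-- The distribution of a bounded continuous function. -/
def bdist (f : ℝ →ᵇ ℂ) : 𝓢'(ℝ, ℂ) := Lp.toTemperedDistribution (toLinf f)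

theorem bdist_apply (f : ℝ →ᵇ ℂ) (ψ : 𝓢(ℝ, ℂ)) : bdist f ψ = ∫ x, ψ x * f x := by
  rw [bdist, Lp.toTemperedDistribution_apply]
  refine integral_congr_ae ?_
  filter_upwards [toLinf_coe f] with y hy
  rw [hy, smul_eq_mul]

theorem toTemperedDistribution_injective :
    Function.Injective (Lp.toTemperedDistribution : Lp ℂ ⊤ (volume : Measure ℝ) → 𝓢'(ℝ, ℂ)) :=
  LinearMap.ker_eq_bot.mp
    (Lp.ker_toTemperedDistributionCLM_eq_bot (E := ℝ) (F := ℂ) (μ := volume) (p := ⊤))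

theorem toLinf_injective : Function.Injective toLinf := by
  intro f g h
  have : (f : ℝ → ℂ) =ᵐ[volume] g := (toLinf_coe f).symm.trans (h ▸ toLinf_coe g)
  ext x
  exact congrFun ((Continuous.ae_eq_iff_eq volume f.continuous g.continuous).mp this) x

theorem bdist_injective : Function.Injective bdist :=
  toTemperedDistribution_injective.comp toLinf_injective

theorem bdist_add (f g : ℝ →ᵇ ℂ) : bdist (f + g) = bdist f + bdist g := by
  have : toLinf (f + g) = toLinf f + toLinf g := rfl
  rw [bdist, this]
  exact map_add (Lp.toTemperedDistributionCLM ℂ (volume : Measure ℝ) ⊤) _ _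

theorem bdist_smul (c : ℂ) (f : ℝ →ᵇ ℂ) : bdist (c • f) = c • bdist f := by
  have : toLinf (c • f) = c • toLinf f := rfl
  rw [bdist, this]
  exact map_smul (Lp.toTemperedDistributionCLM ℂ (volume : Measure ℝ) ⊤) _ _

theorem bdist_sub (f g : ℝ →ᵇ ℂ) : bdist (f - g) = bdist f - bdist g := by
  have : toLinf (f - g) = toLinf f - toLinf g := rfl
  rw [bdist, this]
  exact map_sub (Lp.toTemperedDistributionCLM ℂ (volume : Measure ℝ) ⊤) _ _

theorem bdist_refl (f : ℝ →ᵇ ℂ) (k : 𝓢(ℝ, ℂ)) (x : ℝ) : bdist f (refl x k) = conv k f x := by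
  rw [bdist_apply, conv_apply]
  simp_rw [refl_apply]

/-- Convolution of a distribution with a Schwartz kernel, as a Fourier multiplier. -/
def cv (k : 𝓢(ℝ, ℂ)) (u : 𝓢'(ℝ, ℂ)) : 𝓢'(ℝ, ℂ) :=
  TemperedDistribution.fourierMultiplierCLM ℂ (𝓕 k : 𝓢(ℝ, ℂ)) u

theorem cv_cv {k l m : 𝓢(ℝ, ℂ)} (h : ∀ ξ, 𝓕 m ξ = 𝓕 k ξ * 𝓕 l ξ) (u : 𝓢'(ℝ, ℂ)) :
    cv k (cv l u) = cv m u := by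
  have h' : ((𝓕 m : 𝓢(ℝ, ℂ)) : ℝ → ℂ) = (𝓕 l : 𝓢(ℝ, ℂ)) * (𝓕 k : 𝓢(ℝ, ℂ)) := by
    ext ξ
    rw [h, Pi.mul_apply, mul_comm]
  rw [cv, cv, cv, h', TemperedDistribution.fourierMultiplierCLM_fourierMultiplierCLM_apply
    (𝓕 l : 𝓢(ℝ, ℂ)).hasTemperateGrowth (𝓕 k : 𝓢(ℝ, ℂ)).hasTemperateGrowth]

theorem cv_comm (k l : 𝓢(ℝ, ℂ)) (u : 𝓢'(ℝ, ℂ)) : cv k (cv l u) = cv l (cv k u) := by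
  rw [cv, cv, cv, cv, TemperedDistribution.fourierMultiplierCLM_fourierMultiplierCLM_apply
    (𝓕 l : 𝓢(ℝ, ℂ)).hasTemperateGrowth (𝓕 k : 𝓢(ℝ, ℂ)).hasTemperateGrowth,
    TemperedDistribution.fourierMultiplierCLM_fourierMultiplierCLM_apply
    (𝓕 k : 𝓢(ℝ, ℂ)).hasTemperateGrowth (𝓕 l : 𝓢(ℝ, ℂ)).hasTemperateGrowth, mul_comm]

/-- The transpose of the Fourier multiplier with symbol `𝓕 k`, applied to a test function. -/
theorem fourier_mul_fourierInv (k ψ : 𝓢(ℝ, ℂ)) (y : ℝ) :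
    𝓕 (SchwartzMap.smulLeftCLM ℂ (𝓕 k : 𝓢(ℝ, ℂ)) (𝓕⁻ ψ)) y = ∫ x, k (x - y) * ψ x := by
  -- move the Fourier transform from `ψ = 𝓕 (𝓕⁻ ψ)` onto the translated kernel
  set K : 𝓢(ℝ, ℂ) := SchwartzMap.compSubConstCLM ℂ y k
  have h := SchwartzMap.integral_fourier_smul_eq K (𝓕⁻ ψ)
  rw [FourierTransform.fourier_fourierInv_eq] at h
  have h1 : ∀ x, K x • ψ x = k (x - y) * ψ x := fun x => rfl
  simp_rw [h1] at h
  rw [← h, SchwartzMap.fourier_coe, Real.fourier_eq']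
  congr 1
  ext ξ
  have h2 : 𝓕 K ξ = Complex.exp (↑(-2 * Real.pi * inner ℝ ξ y) * Complex.I) * 𝓕 k ξ := by
    rw [SchwartzMap.fourier_coe, SchwartzMap.fourier_coe, Real.fourier_eq', Real.fourier_eq',
      ← integral_add_right_eq_self _ y, ← integral_const_mul]
    congr 1
    ext x
    have h3 : K (x + y) = k x := by simp [K]
    rw [h3, smul_eq_mul, smul_eq_mul, ← mul_assoc, ← Complex.exp_add]
    congr 2
    simp only [RCLike.inner_apply, conj_trivial]
    push_cast
    ring
  rw [SchwartzMap.smulLeftCLM_apply_apply (𝓕 k : 𝓢(ℝ, ℂ)).hasTemperateGrowth, h2]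
  simp only [smul_eq_mul, mul_assoc]

/-- The Fourier multiplier with symbol `𝓕 k` acts on bounded functions by convolution with `k`. -/
theorem cv_toTemperedDistribution (k : 𝓢(ℝ, ℂ)) (g : Lp ℂ ⊤ (volume : Measure ℝ)) :
    cv k (Lp.toTemperedDistribution g) = bdist (convL k g) := by
  ext ψ
  rw [bdist_apply, cv, TemperedDistribution.fourierMultiplierCLM_apply_apply,
    Lp.toTemperedDistribution_apply]
  simp_rw [fourier_mul_fourierInv]
  have h1 : ∀ x, ψ x * convL k g x = ∫ y, ψ x * (k (x - y) * g y) := fun x =>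
    (integral_const_mul _ _).symm
  simp_rw [h1]
  rw [integral_integral_swap]
  · congr 1
    ext y
    rw [smul_eq_mul, ← integral_mul_const]
    congr 1
    ext x
    ring
  · have h2 : Integrable (fun p : ℝ × ℝ => (‖ψ p.1‖ * ‖k (p.1 - p.2)‖) * ‖g‖)
        (volume.prod volume) := by
      have h3 := Integrable.convolution_integrand (μ := (volume : Measure ℝ)) (ν := volume)
        (L := ContinuousLinearMap.mul ℝ ℝ) ψ.integrable.norm (k.integrable.comp_neg).norm
      have h4 := (h3.swap).mul_const ‖g‖
      refine h4.congr (ae_of_all _ fun p => ?_)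
      simp [neg_sub]
    refine h2.mono' ?_ ?_
    · have hg : AEStronglyMeasurable (fun p : ℝ × ℝ => g p.2) (volume.prod volume) :=
        (Lp.aestronglyMeasurable g).comp_snd
      have hk : Continuous fun p : ℝ × ℝ => ψ p.1 * k (p.1 - p.2) := by
        have := k.continuous
        have := ψ.continuous
        fun_prop
      refine (hk.aestronglyMeasurable.mul hg).congr (ae_of_all _ fun p => ?_)
      simp [Function.uncurry, mul_assoc]
    · have : ∀ᵐ p : ℝ × ℝ ∂(volume.prod volume), ‖g p.2‖ ≤ ‖g‖ :=
        Measure.quasiMeasurePreserving_snd.ae (ae_norm_le g)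
      filter_upwards [this] with p hp
      simp only [Function.uncurry, norm_mul, ← mul_assoc]
      gcongr

theorem cv_bdist (k : 𝓢(ℝ, ℂ)) (f : ℝ →ᵇ ℂ) : cv k (bdist f) = bdist (conv k f) :=
  cv_toTemperedDistribution k (toLinf f)

theorem conv_conv {k l m : 𝓢(ℝ, ℂ)} (h : ∀ ξ, 𝓕 m ξ = 𝓕 k ξ * 𝓕 l ξ) (f : ℝ →ᵇ ℂ) :
    conv k (conv l f) = conv m f := by
  apply bdist_injective
  rw [← cv_bdist, ← cv_bdist, ← cv_bdist, cv_cv h]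

theorem conv_comm (k l : 𝓢(ℝ, ℂ)) (f : ℝ →ᵇ ℂ) : conv k (conv l f) = conv l (conv k f) := by
  apply bdist_injective
  simp only [← cv_bdist]
  rw [cv_comm]

/-! ### The heat semigroup on bounded continuous functions -/

/-- The heat semigroup `P_τ`, for `τ > 0`. -/
def P (τ : ℝ) (f : ℝ →ᵇ ℂ) : ℝ →ᵇ ℂ := conv (gk τ) f

/-- The operator `∂_x P_τ`, for `τ > 0`. -/
def Q (τ : ℝ) (f : ℝ →ᵇ ℂ) : ℝ →ᵇ ℂ := conv (dk (gk τ)) f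

/-- The `L¹` norm of the derivative of the standard Gaussian. -/
def c1 : ℝ := L1 (dk g1)

theorem c1_nonneg : 0 ≤ c1 := L1_nonneg _

theorem L1_dk_gk' {τ : ℝ} (h : 0 < τ) : L1 (dk (gk τ)) = c1 * τ ^ (-(1 / 2) : ℝ) := by
  rw [L1_dk_gk h, c1, Real.sqrt_eq_rpow, ← Real.rpow_neg h.le, mul_comm]

theorem norm_P_le {τ : ℝ} (h : 0 < τ) (f : ℝ →ᵇ ℂ) : ‖P τ f‖ ≤ ‖f‖ := by
  have := norm_conv_le_L1 (gk τ) f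
  rwa [L1_gk h, one_mul] at this

theorem norm_Q_le {τ : ℝ} (h : 0 < τ) (f : ℝ →ᵇ ℂ) :
    ‖Q τ f‖ ≤ c1 * τ ^ (-(1 / 2) : ℝ) * ‖f‖ := by
  have := norm_conv_le_L1 (dk (gk τ)) f
  rwa [L1_dk_gk' h] at this

theorem P_sub (τ : ℝ) (f g : ℝ →ᵇ ℂ) : P τ (f - g) = P τ f - P τ g := conv_sub _ _ _

theorem Q_sub (τ : ℝ) (f g : ℝ →ᵇ ℂ) : Q τ (f - g) = Q τ f - Q τ g := conv_sub _ _ _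

theorem P_P {s t : ℝ} (hs : 0 < s) (ht : 0 < t) (f : ℝ →ᵇ ℂ) : P s (P t f) = P (s + t) f := by
  refine conv_conv (fun ξ => ?_) f
  rw [fourier_gk hs, fourier_gk ht, fourier_gk (add_pos hs ht), ← Complex.ofReal_mul, ← Real.exp_add]
  congr 2
  ring

theorem Q_P {s t : ℝ} (hs : 0 < s) (ht : 0 < t) (f : ℝ →ᵇ ℂ) : Q s (P t f) = Q (s + t) f := by
  refine conv_conv (fun ξ => ?_) f
  rw [fourier_dk, fourier_dk, mul_assoc _ (𝓕 (gk s) ξ)]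
  congr 1
  rw [fourier_gk hs, fourier_gk ht, fourier_gk (add_pos hs ht), ← Complex.ofReal_mul,
    ← Real.exp_add]
  congr 2
  ring

theorem P_Q {s t : ℝ} (hs : 0 < s) (ht : 0 < t) (f : ℝ →ᵇ ℂ) : P s (Q t f) = Q (s + t) f := by
  rw [P, Q, conv_comm]
  exact (Q_P ht hs f).trans (by rw [add_comm])

theorem P_shift (τ h : ℝ) (f : ℝ →ᵇ ℂ) : P τ (shift h f) = shift h (P τ f) := conv_shift _ _ _

theorem Q_shift (τ h : ℝ) (f : ℝ →ᵇ ℂ) : Q τ (shift h f) = shift h (Q τ f) := conv_shift _ _ _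

/-- `P_ε f → f` pointwise. -/
theorem tendsto_P (f : ℝ →ᵇ ℂ) (x : ℝ) : Tendsto (fun ε => P ε f x) (𝓝[>] 0) (𝓝 (f x)) := by
  have h1 : ∀ ε > 0, P ε f x = ∫ z, g1 z * f (x - √ε * z) := by
    intro ε hε
    have hs : 0 < √ε := Real.sqrt_pos.mpr hε
    have h := Measure.integral_comp_mul_left (fun z : ℝ => g1 z * f (x - √ε * z)) (√ε)⁻¹
    have h2 : ∀ y, gk ε y * f (x - y)
        = ((√ε)⁻¹ : ℝ) • (fun z : ℝ => g1 z * f (x - √ε * z)) ((√ε)⁻¹ * y) := by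
      intro y
      simp only [gk, dil_apply (inv_pos.mpr hs), mul_inv_cancel_left₀ hs.ne', Complex.real_smul,
        mul_assoc]
    rw [P, conv_apply']
    simp_rw [h2]
    rw [integral_smul, h, inv_inv, abs_of_pos hs, smul_smul, inv_mul_cancel₀ hs.ne', one_smul]
  have h2 : ∫ z, g1 z * f x = f x := by
    rw [integral_mul_const]
    have : ∫ z, g1 z = 1 := by
      have := integral_gk one_pos
      have h3 : gk 1 = g1 := by ext z; rw [gk, dil_apply (by norm_num)]; simp
      rwa [h3] at this
    rw [this, one_mul]
  have h3 : Tendsto (fun ε => ∫ z, g1 z * f (x - √ε * z)) (𝓝[>] 0) (𝓝 (∫ z, g1 z * f x)) := by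
    refine tendsto_integral_filter_of_dominated_convergence (fun z => ‖g1 z‖ * ‖f‖)
      (Eventually.of_forall fun ε => ?_) (Eventually.of_forall fun ε => ae_of_all _ fun z => ?_)
      (g1.integrable.norm.mul_const _) (ae_of_all _ fun z => ?_)
    · have := g1.continuous
      exact Continuous.aestronglyMeasurable (by fun_prop)
    · rw [norm_mul]
      gcongr
      exact f.norm_coe_le_norm _
    · refine Tendsto.const_mul _ ((f.continuous.tendsto x).comp ?_)
      have h4 : Tendsto (fun ε => x - √ε * z) (𝓝 0) (𝓝 (x - √0 * z)) :=
        Continuous.tendsto (by fun_prop) 0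
      simpa using h4.mono_left nhdsWithin_le_nhds
  rw [h2] at h3
  refine h3.congr' ?_
  filter_upwards [self_mem_nhdsWithin] with ε hε
  exact (h1 ε hε).symm

/-- A closed bound which holds for all `P_ε f` holds for `f`. -/
theorem norm_le_of_forall_P {f : ℝ →ᵇ ℂ} {C ε₀ : ℝ} (hε₀ : 0 < ε₀) {x : ℝ}
    (h : ∀ ε, 0 < ε → ε < ε₀ → ‖P ε f x‖ ≤ C) : ‖f x‖ ≤ C := by
  refine le_of_tendsto (tendsto_P f x).norm ?_
  filter_upwards [Ioo_mem_nhdsGT hε₀] with ε hε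
  exact h ε hε.1 hε.2

/-! ### Hölder bounds -/

/-- `f` is bounded by `K` and `γ`-Hölder continuous with constant `K`. -/
def HB {E : Type*} [NormedAddCommGroup E] (γ K : ℝ) (f : ℝ → E) : Prop :=
  (∀ x, ‖f x‖ ≤ K) ∧ ∀ x y, ‖f x - f y‖ ≤ K * |x - y| ^ γ

theorem HB.nonneg {E : Type*} [NormedAddCommGroup E] {γ K : ℝ} {f : ℝ → E} (h : HB γ K f) :
    0 ≤ K := (norm_nonneg _).trans (h.1 0)

theorem HB.mono {E : Type*} [NormedAddCommGroup E] {γ K K' : ℝ} {f : ℝ → E} (h : HB γ K f)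
    (hK : K ≤ K') : HB γ K' f :=
  ⟨fun x => (h.1 x).trans hK, fun x y => (h.2 x y).trans (by gcongr)⟩

/-- A bound on a bounded continuous function and its increments gives a Hölder bound. -/
theorem HB.of_shift {γ K : ℝ} {f : ℝ →ᵇ ℂ} (h1 : ‖f‖ ≤ K)
    (h2 : ∀ h, ‖shift h f - f‖ ≤ K * |h| ^ γ) : HB γ K f := by
  refine ⟨fun x => (f.norm_coe_le_norm x).trans h1, fun x y => ?_⟩
  have := ((shift (x - y) f - f).norm_coe_le_norm y).trans (h2 (x - y))
  simpa using this

theorem HB.norm_le {γ K : ℝ} {f : ℝ →ᵇ ℂ} (h : HB γ K f) : ‖f‖ ≤ K :=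
  (BoundedContinuousFunction.norm_le h.nonneg).mpr h.1

theorem HB.shift_le {γ K : ℝ} {f : ℝ →ᵇ ℂ} (h : HB γ K f) (a : ℝ) :
    ‖shift a f - f‖ ≤ K * |a| ^ γ := by
  refine (BoundedContinuousFunction.norm_le (mul_nonneg h.nonneg (by positivity))).mpr fun x => ?_
  simpa using h.2 (x + a) x

theorem HB.P {γ K τ : ℝ} {f : ℝ →ᵇ ℂ} (h : HB γ K f) (hτ : 0 < τ) : HB γ K (P τ f) := by
  refine HB.of_shift ((norm_P_le hτ f).trans h.norm_le) fun a => ?_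
  rw [← P_shift, ← P_sub]
  exact (norm_P_le hτ _).trans (h.shift_le a)

/-- Lowering the Hölder exponent costs a factor `2`. -/
theorem HB.lower {E : Type*} [NormedAddCommGroup E] {γ η K : ℝ} {f : ℝ → E} (h : HB γ K f)
    (h0 : 0 ≤ η) (hη : η ≤ γ) : HB η (2 * K) f := by
  have hK := h.nonneg
  refine ⟨fun x => (h.1 x).trans (by linarith), fun x y => ?_⟩
  rcases le_total |x - y| 1 with h1 | h1
  · have h2 : |x - y| ^ γ ≤ |x - y| ^ η := by
      rcases eq_or_lt_of_le (abs_nonneg (x - y)) with h3 | h3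
      · rcases eq_or_lt_of_le h0 with h4 | h4
        · rw [← h4, Real.rpow_zero]
          exact Real.rpow_le_one (abs_nonneg _) h1 (h0.trans hη)
        · rw [← h3, Real.zero_rpow h4.ne', Real.zero_rpow (h4.trans_le hη).ne']
      · exact Real.rpow_le_rpow_of_exponent_ge h3 h1 hη
    refine (h.2 x y).trans ?_
    have : 0 ≤ |x - y| ^ η := by positivity
    nlinarith
  · have h2 : 1 ≤ |x - y| ^ η := Real.one_le_rpow h1 h0
    calc ‖f x - f y‖ ≤ ‖f x‖ + ‖f y‖ := norm_sub_le _ _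
      _ ≤ 2 * K := by linarith [h.1 x, h.1 y]
      _ ≤ _ := le_mul_of_one_le_right (by positivity) h2

theorem HB.mul {γ K L : ℝ} {f g : ℝ → ℂ} (hf : HB γ K f) (hg : HB γ L g) :
    HB γ (2 * K * L) fun x => f x * g x := by
  have hK := hf.nonneg
  have hL := hg.nonneg
  refine ⟨fun x => ?_, fun x y => ?_⟩
  · rw [norm_mul]
    have := mul_le_mul (hf.1 x) (hg.1 x) (norm_nonneg _) hK
    nlinarith [mul_nonneg hK hL]
  · have h1 : f x * g x - f y * g y = (f x - f y) * g x + f y * (g x - g y) := by ring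
    rw [h1]
    refine (norm_add_le _ _).trans ?_
    rw [norm_mul, norm_mul]
    have h2 := mul_le_mul (hf.2 x y) (hg.1 x) (norm_nonneg _) (by positivity)
    have h3 := mul_le_mul (hf.1 y) (hg.2 x y) (norm_nonneg _) hK
    nlinarith

/-- Interpolation between a trivial bound and a Lipschitz bound. -/
theorem min_two_mul_le {c x γ : ℝ} (hc : 0 ≤ c) (hx : 0 ≤ x) (h0 : 0 ≤ γ) (h1 : γ ≤ 1) :
    min 2 (c * x) ≤ (2 + c) * x ^ γ := by
  have hp : 0 ≤ x ^ γ := by positivity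
  rcases le_total x 1 with h | h
  · refine (min_le_right _ _).trans ?_
    rcases eq_or_lt_of_le hx with h3 | h3
    · rw [← h3, mul_zero]; positivity
    · have := Real.rpow_le_rpow_of_exponent_ge h3 h h1
      rw [Real.rpow_one] at this
      nlinarith
  · refine (min_le_left _ _).trans ?_
    have := Real.one_le_rpow h h0
    nlinarith

/-- Smoothing by the heat semigroup, measured in a Hölder norm. -/
theorem norm_shift_P_sub_le {γ τ : ℝ} (h0 : 0 ≤ γ) (h1 : γ ≤ 1) (hτ : 0 < τ) (f : ℝ →ᵇ ℂ) (a : ℝ) :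
    ‖shift a (P τ f) - P τ f‖ ≤ (2 + c1) * τ ^ (-(γ / 2)) * ‖f‖ * |a| ^ γ := by
  have hc := c1_nonneg
  refine (BoundedContinuousFunction.norm_le (by positivity)).mpr fun x => ?_
  have hA : ‖P τ f (x + a) - P τ f x‖ ≤ 2 * ‖f‖ := by
    refine (norm_sub_le _ _).trans ?_
    linarith [((P τ f).norm_coe_le_norm (x + a)).trans (norm_P_le hτ f),
      ((P τ f).norm_coe_le_norm x).trans (norm_P_le hτ f)]
  have hB : ‖P τ f (x + a) - P τ f x‖ ≤ (c1 * (τ ^ (-(1 / 2) : ℝ) * |a|)) * ‖f‖ := by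
    have := norm_conv_sub_le (gk τ) f (x + a) x
    rw [L1_dk_gk' hτ, add_sub_cancel_left] at this
    exact this.trans (le_of_eq (by ring))
  have h2 := min_two_mul_le hc (x := τ ^ (-(1 / 2) : ℝ) * |a|) (by positivity) h0 h1
  rw [Real.mul_rpow (by positivity) (abs_nonneg a), ← Real.rpow_mul hτ.le] at h2
  have h3 : ‖P τ f (x + a) - P τ f x‖ ≤ min 2 (c1 * (τ ^ (-(1 / 2) : ℝ) * |a|)) * ‖f‖ := by
    rw [min_mul_of_nonneg _ _ (norm_nonneg f)]
    exact le_min hA hB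
  refine (h3.trans (mul_le_mul_of_nonneg_right h2 (norm_nonneg f))).trans (le_of_eq ?_)
  rw [show -(1 / 2) * γ = -(γ / 2) by ring]
  ring

/-- The Schauder estimate for `∂_x P_τ`, from a space of negative regularity `-2a` (expressed
through the heat semigroup) to the Hölder space of order `γ`. -/
theorem HB_Q {γ a S A τ : ℝ} (h0 : 0 ≤ γ) (h1 : γ ≤ 1) (hA : 0 ≤ A) {H : ℝ →ᵇ ℂ}
    (hH : ∀ σ, 0 < σ → σ ≤ S → ‖P σ H‖ ≤ A * σ ^ (-a)) (hτ : 0 < τ) (hS : τ ≤ S) :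
    HB γ (c1 * (1 + (2 + c1)) * (1 + S ^ (γ / 2)) * 3 ^ (1 / 2 + a + γ / 2) *
      A * τ ^ (-(1 / 2 + a + γ / 2))) (Q τ H) := by
  have hc := c1_nonneg
  -- one third of the time is spent on the derivative, one on the Hölder regularity, one on `H`
  set σ := τ / 3 with hσ
  have hσ0 : 0 < σ := by positivity
  have hQ : Q τ H = Q σ (P σ (P σ H)) := by
    rw [Q_P hσ0 hσ0, Q_P (by positivity) hσ0]
    congr 1
    rw [hσ]; ring
  have e1 : (3 : ℝ) ^ (1 / 2 + a + γ / 2) * τ ^ (-(1 / 2 + a + γ / 2))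
      = σ ^ (-(1 / 2) : ℝ) * σ ^ (-a) * σ ^ (-(γ / 2)) := by
    rw [← Real.rpow_add hσ0, ← Real.rpow_add hσ0, hσ, Real.div_rpow hτ.le (by norm_num),
      Real.rpow_neg hτ.le, show -(1 / 2) + -a + -(γ / 2) = -(1 / 2 + a + γ / 2) by ring,
      Real.rpow_neg hτ.le, Real.rpow_neg (by norm_num : (0 : ℝ) ≤ 3), div_inv_eq_mul, mul_comm]
  have hPσ := hH σ hσ0 (by linarith)
  have hS0 : 0 ≤ S := by linarith
  have hSp : (0 : ℝ) ≤ S ^ (γ / 2) := by positivity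
  have hp1 : 0 ≤ σ ^ (-(1 / 2) : ℝ) * σ ^ (-a) * σ ^ (-(γ / 2)) := by positivity
  have hcon : c1 * (1 + (2 + c1)) * (1 + S ^ (γ / 2)) * 3 ^ (1 / 2 + a + γ / 2) *
      A * τ ^ (-(1 / 2 + a + γ / 2)) = c1 * (1 + (2 + c1)) * (1 + S ^ (γ / 2)) * A *
      (σ ^ (-(1 / 2) : ℝ) * σ ^ (-a) * σ ^ (-(γ / 2))) := by
    rw [← e1]; ring
  rw [hcon, hQ]
  refine HB.of_shift ?_ fun b => ?_
  · have h2 : ‖Q σ (P σ (P σ H))‖ ≤ c1 * σ ^ (-(1 / 2) : ℝ) * (A * σ ^ (-a)) :=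
      (norm_Q_le hσ0 _).trans
        (mul_le_mul_of_nonneg_left ((norm_P_le hσ0 _).trans hPσ) (by positivity))
    have h3 : 1 ≤ S ^ (γ / 2) * σ ^ (-(γ / 2)) := by
      rw [Real.rpow_neg hσ0.le, ← div_eq_mul_inv, one_le_div (by positivity)]
      exact Real.rpow_le_rpow hσ0.le (by linarith) (by linarith)
    calc _ ≤ c1 * σ ^ (-(1 / 2) : ℝ) * (A * σ ^ (-a)) * 1 := by rw [mul_one]; exact h2
      _ ≤ c1 * σ ^ (-(1 / 2) : ℝ) * (A * σ ^ (-a)) * (S ^ (γ / 2) * σ ^ (-(γ / 2))) := by gcongr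
      _ = (c1 * 1 * (S ^ (γ / 2)) * A) *
          (σ ^ (-(1 / 2) : ℝ) * σ ^ (-a) * σ ^ (-(γ / 2))) := by ring
      _ ≤ _ := by gcongr <;> linarith
  · have h2 : shift b (Q σ (P σ (P σ H))) - Q σ (P σ (P σ H))
        = Q σ (shift b (P σ (P σ H)) - P σ (P σ H)) := by
      rw [← Q_shift, ← Q_sub]
    rw [h2]
    have h3 := norm_shift_P_sub_le h0 h1 hσ0 (P σ H) b
    calc _ ≤ c1 * σ ^ (-(1 / 2) : ℝ) * ((2 + c1) * σ ^ (-(γ / 2)) * (A * σ ^ (-a)) * |b| ^ γ) := by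
          refine (norm_Q_le hσ0 _).trans (mul_le_mul_of_nonneg_left (h3.trans ?_) (by positivity))
          gcongr
      _ = c1 * (2 + c1) * 1 * A *
          (σ ^ (-(1 / 2) : ℝ) * σ ^ (-a) * σ ^ (-(γ / 2))) * |b| ^ γ := by ring
      _ ≤ _ := by
        gcongr ?_ * ?_ * _ * _ * _
        · exact mul_le_mul_of_nonneg_left (by linarith) hc
        · linarith

/-! ### The product of a Hölder function and a function of negative regularity -/

/-- The commutator of multiplication by a `γ`-Hölder function with `P_τ` gains `τ^{γ/2}`, since
`|f(x - y) - f(x)| ≤ K |y|^γ` under the Gaussian. -/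
theorem norm_commutator_le {γ K τ : ℝ} (h0 : 0 ≤ γ) (h2 : γ ≤ 2) (hτ : 0 < τ) {f : ℝ →ᵇ ℂ}
    (hf : HB γ K f) (g : ℝ →ᵇ ℂ) :
    ‖P τ (f * g) - f * P τ g‖ ≤ K * (mom γ g1 * τ ^ (γ / 2)) * ‖g‖ := by
  have hK := hf.nonneg
  have hm := mom_nonneg γ g1
  refine (BoundedContinuousFunction.norm_le (by positivity)).mpr fun x => ?_
  have h1 : (P τ (f * g) - f * P τ g) x = ∫ y, gk τ y * ((f (x - y) - f x) * g (x - y)) := by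
    have h3 : ∀ y, gk τ y * ((f (x - y) - f x) * g (x - y))
        = gk τ y * (f * g) (x - y) - f x * (gk τ y * g (x - y)) := fun y => by
      simp only [BoundedContinuousFunction.mul_apply]; ring
    simp_rw [h3]
    rw [integral_sub (integrable_kernel_mul _ _ _) ((integrable_kernel_mul _ _ _).const_mul _),
      integral_const_mul]
    simp only [BoundedContinuousFunction.sub_apply, BoundedContinuousFunction.mul_apply, P,
      conv_apply']
  rw [h1]
  have h4 : ∫ y, ‖gk τ y‖ * |y| ^ γ * (K * ‖g‖) = K * (mom γ g1 * τ ^ (γ / 2)) * ‖g‖ := by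
    rw [integral_mul_const]
    have := mom_gk hτ γ
    rw [mom] at this
    rw [this]
    ring
  rw [← h4]
  refine norm_integral_le_of_norm_le ((integrable_mom h0 h2 _).mul_const _) (ae_of_all _ fun y => ?_)
  rw [norm_mul, norm_mul, mul_assoc]
  have h5 := hf.2 (x - y) x
  rw [show x - y - x = -y by ring, abs_neg] at h5
  have h6 := mul_le_mul h5 (g.norm_coe_le_norm (x - y)) (norm_nonneg _) (by positivity)
  refine mul_le_mul_of_nonneg_left (h6.trans (le_of_eq (by ring))) (norm_nonneg _)

/-- The commutator `P_τ (f h) - f P_τ h` gains the regularity of `f`. Halving `τ` changes it only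
by a commutator of `f` with the smoother function `P_{τ/2} h`, and these changes form a
geometric series, as `a < γ / 2`. -/
theorem norm_commutator_le_of_P_le {γ K a S M τ : ℝ} (h2 : γ ≤ 2) (ha : 0 ≤ a)
    (haγ : a < γ / 2) (hM : 0 ≤ M) {f h : ℝ →ᵇ ℂ} (hf : HB γ K f)
    (hh : ∀ σ, 0 < σ → σ ≤ S → ‖P σ h‖ ≤ M * σ ^ (-a)) (hτ : 0 < τ) (hS : τ ≤ S) :
    ‖P τ (f * h) - f * P τ h‖
      ≤ mom γ g1 / (1 - 2 ^ (-(γ / 2 - a)) : ℝ) * K * M * τ ^ (γ / 2 - a) := by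
  have hK := hf.nonneg
  have hm := mom_nonneg γ g1
  set e := γ / 2 - a with he
  have he0 : 0 < e := by rw [he]; linarith
  set r : ℝ := 2 ^ (-e) with hr
  have hr0 : 0 < r := by positivity
  have hr1 : r < 1 := Real.rpow_lt_one_of_one_lt_of_neg (by norm_num) (by linarith)
  set A : ℝ → ℝ →ᵇ ℂ := fun τ => P τ (f * h) - f * P τ h with hAdef
  have step : ∀ σ, 0 < σ → 2 * σ ≤ S → ‖A (2 * σ)‖ ≤ ‖A σ‖ + mom γ g1 * K * M * σ ^ e := by
    intro σ hσ hσS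
    have h3 : A (2 * σ) = P σ (A σ) + (P σ (f * P σ h) - f * P σ (P σ h)) := by
      simp only [hAdef]
      rw [P_sub, two_mul, P_P hσ hσ, P_P hσ hσ]
      abel
    rw [h3]
    refine (norm_add_le _ _).trans (add_le_add (norm_P_le hσ _) ?_)
    refine (norm_commutator_le (by linarith) h2 hσ hf _).trans ?_
    have h4 := hh σ hσ (by linarith)
    calc _ ≤ K * (mom γ g1 * σ ^ (γ / 2)) * (M * σ ^ (-a)) := by gcongr
      _ = mom γ g1 * K * M * (σ ^ (γ / 2) * σ ^ (-a)) := by ring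
      _ = _ := by rw [← Real.rpow_add hσ, he, sub_eq_add_neg]
  -- the increments of `1 - r ^ n` dominate the terms of the geometric series
  have it : ∀ n : ℕ, ‖A τ‖ ≤ ‖A (τ / 2 ^ n)‖
      + mom γ g1 / (1 - r) * K * M * τ ^ e * (1 - r ^ n) := by
    intro n
    induction n with
    | zero => simp
    | succ n ih =>
      have hpos : 0 < τ / 2 ^ (n + 1) := by positivity
      have h5 : 2 * (τ / 2 ^ (n + 1)) = τ / 2 ^ n := by rw [pow_succ]; field_simp
      have h6 := step (τ / 2 ^ (n + 1)) hpos (by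
        rw [h5]; exact (div_le_self hτ.le (one_le_pow₀ (by norm_num))).trans hS)
      rw [h5] at h6
      have h7 : (τ / 2 ^ (n + 1)) ^ e ≤ τ ^ e * r ^ n := by
        have h8 : (τ / 2 ^ (n + 1)) ^ e = τ ^ e * r ^ (n + 1) := by
          rw [Real.div_rpow hτ.le (by positivity), div_eq_mul_inv, hr, ← Real.rpow_natCast,
            ← Real.rpow_mul (by norm_num), ← Real.rpow_neg (by norm_num), ← Real.rpow_natCast,
            ← Real.rpow_mul (by norm_num)]
          congr 2
          ring
        rw [h8, pow_succ]
        have : r ^ n * r ≤ r ^ n := mul_le_of_le_one_right (by positivity) hr1.le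
        gcongr
      have h9 : mom γ g1 * K * M * (τ / 2 ^ (n + 1)) ^ e
          ≤ mom γ g1 / (1 - r) * K * M * τ ^ e * (r ^ n - r ^ (n + 1)) := by
        calc _ ≤ mom γ g1 * K * M * (τ ^ e * r ^ n) := by gcongr
          _ = _ := by
            have : 1 - r ≠ 0 := by linarith
            rw [pow_succ]
            field_simp
      nlinarith
  have lim : Tendsto (fun n : ℕ => K * (mom γ g1 * (τ / 2 ^ n) ^ (γ / 2)) * ‖h‖
      + mom γ g1 / (1 - r) * K * M * τ ^ e) atTop
      (𝓝 (K * (mom γ g1 * 0 ^ (γ / 2)) * ‖h‖ + mom γ g1 / (1 - r) * K * M * τ ^ e)) := by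
    have h1 : Tendsto (fun n : ℕ => τ / 2 ^ n) atTop (𝓝 0) :=
      tendsto_const_nhds.div_atTop (tendsto_pow_atTop_atTop_of_one_lt (by norm_num))
    have h2 := h1.rpow_const (p := γ / 2) (Or.inr (by linarith))
    exact (((h2.const_mul _).const_mul _).mul_const _).add_const _
  rw [Real.zero_rpow (by linarith), mul_zero, mul_zero, zero_mul, zero_add] at lim
  refine ge_of_tendsto' lim fun n => (it n).trans ?_
  have h10 : 0 ≤ mom γ g1 / (1 - r) * K * M * τ ^ e :=
    mul_nonneg (mul_nonneg (mul_nonneg (div_nonneg hm (by linarith)) hK) hM) (by positivity)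
  have h11 : 0 ≤ r ^ n := by positivity
  have h12 := norm_commutator_le (by linarith) h2 (show 0 < τ / 2 ^ n by positivity) hf h
  have : ‖A (τ / 2 ^ n)‖ ≤ K * (mom γ g1 * (τ / 2 ^ n) ^ (γ / 2)) * ‖h‖ := h12
  nlinarith

/-- The constant in `norm_P_mul_le`. -/
def cprod (γ a S : ℝ) : ℝ := 1 + mom γ g1 / (1 - 2 ^ (-(γ / 2 - a)) : ℝ) * S ^ (γ / 2)

theorem cprod_nonneg {γ a S : ℝ} (haγ : a < γ / 2) (hS : 0 ≤ S) : 0 ≤ cprod γ a S := by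
  have h1 : (2 : ℝ) ^ (-(γ / 2 - a)) < 1 :=
    Real.rpow_lt_one_of_one_lt_of_neg (by norm_num) (by linarith)
  have := mom_nonneg γ g1
  exact add_nonneg zero_le_one (mul_nonneg (div_nonneg this (by linarith)) (by positivity))

/-- Multiplication by a `γ`-Hölder function preserves the negative regularity `-2a > -γ`. -/
theorem norm_P_mul_le {γ K a S M τ : ℝ} (h2 : γ ≤ 2) (ha : 0 ≤ a)
    (haγ : a < γ / 2) (hM : 0 ≤ M) {f h : ℝ →ᵇ ℂ} (hf : HB γ K f)
    (hh : ∀ σ, 0 < σ → σ ≤ S → ‖P σ h‖ ≤ M * σ ^ (-a)) (hτ : 0 < τ) (hS : τ ≤ S) :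
    ‖P τ (f * h)‖ ≤ cprod γ a S * K * M * τ ^ (-a) := by
  have hK := hf.nonneg
  have h1 : (2 : ℝ) ^ (-(γ / 2 - a)) < 1 :=
    Real.rpow_lt_one_of_one_lt_of_neg (by norm_num) (by linarith)
  have h3 := norm_commutator_le_of_P_le h2 ha haγ hM hf hh hτ hS
  have h4 : ‖f * P τ h‖ ≤ K * (M * τ ^ (-a)) :=
    (norm_mul_le _ _).trans (mul_le_mul hf.norm_le (hh τ hτ hS) (norm_nonneg _) hK)
  have h5 : P τ (f * h) = (P τ (f * h) - f * P τ h) + f * P τ h := by abel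
  have h6 : τ ^ (γ / 2 - a) ≤ S ^ (γ / 2) * τ ^ (-a) := by
    rw [sub_eq_add_neg, Real.rpow_add hτ]
    have := Real.rpow_le_rpow hτ.le hS (by linarith : 0 ≤ γ / 2)
    gcongr
  rw [h5]
  refine (norm_add_le _ _).trans ((add_le_add (h3.trans
    (mul_le_mul_of_nonneg_left h6 ?_)) h4).trans (le_of_eq ?_))
  · exact mul_nonneg (mul_nonneg (div_nonneg (mom_nonneg _ _) (by linarith)) hK) hM
  · rw [cprod]; ring

/-! ### Time regularity of the heat semigroup -/

theorem P_sub_apply {d : ℝ} (hd : 0 < d) (v : ℝ →ᵇ ℂ) (x : ℝ) :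
    (P d v - v) x = ∫ y, gk d y * (v (x - y) - v x) := by
  simp_rw [mul_sub]
  rw [integral_sub (integrable_kernel_mul _ _ _) ((gk d).integrable.mul_const _),
    integral_mul_const, integral_gk hd, one_mul, ← conv_apply']
  rfl

theorem norm_P_sub_le_of_lipschitz {d L : ℝ} (hd : 0 < d) (hL : 0 ≤ L) {v : ℝ →ᵇ ℂ}
    (hv : ∀ x y, ‖v x - v y‖ ≤ L * |x - y|) :
    ‖P d v - v‖ ≤ L * (mom 1 g1 * d ^ (1 / 2 : ℝ)) := by
  have hm := mom_nonneg 1 g1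
  refine (BoundedContinuousFunction.norm_le (by positivity)).mpr fun x => ?_
  rw [P_sub_apply hd]
  have h4 : ∫ y, ‖gk d y‖ * |y| ^ (1 : ℝ) * L = L * (mom 1 g1 * d ^ (1 / 2 : ℝ)) := by
    rw [integral_mul_const]
    have := mom_gk hd 1
    rw [mom] at this
    rw [this]
    ring
  rw [← h4]
  refine norm_integral_le_of_norm_le ((integrable_mom zero_le_one one_le_two _).mul_const _)
    (ae_of_all _ fun y => ?_)
  have h5 := hv (x - y) x
  rw [show x - y - x = -y by ring, abs_neg] at h5
  rw [norm_mul, mul_assoc, Real.rpow_one]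
  refine mul_le_mul_of_nonneg_left (h5.trans (le_of_eq (by ring))) (norm_nonneg _)

theorem integral_mul_gk {d : ℝ} (hd : 0 < d) : ∫ y, gk d y * (y : ℂ) = 0 := by
  have h := integral_neg_eq_self (fun y : ℝ => gk d y * (y : ℂ)) volume
  have h2 : ∀ y : ℝ, gk d (-y) * ((-y : ℝ) : ℂ) = -(gk d y * (y : ℂ)) := fun y => by
    rw [gk_apply hd, gk_apply hd, gr_neg]; push_cast; ring
  simp_rw [h2, integral_neg] at h
  exact self_eq_neg.mp h.symm

/-- The second order bound: the linear term of the Taylor expansion drops out by symmetry. -/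
theorem norm_P_sub_le_of_deriv_lipschitz {d L : ℝ} (hd : 0 < d) (hL : 0 ≤ L) {v w : ℝ →ᵇ ℂ}
    (hv : ∀ x, HasDerivAt v (w x) x) (hw : ∀ x y, ‖w x - w y‖ ≤ L * |x - y|) :
    ‖P d v - v‖ ≤ L * (mom 2 g1 * d) := by
  have hm := mom_nonneg 2 g1
  refine (BoundedContinuousFunction.norm_le (by positivity)).mpr fun x => ?_
  have hy : Integrable fun y : ℝ => gk d y * (y : ℂ) := by
    refine ((gk d).integrable_pow_mul volume 1).mono' (Continuous.aestronglyMeasurable (by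
      have := (gk d).continuous
      fun_prop)) (ae_of_all _ fun y => le_of_eq ?_)
    rw [norm_mul, Complex.norm_real, pow_one, mul_comm]
  have h1 : (P d v - v) x = ∫ y, gk d y * (v (x - y) - v x + w x * (y : ℂ)) := by
    have h2 : ∀ y : ℝ, gk d y * (v (x - y) - v x + w x * (y : ℂ))
        = gk d y * (v (x - y) - v x) + w x * (gk d y * (y : ℂ)) := fun y => by ring
    simp_rw [h2]
    rw [integral_add _ (hy.const_mul _), integral_const_mul, integral_mul_gk hd, mul_zero,
      add_zero, P_sub_apply hd]
    simp_rw [mul_sub]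
    exact (integrable_kernel_mul _ _ _).sub ((gk d).integrable.mul_const _)
  rw [h1]
  have h4 : ∫ y, ‖gk d y‖ * |y| ^ (2 : ℝ) * L = L * (mom 2 g1 * d) := by
    rw [integral_mul_const]
    have := mom_gk hd 2
    rw [mom] at this
    rw [this, div_self two_ne_zero, Real.rpow_one]
    ring
  rw [← h4]
  refine norm_integral_le_of_norm_le ((integrable_mom zero_le_two le_rfl _).mul_const _)
    (ae_of_all _ fun y => ?_)
  rw [norm_mul, mul_assoc]
  refine mul_le_mul_of_nonneg_left ?_ (norm_nonneg _)
  -- the mean value inequality for `u ↦ v(x - u) + w(x) u` on the segment from `0` to `y`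
  have h5 : ∀ u ∈ uIcc 0 y, HasDerivWithinAt (fun u : ℝ => v (x - u) + w x * (u : ℂ))
      (-w (x - u) + w x) (uIcc 0 y) u := by
    intro u _
    have a1 : HasDerivAt (fun u : ℝ => x - u) (-1) u := by
      simpa using (hasDerivAt_id u).const_sub x
    have a2 := (hv (x - u)).scomp u a1
    have a3 : HasDerivAt (fun u : ℝ => w x * (u : ℂ)) (w x) u := by
      simpa using (Complex.ofRealCLM.hasDerivAt (x := u)).const_mul (w x)
    have := (a2.add a3).hasDerivWithinAt (s := uIcc 0 y)
    rwa [neg_one_smul] at this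
  have h6 : ∀ u ∈ uIcc 0 y, ‖-w (x - u) + w x‖ ≤ L * |y| := by
    intro u hu
    have a1 := hw x (x - u)
    rw [sub_sub_cancel] at a1
    rw [neg_add_eq_sub]
    refine a1.trans (mul_le_mul_of_nonneg_left ?_ hL)
    simpa using abs_sub_left_of_mem_uIcc hu
  have h7 := Convex.norm_image_sub_le_of_norm_hasDerivWithin_le h5 h6 (convex_uIcc 0 y)
    left_mem_uIcc right_mem_uIcc
  simp only [sub_zero, Complex.ofReal_zero, mul_zero, add_zero, Real.norm_eq_abs] at h7
  rw [Real.rpow_two]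
  calc _ = ‖v (x - y) + w x * (y : ℂ) - v x‖ := by congr 1; ring
    _ ≤ L * |y| * |y| := h7
    _ = _ := by rw [sq]; ring

/-- The constant in `norm_Q_add_sub_le`. -/
def cQ : ℝ := 2 * c1 + c1 ^ 3 * 3 ^ (3 / 2 : ℝ) * mom 2 g1

theorem cQ_nonneg : 0 ≤ cQ := by
  have := c1_nonneg
  have := mom_nonneg 2 g1
  unfold cQ
  positivity

/-- Time increments of `∂_x P_τ`. For `d ≤ τ` the gain `d / τ` comes from the second order bound for
`P_d - 1`. -/
theorem norm_Q_add_sub_le {τ d : ℝ} (hτ : 0 < τ) (hd : 0 < d) (H : ℝ →ᵇ ℂ) :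
    ‖Q (τ + d) H - Q τ H‖ ≤ cQ * (min 1 (d / τ) * τ ^ (-(1 / 2) : ℝ)) * ‖H‖ := by
  have hc := c1_nonneg
  have hm := mom_nonneg 2 g1
  have e : Q (τ + d) H = P d (Q τ H) := by rw [P_Q hd hτ, add_comm]
  have hA : ‖Q (τ + d) H - Q τ H‖ ≤ cQ * (1 * τ ^ (-(1 / 2) : ℝ)) * ‖H‖ := by
    rw [e]
    have h1 := norm_Q_le hτ H
    calc _ ≤ ‖P d (Q τ H)‖ + ‖Q τ H‖ := norm_sub_le _ _
      _ ≤ 2 * ‖Q τ H‖ := by linarith [norm_P_le hd (Q τ H)]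
      _ ≤ 2 * (c1 * τ ^ (-(1 / 2) : ℝ) * ‖H‖) := by gcongr
      _ = (2 * c1) * (1 * τ ^ (-(1 / 2) : ℝ)) * ‖H‖ := by ring
      _ ≤ _ := by
        gcongr
        exact le_add_of_nonneg_right (by positivity)
  have hB : ‖Q (τ + d) H - Q τ H‖ ≤ cQ * (d / τ * τ ^ (-(1 / 2) : ℝ)) * ‖H‖ := by
    -- three derivatives fall on three Gaussians of variance `τ / 3`
    set σ := τ / 3 with hσ
    have hσ0 : 0 < σ := by positivity
    have hv : Q τ H = P σ (P σ (Q σ H)) := by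
      rw [P_Q hσ0 hσ0, P_Q hσ0 (by positivity)]
      congr 1
      rw [hσ]; ring
    have hw : Q σ (P σ (Q σ H)) = P σ (Q σ (Q σ H)) := conv_comm _ _ _
    have h1 := norm_P_sub_le_of_deriv_lipschitz hd
      (L := c1 * σ ^ (-(1 / 2) : ℝ) * (c1 * σ ^ (-(1 / 2) : ℝ) * (c1 * σ ^ (-(1 / 2) : ℝ) * ‖H‖)))
      (by positivity) (v := P σ (P σ (Q σ H))) (w := Q σ (P σ (Q σ H)))
      (fun x => hasDerivAt_conv_apply _ _ x) (fun x y => by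
        rw [hw]
        refine (norm_conv_sub_le (gk σ) _ x y).trans ?_
        rw [L1_dk_gk' hσ0]
        have h2 : ‖Q σ (Q σ H)‖
            ≤ c1 * σ ^ (-(1 / 2) : ℝ) * (c1 * σ ^ (-(1 / 2) : ℝ) * ‖H‖) :=
          (norm_Q_le hσ0 _).trans (mul_le_mul_of_nonneg_left (norm_Q_le hσ0 H) (by positivity))
        gcongr)
    rw [e, hv]
    refine h1.trans ?_
    have h3 : σ ^ (-(1 / 2) : ℝ) * σ ^ (-(1 / 2) : ℝ) * σ ^ (-(1 / 2) : ℝ)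
        = 3 ^ (3 / 2 : ℝ) * (τ⁻¹ * τ ^ (-(1 / 2) : ℝ)) := by
      rw [← Real.rpow_add hσ0, ← Real.rpow_add hσ0, ← Real.rpow_neg_one τ, ← Real.rpow_add hτ, hσ,
        Real.div_rpow hτ.le (by norm_num), div_eq_mul_inv, ← Real.rpow_neg (by norm_num)]
      norm_num
      ring
    calc _ = c1 ^ 3 * (σ ^ (-(1 / 2) : ℝ) * σ ^ (-(1 / 2) : ℝ) * σ ^ (-(1 / 2) : ℝ)) * mom 2 g1
          * d * ‖H‖ := by ring
      _ = (c1 ^ 3 * 3 ^ (3 / 2 : ℝ) * mom 2 g1) * (d / τ * τ ^ (-(1 / 2) : ℝ)) * ‖H‖ := by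
          rw [h3]; ring
      _ ≤ _ := by
        gcongr
        exact le_add_of_nonneg_left (by positivity)
  rcases le_total 1 (d / τ) with h | h
  · rwa [min_eq_left h]
  · rwa [min_eq_right h]

/-- The singularity of `∂_x (P_{τ + d} - P_τ)` as a difference, which integrates to `O(√d)`
uniformly on the half-line. -/
theorem min_mul_rpow_le {τ d : ℝ} (hτ : 0 < τ) (hd : 0 < d) :
    min 1 (d / τ) * τ ^ (-(1 / 2) : ℝ)
      ≤ 6 * (τ ^ (-(1 / 2) : ℝ) - (τ + d) ^ (-(1 / 2) : ℝ)) := by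
  rw [Real.rpow_neg hτ.le, Real.rpow_neg (by positivity), ← Real.sqrt_eq_rpow, ← Real.sqrt_eq_rpow]
  set a := √τ
  set b := √(τ + d)
  have ha : 0 < a := Real.sqrt_pos.mpr hτ
  have hb : 0 < b := Real.sqrt_pos.mpr (by positivity)
  have ha2 : a ^ 2 = τ := Real.sq_sqrt hτ.le
  have hb2 : b ^ 2 = τ + d := Real.sq_sqrt (by positivity)
  have hab : a ≤ b := Real.sqrt_le_sqrt (by linarith)
  have e : a⁻¹ - b⁻¹ = (b - a) / b * a⁻¹ := by field_simp
  rw [e, ← mul_assoc]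
  refine mul_le_mul_of_nonneg_right ?_ (by positivity)
  rw [← mul_div_assoc, le_div_iff₀ hb]
  rcases le_total d τ with h | h
  · have h1 : b ≤ 2 * a := by nlinarith
    refine (mul_le_mul_of_nonneg_right (min_le_right _ _) hb.le).trans ?_
    rw [div_mul_eq_mul_div, div_le_iff₀ hτ, ← ha2]
    have h3 : d = (b - a) * (b + a) := by nlinarith
    rw [h3]
    have h4 : (b + a) * b ≤ 6 * a ^ 2 := by nlinarith
    nlinarith [mul_le_mul_of_nonneg_left h4 (sub_nonneg.mpr hab)]
  · refine (mul_le_mul_of_nonneg_right (min_le_left _ _) hb.le).trans ?_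
    nlinarith

/-! ### Littlewood–Paley blocks as convolutions -/

/-- A smooth compactly supported symbol of a real variable, dilated by `2π`, as a Schwartz
function. -/
def symbolSchwartz (m : ℝ → ℝ) (h1 : ContDiff ℝ ∞ m) (h2 : HasCompactSupport m) : 𝓢(ℝ, ℂ) :=
  HasCompactSupport.toSchwartzMap (f := fun ξ : ℝ => ((m (2 * Real.pi * ξ) : ℝ) : ℂ))
    ((h2.comp_homeomorph (Homeomorph.mulLeft₀ (2 * Real.pi) (by positivity))).comp_left
      (g := Complex.ofReal) Complex.ofReal_zero)
    (Complex.ofRealCLM.contDiff.comp (h1.comp (by fun_prop)))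

theorem symbolSchwartz_apply (m : ℝ → ℝ) (h1 : ContDiff ℝ ∞ m) (h2 : HasCompactSupport m) (ξ : ℝ) :
    symbolSchwartz m h1 h2 ξ = ((m (2 * Real.pi * ξ) : ℝ) : ℂ) := rfl

namespace DyadicPartition

variable (D : DyadicPartition)

theorem χ_eq_zero {ξ : ℝ} (h : 4 / 3 < |ξ|) : D.χ ξ = 0 := by
  by_contra h1
  have : |ξ| ≤ 4 / 3 := D.χ_supp (subset_tsupport _ h1)
  linarith

theorem φ_eq_zero {ξ : ℝ} (h : |ξ| < 3 / 4 ∨ 8 / 3 < |ξ|) : D.φ ξ = 0 := by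
  by_contra h1
  have : 3 / 4 ≤ |ξ| ∧ |ξ| ≤ 8 / 3 := D.φ_supp (subset_tsupport _ h1)
  rcases h with h | h <;> linarith [this.1, this.2]

theorem χ_eq_one {ξ : ℝ} (h : |ξ| < 3 / 4) : D.χ ξ = 1 := by
  have h1 := D.sum_eq ξ
  have h2 : (fun j : ℕ => D.φ ((2 : ℝ)⁻¹ ^ j * ξ)) = fun _ => 0 := by
    ext j
    refine D.φ_eq_zero (Or.inl ?_)
    rw [abs_mul, abs_of_pos (by positivity)]
    have : (2 : ℝ)⁻¹ ^ j ≤ 1 := pow_le_one₀ (by norm_num) (by norm_num)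
    nlinarith [abs_nonneg ξ]
  rw [h2] at h1
  have := h1.unique hasSum_zero
  linarith

theorem hasCompactSupport_χ : HasCompactSupport D.χ := by
  refine HasCompactSupport.intro (isCompact_Icc (a := -(4 / 3 : ℝ)) (b := 4 / 3)) fun x hx => ?_
  refine D.χ_eq_zero ?_
  by_contra! h
  exact hx (abs_le.mp h)

theorem hasCompactSupport_φ : HasCompactSupport D.φ := by
  refine HasCompactSupport.intro (isCompact_Icc (a := -(8 / 3 : ℝ)) (b := 8 / 3)) fun x hx => ?_
  refine D.φ_eq_zero (Or.inr ?_)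
  by_contra! h
  exact hx (abs_le.mp h)

/-- Subtracting the partition of unity at `ξ` from the one at `ξ / 2` leaves a single term. -/
theorem φ_eq (ξ : ℝ) : D.φ ξ = D.χ (2⁻¹ * ξ) - D.χ ξ := by
  have h1 := (hasSum_nat_add_iff' 1).mpr (D.sum_eq ξ)
  have h2 := D.sum_eq (2⁻¹ * ξ)
  have h3 : (fun j : ℕ => D.φ ((2 : ℝ)⁻¹ ^ (j + 1) * ξ))
      = fun j : ℕ => D.φ ((2 : ℝ)⁻¹ ^ j * (2⁻¹ * ξ)) := by
    ext j; rw [pow_succ, mul_assoc]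
  rw [h3] at h1
  have := h1.unique h2
  simp at this
  linarith

theorem sum_symbol (n : ℕ) (ξ : ℝ) :
    ∑ j ∈ Finset.range (n + 1), D.symbol j ξ = D.χ ((2 : ℝ)⁻¹ ^ n * ξ) := by
  induction n with
  | zero => simp [symbol]
  | succ n ih =>
    rw [Finset.sum_range_succ, ih]
    change D.χ _ + D.φ _ = _
    rw [φ_eq, ← mul_assoc, ← pow_succ']
    ring

/-- The inverse Fourier transform of the low frequency symbol. -/
def lowKernel : 𝓢(ℝ, ℂ) := 𝓕⁻ (symbolSchwartz D.χ D.χ_smooth D.hasCompactSupport_χ)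

/-- The inverse Fourier transform of the symbol of the annulus. -/
def annulusKernel : 𝓢(ℝ, ℂ) := 𝓕⁻ (symbolSchwartz D.φ D.φ_smooth D.hasCompactSupport_φ)

/-- The kernel of the `j`-th Littlewood–Paley block. -/
def blockKernel : ℕ → 𝓢(ℝ, ℂ)
  | 0 => D.lowKernel
  | j + 1 => dil (2 ^ j) D.annulusKernel

theorem fourier_blockKernel (j : ℕ) (ξ : ℝ) :
    𝓕 (D.blockKernel j) ξ = ((D.symbol j (2 * Real.pi * ξ) : ℝ) : ℂ) := by
  cases j with
  | zero =>
    rw [blockKernel, lowKernel, FourierTransform.fourier_fourierInv_eq, symbolSchwartz_apply, symbol]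
  | succ j =>
    rw [blockKernel, fourier_dil (by positivity), annulusKernel,
      FourierTransform.fourier_fourierInv_eq, symbolSchwartz_apply, symbol]
    congr 2
    rw [inv_pow]
    ring

theorem block_eq_cv (j : ℕ) (u : 𝓢'(ℝ, ℂ)) : D.block j u = cv (D.blockKernel j) u := by
  rw [block, cv]
  congr 2
  ext ξ
  rw [fourier_blockKernel]

/-- A symbol supported in an annulus which is `1` on the support of `φ`, divided by `ξ`. It is
smooth, since the numerator vanishes near the origin. -/
def fatSymbol (ξ : ℝ) : ℝ := (D.χ (4⁻¹ * ξ) - D.χ (4 * ξ)) / ξ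

theorem contDiff_fatSymbol : ContDiff ℝ ∞ D.fatSymbol := by
  rw [contDiff_iff_contDiffAt]
  intro ξ
  rcases eq_or_ne ξ 0 with h | h
  · subst h
    have h1 : D.fatSymbol =ᶠ[𝓝 0] fun _ => 0 := by
      filter_upwards [Metric.ball_mem_nhds (0 : ℝ) (by norm_num : (0 : ℝ) < 3 / 16)] with x hx
      rw [Metric.mem_ball, dist_zero_right, Real.norm_eq_abs] at hx
      rw [fatSymbol, D.χ_eq_one, D.χ_eq_one, sub_self, zero_div]
      · rw [abs_mul]; norm_num; linarith
      · rw [abs_mul]; norm_num; linarith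
    exact contDiffAt_const.congr_of_eventuallyEq h1
  · have h1 : ContDiff ℝ ∞ fun ξ => D.χ (4⁻¹ * ξ) - D.χ (4 * ξ) :=
      (D.χ_smooth.comp (by fun_prop)).sub (D.χ_smooth.comp (by fun_prop))
    exact h1.contDiffAt.div contDiffAt_id h

theorem hasCompactSupport_fatSymbol : HasCompactSupport D.fatSymbol := by
  refine HasCompactSupport.intro (isCompact_Icc (a := -(16 / 3 : ℝ)) (b := 16 / 3)) fun x hx => ?_
  have h : 16 / 3 < |x| := by
    by_contra! h
    exact hx (abs_le.mp h)
  rw [fatSymbol, D.χ_eq_zero, D.χ_eq_zero, sub_self, zero_div]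
  · rw [abs_mul]; norm_num; linarith
  · rw [abs_mul]; norm_num; linarith

/-- The Schwartz kernel whose derivative is the kernel of the fattened annulus projection; the factor
`-i` turns the division by `ξ` into one by `i ξ`. -/
def antiKernel : 𝓢(ℝ, ℂ) :=
  (-Complex.I) • 𝓕⁻ (symbolSchwartz D.fatSymbol D.contDiff_fatSymbol D.hasCompactSupport_fatSymbol)

/-- The kernel of a projection to a slightly larger frequency band, so that it reproduces the
`j`-th block. -/
def fatKernel : ℕ → 𝓢(ℝ, ℂ)
  | 0 => dil 2 D.lowKernel
  | j + 1 => dil (2 ^ j) (dk D.antiKernel)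

theorem fourier_dk_antiKernel (ξ : ℝ) : 𝓕 (dk D.antiKernel) ξ
    = ((D.χ (4⁻¹ * (2 * Real.pi * ξ)) - D.χ (4 * (2 * Real.pi * ξ)) : ℝ) : ℂ) := by
  rw [fourier_dk, antiKernel, FourierTransform.fourier_smul, FourierTransform.fourier_fourierInv_eq,
    _root_.smul_apply, symbolSchwartz_apply, fatSymbol, smul_eq_mul]
  rcases eq_or_ne ξ 0 with h | h
  · subst h
    simp
  · have h1 : (ξ : ℂ) ≠ 0 := Complex.ofReal_ne_zero.mpr h
    have h2 : (Real.pi : ℂ) ≠ 0 := Complex.ofReal_ne_zero.mpr Real.pi_ne_zero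
    rw [Complex.ofReal_div]
    push_cast
    field_simp
    rw [Complex.I_sq]
    ring

/-- The fattened symbols are `1` on the supports of the symbols of the partition. -/
theorem fat_reproduces (j : ℕ) (ξ : ℝ) :
    𝓕 (D.blockKernel j) ξ = 𝓕 (D.fatKernel j) ξ * 𝓕 (D.blockKernel j) ξ := by
  by_cases h0 : D.symbol j (2 * Real.pi * ξ) = 0
  · rw [fourier_blockKernel, h0, Complex.ofReal_zero, mul_zero]
  suffices h : 𝓕 (D.fatKernel j) ξ = 1 by rw [h, one_mul]
  cases j with
  | zero =>
    rw [fatKernel, fourier_dil two_pos, lowKernel, FourierTransform.fourier_fourierInv_eq,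
      symbolSchwartz_apply, D.χ_eq_one, Complex.ofReal_one]
    rw [symbol] at h0
    have : ¬ 4 / 3 < |2 * Real.pi * ξ| := fun h => h0 (D.χ_eq_zero h)
    rw [← mul_div_assoc, abs_div]
    norm_num at this ⊢
    linarith
  | succ j =>
    rw [fatKernel, fourier_dil (by positivity), fourier_dk_antiKernel]
    rw [symbol] at h0
    set x := (2 : ℝ)⁻¹ ^ j * (2 * Real.pi * ξ)
    have e : 2 * Real.pi * (ξ / 2 ^ j) = x := by
      simp only [x, inv_pow]; ring
    have h1 : ¬ (|x| < 3 / 4 ∨ 8 / 3 < |x|) := fun h => h0 (D.φ_eq_zero h)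
    push Not at h1
    rw [e, D.χ_eq_one, D.χ_eq_zero, sub_zero, Complex.ofReal_one]
    · rw [abs_mul]; norm_num; linarith [h1.1]
    · rw [abs_mul]; norm_num; linarith [h1.2]

theorem cv_fatKernel (j : ℕ) (u : 𝓢'(ℝ, ℂ)) : cv (D.fatKernel j) (D.block j u) = D.block j u := by
  rw [block_eq_cv, cv_cv (D.fat_reproduces j)]

end DyadicPartition

/-! ### Weak convergence of the Littlewood–Paley decomposition -/

/-- The functions `S(ε ·) - 1` and their derivatives are `O(ε)`, up to linear growth. -/
theorem norm_iteratedFDeriv_dilation_le (S : 𝓢(ℝ, ℂ)) (hS : S 0 = 1) (i : ℕ) :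
    ∃ B, 0 ≤ B ∧ ∀ ε : ℝ, 0 < ε → ε ≤ 1 → ∀ x : ℝ,
      ‖iteratedFDeriv ℝ i (fun x : ℝ => S (ε * x) - 1) x‖ ≤ ε * B * (1 + |x|) := by
  have hd : ∀ ε x : ℝ, HasDerivAt (fun x : ℝ => S (ε * x) - 1) ((ε : ℂ) * dk S (ε * x)) x := by
    intro ε x
    have h2 : HasDerivAt (fun x : ℝ => ε * x) ε x := by
      simpa using (hasDerivAt_id x).const_mul ε
    have := ((hasDerivAt_kernel S (ε * x)).scomp x h2).sub_const 1
    rwa [Complex.real_smul] at this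
  cases i with
  | zero =>
    refine ⟨SchwartzMap.seminorm ℝ 0 0 (dk S), apply_nonneg _ _, fun ε h0 h1 x => ?_⟩
    rw [norm_iteratedFDeriv_zero]
    have h3 := Convex.norm_image_sub_le_of_norm_hasDerivWithin_le (s := univ)
      (C := ε * SchwartzMap.seminorm ℝ 0 0 (dk S))
      (fun z _ => (hd ε z).hasDerivWithinAt)
      (fun z _ => by
        rw [norm_mul, Complex.norm_real, Real.norm_of_nonneg h0.le]
        exact mul_le_mul_of_nonneg_left (SchwartzMap.norm_le_seminorm ℝ _ _) h0.le)
      convex_univ (mem_univ (0 : ℝ)) (mem_univ x)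
    simp only [mul_zero, hS, sub_self, sub_zero, Real.norm_eq_abs] at h3
    refine h3.trans (mul_le_mul_of_nonneg_left (by linarith) ?_)
    exact mul_nonneg h0.le (apply_nonneg _ _)
  | succ i =>
    refine ⟨SchwartzMap.seminorm ℝ 0 i (dk S), apply_nonneg _ _, fun ε h0 h1 x => ?_⟩
    have hp : 0 ≤ SchwartzMap.seminorm ℝ 0 i (dk S) := apply_nonneg _ _
    have e : deriv (fun x : ℝ => S (ε * x) - 1) = fun x : ℝ => (ε : ℂ) * dk S (ε * x) :=
      funext fun x => (hd ε x).deriv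
    have e2 := congrFun (iteratedDeriv_comp_const_smul ((dk S).smooth i) ε) x
    rw [norm_iteratedFDeriv_eq_norm_iteratedDeriv, iteratedDeriv_succ', e,
      iteratedDeriv_const_mul_field]
    rw [e2, norm_mul, Complex.norm_real, Real.norm_of_nonneg h0.le, norm_smul, norm_pow,
      Real.norm_of_nonneg h0.le]
    have h4 := SchwartzMap.le_seminorm' ℝ 0 i (dk S) (ε * x)
    rw [pow_zero, one_mul] at h4
    have h5 : ε ^ i ≤ 1 := pow_le_one₀ h0.le h1
    have h6 : ε ^ i * ‖iteratedDeriv i (⇑(dk S)) (ε * x)‖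
        ≤ 1 * SchwartzMap.seminorm ℝ 0 i (dk S) := by gcongr
    have h7 : 0 ≤ ε * SchwartzMap.seminorm ℝ 0 i (dk S) * |x| := by positivity
    nlinarith [mul_le_mul_of_nonneg_left h6 h0.le]

/-- Truncation at high frequencies converges in the Schwartz topology. -/
theorem tendsto_smulLeft_dilation (S : 𝓢(ℝ, ℂ)) (hS : S 0 = 1) (f : 𝓢(ℝ, ℂ)) (ε : ℕ → ℝ)
    (hε0 : ∀ n, 0 < ε n) (hε1 : ∀ n, ε n ≤ 1) (hε : Tendsto ε atTop (𝓝 0)) :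
    Tendsto (fun n => SchwartzMap.smulLeftCLM ℂ (fun x : ℝ => S (ε n * x)) f) atTop (𝓝 f) := by
  rw [(schwartz_withSeminorms ℝ ℝ ℂ).tendsto_nhds]
  rintro ⟨k, m⟩ δ hδ
  choose B hB0 hB using norm_iteratedFDeriv_dilation_le S hS
  set A : ℝ := ∑ i ∈ Finset.range (m + 1), (m.choose i : ℝ) * B i *
    (SchwartzMap.seminorm ℝ k (m - i) f + SchwartzMap.seminorm ℝ (k + 1) (m - i) f) with hA
  have hA0 : 0 ≤ A := Finset.sum_nonneg fun i _ => mul_nonneg (mul_nonneg (by positivity) (hB0 i))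
    (add_nonneg (apply_nonneg _ _) (apply_nonneg _ _))
  have key : ∀ n, SchwartzMap.seminorm ℝ k m
      (SchwartzMap.smulLeftCLM ℂ (fun x : ℝ => S (ε n * x)) f - f) ≤ ε n * A := by
    intro n
    refine SchwartzMap.seminorm_le_bound ℝ k m _ (mul_nonneg (hε0 n).le hA0) fun x => ?_
    have htg : (fun x : ℝ => S (ε n * x)).HasTemperateGrowth :=
      S.hasTemperateGrowth.comp (by fun_prop)
    have e : ((SchwartzMap.smulLeftCLM ℂ (fun x : ℝ => S (ε n * x)) f - f : 𝓢(ℝ, ℂ)) : ℝ → ℂ)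
        = fun x => (S (ε n * x) - 1) * f x := by
      ext x
      rw [_root_.sub_apply, SchwartzMap.smulLeftCLM_apply_apply htg, smul_eq_mul, sub_mul, one_mul]
    have hsm : ContDiff ℝ m fun x : ℝ => S (ε n * x) - 1 :=
      ((S.smooth m).comp (by fun_prop)).sub contDiff_const
    rw [e]
    have h1 := norm_iteratedFDeriv_mul_le hsm (f.smooth m) x (n := m) le_rfl
    refine (mul_le_mul_of_nonneg_left h1 (by positivity)).trans ?_
    rw [hA, Finset.mul_sum, Finset.mul_sum]
    refine Finset.sum_le_sum fun i _ => ?_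
    have h2 := hB i (ε n) (hε0 n) (hε1 n) x
    have h3 := SchwartzMap.le_seminorm ℝ k (m - i) f x
    have h4 := SchwartzMap.le_seminorm ℝ (k + 1) (m - i) f x
    rw [Real.norm_eq_abs] at h3 h4 ⊢
    have h5 := hε0 n
    have h6 := hB0 i
    calc |x| ^ k * ((m.choose i : ℝ) * ‖iteratedFDeriv ℝ i (fun x : ℝ => S (ε n * x) - 1) x‖
          * ‖iteratedFDeriv ℝ (m - i) f x‖)
        ≤ |x| ^ k * ((m.choose i : ℝ) * (ε n * B i * (1 + |x|))
          * ‖iteratedFDeriv ℝ (m - i) f x‖) := by gcongr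
      _ = ε n * ((m.choose i : ℝ) * B i * (|x| ^ k * ‖iteratedFDeriv ℝ (m - i) f x‖
          + |x| ^ (k + 1) * ‖iteratedFDeriv ℝ (m - i) f x‖)) := by rw [pow_succ]; ring
      _ ≤ _ := by gcongr
  have hlim : Tendsto (fun n => ε n * A) atTop (𝓝 0) := by simpa using hε.mul_const A
  filter_upwards [hlim.eventually (gt_mem_nhds hδ)] with n hn
  exact (key n).trans_lt hn

theorem symbol_hasTemperateGrowth (D : DyadicPartition) (j : ℕ) :
    (fun ξ : ℝ => ((D.symbol j (2 * Real.pi * ξ) : ℝ) : ℂ)).HasTemperateGrowth := by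
  have : (fun ξ : ℝ => ((D.symbol j (2 * Real.pi * ξ) : ℝ) : ℂ))
      = ((𝓕 (D.blockKernel j) : 𝓢(ℝ, ℂ)) : ℝ → ℂ) :=
    funext fun ξ => (D.fourier_blockKernel j ξ).symm
  rw [this]
  exact SchwartzMap.hasTemperateGrowth _

/-- The Littlewood–Paley decomposition converges weakly. -/
theorem tendsto_sum_block (D : DyadicPartition) (u : 𝓢'(ℝ, ℂ)) (ψ : 𝓢(ℝ, ℂ)) :
    Tendsto (fun n => ∑ j ∈ Finset.range (n + 1), D.block j u ψ) atTop (𝓝 (u ψ)) := by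
  set S := symbolSchwartz D.χ D.χ_smooth D.hasCompactSupport_χ
  have hS : S 0 = 1 := by
    rw [symbolSchwartz_apply, D.χ_eq_one (by norm_num), Complex.ofReal_one]
  have h1 := tendsto_smulLeft_dilation S hS (𝓕⁻ ψ) (fun n => (2 : ℝ)⁻¹ ^ n)
    (fun n => by positivity) (fun n => pow_le_one₀ (by norm_num) (by norm_num))
    (tendsto_pow_atTop_nhds_zero_of_lt_one (by norm_num) (by norm_num))
  have h2 : Continuous fun φ : 𝓢(ℝ, ℂ) => u (𝓕 φ) :=
    (ContinuousLinearMap.continuous (u : 𝓢(ℝ, ℂ) →Lₚₜ[ℂ] ℂ)).comp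
      (FourierTransform.fourierCLM ℂ 𝓢(ℝ, ℂ)).continuous
  have h3 := (h2.tendsto _).comp h1
  rw [FourierTransform.fourier_fourierInv_eq] at h3
  refine h3.congr fun n => ?_
  have h4 : (fun ξ : ℝ => S ((2 : ℝ)⁻¹ ^ n * ξ)) = fun ξ : ℝ =>
      ∑ j ∈ Finset.range (n + 1), ((D.symbol j (2 * Real.pi * ξ) : ℝ) : ℂ) := by
    ext ξ
    rw [symbolSchwartz_apply, ← Complex.ofReal_sum, D.sum_symbol]
    congr 2
    ring
  have h5 := SchwartzMap.smulLeftCLM_sum (F := ℂ) (𝕜 := ℂ) (s := Finset.range (n + 1))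
    (g := fun j (ξ : ℝ) => ((D.symbol j (2 * Real.pi * ξ) : ℝ) : ℂ))
    fun j _ => symbol_hasTemperateGrowth D j
  simp only [Function.comp_apply, h4]
  rw [h5, _root_.sum_apply]
  change u (FourierTransform.fourierCLM ℂ 𝓢(ℝ, ℂ) _) = _
  rw [map_sum, map_sum]
  rfl

theorem norm_bdist_apply_le (f : ℝ →ᵇ ℂ) (ψ : 𝓢(ℝ, ℂ)) : ‖bdist f ψ‖ ≤ L1 ψ * ‖f‖ := by
  rw [bdist_apply, L1, ← integral_mul_const]
  refine norm_integral_le_of_norm_le (ψ.integrable.norm.mul_const _) (ae_of_all _ fun x => ?_)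
  rw [norm_mul]
  gcongr
  exact f.norm_coe_le_norm x

/-- A distribution whose blocks are summable functions is the sum of its blocks. -/
theorem bdist_tsum_eq (D : DyadicPartition) (u : 𝓢'(ℝ, ℂ)) (f : ℕ → ℝ →ᵇ ℂ)
    (hf : ∀ j, bdist (f j) = D.block j u) (hs : Summable fun j => ‖f j‖) :
    bdist (∑' j, f j) = u := by
  ext ψ
  have h1 : Tendsto (fun n => ∑ j ∈ Finset.range n, f j) atTop (𝓝 (∑' j, f j)) :=
    hs.of_norm.hasSum.tendsto_sum_nat
  have h2 : Tendsto (fun n => bdist (∑ j ∈ Finset.range n, f j) ψ) atTop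
      (𝓝 (bdist (∑' j, f j) ψ)) := by
    rw [tendsto_iff_norm_sub_tendsto_zero] at h1 ⊢
    have h3 := h1.const_mul (L1 ψ)
    rw [mul_zero] at h3
    refine squeeze_zero (fun _ => norm_nonneg _) (fun n => ?_) h3
    have := norm_bdist_apply_le (∑ j ∈ Finset.range n, f j - ∑' j, f j) ψ
    rwa [bdist_sub, _root_.sub_apply] at this
  have h4 : ∀ n, bdist (∑ j ∈ Finset.range n, f j) ψ = ∑ j ∈ Finset.range n, D.block j u ψ := by
    intro n
    induction n with
    | zero => simp [bdist_apply]
    | succ n ih => rw [Finset.sum_range_succ, Finset.sum_range_succ, bdist_add, _root_.add_apply, ih, hf]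
  have h5 := (tendsto_sum_block D u ψ)
  refine tendsto_nhds_unique ((tendsto_add_atTop_iff_nat 1).mpr h2) (h5.congr fun n => (h4 _).symm)

/-! ### A dyadic sum -/

/-- `∑_j min(y_j^a, y_j^{a-1})` over `y_j = 2^j r` is bounded independently of `r`; the summand is
dominated by an increment of a bounded monotone function. -/
theorem sum_min_rpow_le {a r : ℝ} (ha0 : 0 < a) (ha1 : a < 1) (hr : 0 < r) (n : ℕ) :
    ∑ j ∈ Finset.range n, (2 : ℝ) ^ ((j : ℝ) * a) * min 1 ((2 ^ j * r)⁻¹)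
      ≤ ((1 - 2 ^ (-a) : ℝ)⁻¹ + (1 - 2 ^ (a - 1) : ℝ)⁻¹) * r ^ (-a) := by
  set A : ℝ := (1 - 2 ^ (-a) : ℝ)⁻¹
  set B : ℝ := (1 - 2 ^ (a - 1) : ℝ)⁻¹
  have hA1 : (2 : ℝ) ^ (-a) < 1 := Real.rpow_lt_one_of_one_lt_of_neg (by norm_num) (by linarith)
  have hB1 : (2 : ℝ) ^ (a - 1) < 1 := Real.rpow_lt_one_of_one_lt_of_neg (by norm_num) (by linarith)
  have hA0 : 0 < A := inv_pos.mpr (by linarith)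
  have hB0 : 0 < B := inv_pos.mpr (by linarith)
  set G : ℝ → ℝ := fun y => A * min 1 ((y / 2) ^ a) - B * min 1 (y ^ (a - 1)) with hG
  have step : ∀ y, 0 < y → y ^ a * min 1 y⁻¹ ≤ G (2 * y) - G y := by
    intro y hy
    have m1 : min 1 ((y / 2) ^ a) ≤ min 1 ((2 * y / 2) ^ a) := by gcongr; linarith
    have m2 : min 1 ((2 * y) ^ (a - 1)) ≤ min 1 (y ^ (a - 1)) :=
      min_le_min_left _ (Real.rpow_le_rpow_of_nonpos hy (by linarith) (by linarith))
    have n1 := mul_le_mul_of_nonneg_left m1 hA0.le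
    have n2 := mul_le_mul_of_nonneg_left m2 hB0.le
    simp only [hG]
    rcases le_total y 1 with h | h
    · have e1 : min 1 ((2 * y / 2) ^ a) = y ^ a := by
        rw [mul_div_cancel_left₀ _ two_ne_zero]
        exact min_eq_right (Real.rpow_le_one hy.le h ha0.le)
      have e2 : min 1 ((y / 2) ^ a) = y ^ a * 2 ^ (-a) := by
        rw [Real.div_rpow hy.le (by norm_num), Real.rpow_neg (by norm_num), ← div_eq_mul_inv]
        refine min_eq_right ?_
        rw [← Real.div_rpow hy.le (by norm_num)]
        exact Real.rpow_le_one (by positivity) (by linarith) ha0.le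
      rw [min_eq_left ((one_le_inv₀ hy).mpr h), e1, e2, mul_one]
      have e3 : A * y ^ a - A * (y ^ a * 2 ^ (-a)) = y ^ a := by
        have : A * (1 - 2 ^ (-a)) = 1 := inv_mul_cancel₀ (by linarith)
        linear_combination y ^ a * this
      linarith
    · have e1 : min 1 (y ^ (a - 1)) = y ^ (a - 1) :=
        min_eq_right (Real.rpow_le_one_of_one_le_of_nonpos h (by linarith))
      have e2 : min 1 ((2 * y) ^ (a - 1)) = 2 ^ (a - 1) * y ^ (a - 1) := by
        rw [← Real.mul_rpow (by norm_num) hy.le]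
        exact min_eq_right (Real.rpow_le_one_of_one_le_of_nonpos (by linarith) (by linarith))
      rw [min_eq_right (inv_le_one_of_one_le₀ h), e1, e2, ← div_eq_mul_inv,
        ← Real.rpow_sub_one hy.ne']
      have e3 : B * y ^ (a - 1) - B * (2 ^ (a - 1) * y ^ (a - 1)) = y ^ (a - 1) := by
        have : B * (1 - 2 ^ (a - 1)) = 1 := inv_mul_cancel₀ (by linarith)
        linear_combination y ^ (a - 1) * this
      linarith
  have h1 : ∀ j : ℕ, (2 : ℝ) ^ ((j : ℝ) * a) * min 1 ((2 ^ j * r)⁻¹)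
      ≤ (G (2 ^ (j + 1) * r) - G (2 ^ j * r)) * r ^ (-a) := by
    intro j
    have h2 := step (2 ^ j * r) (by positivity)
    have h3 : (2 : ℝ) ^ ((j : ℝ) * a) = (2 ^ j * r) ^ a * r ^ (-a) := by
      rw [Real.mul_rpow (by positivity) hr.le, mul_assoc, ← Real.rpow_add hr, add_neg_cancel,
        Real.rpow_zero, mul_one, Real.rpow_mul (by norm_num), Real.rpow_natCast]
    rw [show (2 : ℝ) ^ (j + 1) * r = 2 * (2 ^ j * r) by ring, h3]
    calc _ = (2 ^ j * r) ^ a * min 1 ((2 ^ j * r)⁻¹) * r ^ (-a) := by ring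
      _ ≤ _ := mul_le_mul_of_nonneg_right h2 (by positivity)
  refine (Finset.sum_le_sum fun j _ => h1 j).trans ?_
  rw [← Finset.sum_mul, Finset.sum_range_sub (fun j => G (2 ^ j * r))]
  refine mul_le_mul_of_nonneg_right ?_ (by positivity)
  simp only [hG]
  have hy : (0 : ℝ) ≤ 2 ^ n * r := by positivity
  have b1 : min 1 ((2 ^ n * r / 2) ^ a) ≤ 1 := min_le_left _ _
  have b2 : 0 ≤ min 1 ((2 ^ n * r) ^ (a - 1)) := by positivity
  have b3 : 0 ≤ min 1 ((2 ^ 0 * r / 2) ^ a) := by positivity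
  have b4 : min 1 ((2 ^ 0 * r) ^ (a - 1)) ≤ 1 := min_le_left _ _
  calc _ ≤ (A * 1 - 0) - (0 - B * 1) :=
        sub_le_sub (sub_le_sub (mul_le_mul_of_nonneg_left b1 hA0.le) (mul_nonneg hB0.le b2))
          (sub_le_sub (mul_nonneg hA0.le b3) (mul_le_mul_of_nonneg_left b4 hB0.le))
    _ = A + B := by ring

/-- The constant of the dyadic sum `sum_min_rpow_le`. -/
def cdy (a : ℝ) : ℝ := (1 - 2 ^ (-a) : ℝ)⁻¹ + (1 - 2 ^ (a - 1) : ℝ)⁻¹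

theorem cdy_nonneg {a : ℝ} (ha0 : 0 < a) (ha1 : a < 1) : 0 ≤ cdy a := by
  have hA1 : (2 : ℝ) ^ (-a) < 1 := Real.rpow_lt_one_of_one_lt_of_neg (by norm_num) (by linarith)
  have hB1 : (2 : ℝ) ^ (a - 1) < 1 := Real.rpow_lt_one_of_one_lt_of_neg (by norm_num) (by linarith)
  exact add_nonneg (inv_nonneg.mpr (by linarith)) (inv_nonneg.mpr (by linarith))

/-! ### Distributions with a finite Besov norm -/

theorem distLinftyNorm_toTemperedDistribution_le (g : Lp ℂ ⊤ (volume : Measure ℝ)) :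
    distLinftyNorm (Lp.toTemperedDistribution g) ≤ ENNReal.ofReal ‖g‖ := by
  rw [ofReal_norm]
  unfold distLinftyNorm
  exact iInf_le_of_le g (iInf_le_of_le rfl le_rfl)

theorem distLinftyNorm_bdist_le (f : ℝ →ᵇ ℂ) : distLinftyNorm (bdist f) ≤ ENNReal.ofReal ‖f‖ := by
  refine (distLinftyNorm_toTemperedDistribution_le (toLinf f)).trans ?_
  exact ENNReal.ofReal_le_ofReal (norm_toLinf_le f)

theorem exists_Lp_of_distLinftyNorm_lt {v : 𝓢'(ℝ, ℂ)} (h : distLinftyNorm v < ⊤) :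
    ∃ g : Lp ℂ ⊤ (volume : Measure ℝ), Lp.toTemperedDistribution g = v ∧
      distLinftyNorm v = ENNReal.ofReal ‖g‖ := by
  obtain ⟨g, hg⟩ := iInf_lt_iff.mp h
  obtain ⟨hg, -⟩ := iInf_lt_iff.mp hg
  refine ⟨g, hg, le_antisymm ?_ ?_⟩
  · rw [← hg]
    exact distLinftyNorm_toTemperedDistribution_le g
  · refine le_iInf₂ fun g' hg' => ?_
    rw [toTemperedDistribution_injective (hg'.trans hg.symm), ofReal_norm]

theorem distLinftyNorm_add_le (u v : 𝓢'(ℝ, ℂ)) :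
    distLinftyNorm (u + v) ≤ distLinftyNorm u + distLinftyNorm v := by
  by_cases hu : distLinftyNorm u < ⊤
  swap
  · rw [not_lt_top_iff.mp hu, top_add]; exact le_top
  by_cases hv : distLinftyNorm v < ⊤
  swap
  · rw [not_lt_top_iff.mp hv, add_top]; exact le_top
  obtain ⟨f, hf, hf'⟩ := exists_Lp_of_distLinftyNorm_lt hu
  obtain ⟨g, hg, hg'⟩ := exists_Lp_of_distLinftyNorm_lt hv
  have h : Lp.toTemperedDistribution (f + g) = u + v := by
    rw [← hf, ← hg]
    exact map_add (Lp.toTemperedDistributionCLM ℂ (volume : Measure ℝ) ⊤) f g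
  rw [hf', hg', ← ENNReal.ofReal_add (norm_nonneg _) (norm_nonneg _)]
  rw [← h]
  refine (distLinftyNorm_toTemperedDistribution_le (f + g)).trans ?_
  exact ENNReal.ofReal_le_ofReal (norm_add_le _ _)

theorem block_add (D : DyadicPartition) (j : ℕ) (u v : 𝓢'(ℝ, ℂ)) :
    D.block j (u + v) = D.block j u + D.block j v := map_add _ u v

theorem block_sub (D : DyadicPartition) (j : ℕ) (u v : 𝓢'(ℝ, ℂ)) :
    D.block j (u - v) = D.block j u - D.block j v := map_sub _ u v

theorem besovNorm_add_le (D : DyadicPartition) (γ : ℝ) (u v : 𝓢'(ℝ, ℂ)) :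
    besovNorm D γ (u + v) ≤ besovNorm D γ u + besovNorm D γ v := by
  refine iSup_le fun j => ?_
  rw [block_add]
  refine (mul_le_mul_right (distLinftyNorm_add_le _ _) _).trans ?_
  rw [mul_add]
  exact add_le_add (le_iSup (fun j : ℕ => ENNReal.ofReal ((2 : ℝ) ^ (((j : ℝ) - 1) * γ)) *
    distLinftyNorm (D.block j u)) j) (le_iSup (fun j : ℕ =>
    ENNReal.ofReal ((2 : ℝ) ^ (((j : ℝ) - 1) * γ)) * distLinftyNorm (D.block j v)) j)

/-- To bound a Besov norm it is enough to represent the blocks by bounded functions. -/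
theorem besovNorm_le_of_blocks (D : DyadicPartition) {γ M : ℝ} {u : 𝓢'(ℝ, ℂ)}
    {f : ℕ → ℝ →ᵇ ℂ} (hf : ∀ j, bdist (f j) = D.block j u)
    (hb : ∀ j : ℕ, (2 : ℝ) ^ (((j : ℝ) - 1) * γ) * ‖f j‖ ≤ M) :
    besovNorm D γ u ≤ ENNReal.ofReal M := by
  refine iSup_le fun j => ?_
  rw [← hf j]
  refine (mul_le_mul_right (distLinftyNorm_bdist_le _) _).trans ?_
  rw [← ENNReal.ofReal_mul (by positivity)]
  exact ENNReal.ofReal_le_ofReal (hb j)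

/-- A uniform bound for the `L¹` norms of the reproducing kernels. -/
def cfat (D : DyadicPartition) : ℝ := L1 D.lowKernel + L1 (dk D.antiKernel)

theorem cfat_nonneg (D : DyadicPartition) : 0 ≤ cfat D := add_nonneg (L1_nonneg _) (L1_nonneg _)

theorem L1_fatKernel_le (D : DyadicPartition) (j : ℕ) : L1 (D.fatKernel j) ≤ cfat D := by
  have h1 := L1_nonneg D.lowKernel
  have h2 := L1_nonneg (dk D.antiKernel)
  cases j with
  | zero => rw [DyadicPartition.fatKernel, L1_dil two_pos, cfat]; linarith
  | succ j => rw [DyadicPartition.fatKernel, L1_dil (by positivity), cfat]; linarith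

/-- The blocks of an element of a Besov space are bounded continuous functions, reproduced by the
kernels `fatKernel`. -/
theorem exists_blocks (D : DyadicPartition) {γ M : ℝ} (hM : 0 ≤ M) {u : 𝓢'(ℝ, ℂ)}
    (hu : besovNorm D γ u ≤ ENNReal.ofReal M) :
    ∃ f : ℕ → ℝ →ᵇ ℂ, ∀ j, bdist (f j) = D.block j u ∧ conv (D.fatKernel j) (f j) = f j ∧
      ‖f j‖ ≤ cfat D * ((2 : ℝ) ^ (-(((j : ℝ) - 1) * γ)) * M) := by
  have h : ∀ j, ∃ f : ℝ →ᵇ ℂ, bdist f = D.block j u ∧ conv (D.fatKernel j) f = f ∧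
      ‖f‖ ≤ cfat D * ((2 : ℝ) ^ (-(((j : ℝ) - 1) * γ)) * M) := by
    intro j
    have h1 : ENNReal.ofReal ((2 : ℝ) ^ (((j : ℝ) - 1) * γ)) * distLinftyNorm (D.block j u)
        ≤ ENNReal.ofReal M := (le_iSup (fun j : ℕ =>
      ENNReal.ofReal ((2 : ℝ) ^ (((j : ℝ) - 1) * γ)) * distLinftyNorm (D.block j u)) j).trans hu
    have hp : (0 : ℝ) < (2 : ℝ) ^ (((j : ℝ) - 1) * γ) := by positivity
    have h2 : distLinftyNorm (D.block j u) < ⊤ := by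
      by_contra h3
      rw [not_lt_top_iff.mp h3, ENNReal.mul_top (by simpa using hp)] at h1
      exact absurd h1 (by simp)
    obtain ⟨g, hg, hg'⟩ := exists_Lp_of_distLinftyNorm_lt h2
    rw [hg', ← ENNReal.ofReal_mul hp.le, ENNReal.ofReal_le_ofReal_iff hM] at h1
    have hb : bdist (convL (D.fatKernel j) g) = D.block j u := by
      rw [← cv_toTemperedDistribution, hg, D.cv_fatKernel]
    refine ⟨convL (D.fatKernel j) g, hb, ?_, ?_⟩
    · apply bdist_injective
      rw [← cv_bdist, hb, D.cv_fatKernel]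
    · refine (norm_convL_le _ g).trans ?_
      have h4 : ‖g‖ ≤ (2 : ℝ) ^ (-(((j : ℝ) - 1) * γ)) * M := by
        rw [Real.rpow_neg (by norm_num), ← div_eq_inv_mul, le_div_iff₀ hp, mul_comm]
        exact h1
      have := L1_fatKernel_le D j
      have := cfat_nonneg D
      gcongr
  choose f hf using h
  exact ⟨f, hf⟩

/-- `C^γ` with `γ > 0` embeds into the bounded functions. -/
theorem norm_le_of_besovNorm_le (D : DyadicPartition) {γ : ℝ} (hγ : 0 < γ) :
    ∃ C, 0 ≤ C ∧ ∀ (g : ℝ →ᵇ ℂ) (M : ℝ), 0 ≤ M → besovNorm D γ (bdist g) ≤ ENNReal.ofReal M →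
      ‖g‖ ≤ C * M := by
  set r : ℝ := 2 ^ (-γ) with hr
  have hr0 : 0 ≤ r := by positivity
  have hr1 : r < 1 := Real.rpow_lt_one_of_one_lt_of_neg (by norm_num) (by linarith)
  refine ⟨cfat D * (2 ^ γ * (1 - r)⁻¹), mul_nonneg (cfat_nonneg D) (mul_nonneg (by positivity)
    (inv_nonneg.mpr (by linarith))), fun g M hM hg => ?_⟩
  obtain ⟨f, hf⟩ := exists_blocks D hM hg
  have hb : ∀ j, ‖f j‖ ≤ (cfat D * (2 ^ γ * M)) * r ^ j := by
    intro j
    refine (hf j).2.2.trans (le_of_eq ?_)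
    rw [show -(((j : ℝ) - 1) * γ) = γ + -γ * j by ring, Real.rpow_add (by norm_num),
      Real.rpow_mul (by norm_num), Real.rpow_natCast, ← hr]
    ring
  have hgs := (hasSum_geometric_of_lt_one hr0 hr1).mul_left (cfat D * (2 ^ γ * M))
  have hs : Summable fun j => ‖f j‖ := Summable.of_nonneg_of_le (fun _ => norm_nonneg _) hb hgs.summable
  have e : g = ∑' j, f j := bdist_injective (bdist_tsum_eq D _ f (fun j => (hf j).1) hs).symm
  rw [e]
  refine (norm_tsum_le_tsum_norm hs).trans ((hs.tsum_le_tsum hb hgs.summable).trans (le_of_eq ?_))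
  rw [hgs.tsum_eq]
  ring

/-- `C^γ` with `0 < γ < 1` embeds into the Hölder space. -/
theorem HB_of_besovNorm_le (D : DyadicPartition) {γ : ℝ} (hγ : 0 < γ) (hγ1 : γ < 1) :
    ∃ C, 0 ≤ C ∧ ∀ (g : ℝ →ᵇ ℂ) (M : ℝ), 0 ≤ M → besovNorm D γ (bdist g) ≤ ENNReal.ofReal M →
      HB γ (C * M) g := by
  obtain ⟨C₁, hC₁, hsup⟩ := norm_le_of_besovNorm_le D hγ
  have hF := cfat_nonneg D
  set b₀ := L1 (dk (D.fatKernel 0)) with hb₀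
  set b₁ := L1 (dk (dk D.antiKernel)) with hb₁
  have hb₀0 : 0 ≤ b₀ := L1_nonneg _
  have hb₁0 : 0 ≤ b₁ := L1_nonneg _
  have hcd := cdy_nonneg (a := 1 - γ) (by linarith) (by linarith)
  set C₂ := (2 + b₀) * (cfat D * 2 ^ γ) + (2 + b₁) * cfat D * cdy (1 - γ) with hC₂
  have hC₂0 : 0 ≤ C₂ := by positivity
  refine ⟨C₁ + C₂, by positivity, fun g M hM hg => ?_⟩
  obtain ⟨f, hf⟩ := exists_blocks D hM hg
  have hb : ∀ j, ‖f j‖ ≤ (cfat D * (2 ^ γ * M)) * (2 ^ (-γ)) ^ j := by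
    intro j
    refine (hf j).2.2.trans (le_of_eq ?_)
    rw [show -(((j : ℝ) - 1) * γ) = γ + -γ * j by ring, Real.rpow_add (by norm_num),
      Real.rpow_mul (by norm_num), Real.rpow_natCast]
    ring
  have hr1 : (2 : ℝ) ^ (-γ) < 1 := Real.rpow_lt_one_of_one_lt_of_neg (by norm_num) (by linarith)
  have hs : Summable fun j => ‖f j‖ := Summable.of_nonneg_of_le (fun _ => norm_nonneg _) hb
    ((summable_geometric_of_lt_one (by positivity) hr1).mul_left _)
  have e : g = ∑' j, f j := bdist_injective (bdist_tsum_eq D _ f (fun j => (hf j).1) hs).symm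
  have hLip : ∀ j x y, ‖f j x - f j y‖ ≤ min 2 (L1 (dk (D.fatKernel j)) * |x - y|) * ‖f j‖ := by
    intro j x y
    rw [min_mul_of_nonneg _ _ (norm_nonneg _)]
    refine le_min ?_ ?_
    · refine (norm_sub_le _ _).trans ?_
      linarith [(f j).norm_coe_le_norm x, (f j).norm_coe_le_norm y]
    · have := norm_conv_sub_le (D.fatKernel j) (f j) x y
      rw [(hf j).2.1] at this
      exact this.trans (le_of_eq (by ring))
  refine ⟨fun x => (g.norm_coe_le_norm x).trans ((hsup g M hM hg).trans ?_), fun x y => ?_⟩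
  · gcongr; linarith
  rcases eq_or_ne x y with hxy | hxy
  · subst hxy
    simp only [sub_self, norm_zero]
    positivity
  set r := |x - y| with hr
  have hr0 : 0 < r := abs_pos.mpr (sub_ne_zero.mpr hxy)
  have hev : ∀ x, HasSum (fun j => f j x) (g x) := by
    intro x
    rw [e]
    exact hs.of_norm.hasSum.mapL (BoundedContinuousFunction.evalCLM ℂ x)
  have hdiff := (hev x).sub (hev y)
  have hd0 : ‖f 0 x - f 0 y‖ ≤ (2 + b₀) * (cfat D * 2 ^ γ) * M * r ^ γ := by
    refine (hLip 0 x y).trans ?_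
    have h1 := min_two_mul_le hb₀0 hr0.le hγ.le hγ1.le
    have h2 := hb 0
    rw [pow_zero, mul_one] at h2
    calc _ ≤ ((2 + b₀) * r ^ γ) * (cfat D * (2 ^ γ * M)) :=
          mul_le_mul h1 h2 (norm_nonneg _) (by positivity)
      _ = _ := by ring
  -- each block is bounded, and Lipschitz with a constant of order `2 ^ j`
  have hdj : ∀ j : ℕ, ‖f (j + 1) x - f (j + 1) y‖ ≤ ((2 + b₁) * cfat D * M * r) *
      ((2 : ℝ) ^ ((j : ℝ) * (1 - γ)) * min 1 ((2 ^ j * r)⁻¹)) := by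
    intro j
    refine (hLip (j + 1) x y).trans ?_
    have h1 : L1 (dk (D.fatKernel (j + 1))) = 2 ^ j * b₁ := L1_dk_dil (by positivity) _
    have h2 : ‖f (j + 1)‖ ≤ cfat D * (2 ^ ((j : ℝ) * (-γ)) * M) := by
      refine (hf (j + 1)).2.2.trans (le_of_eq ?_)
      congr 3
      push_cast
      ring
    have h3 : min 2 (L1 (dk (D.fatKernel (j + 1))) * r)
        ≤ (2 + b₁) * (2 ^ j * r * min 1 ((2 ^ j * r)⁻¹)) := by
      rw [h1]
      have hp : 0 < 2 ^ j * r := by positivity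
      rcases le_total (2 ^ j * r) 1 with h | h
      · rw [min_eq_left ((one_le_inv₀ hp).mpr h)]
        refine (min_le_right _ _).trans ?_
        nlinarith
      · rw [min_eq_right (inv_le_one_of_one_le₀ h), mul_inv_cancel₀ hp.ne']
        refine (min_le_left _ _).trans ?_
        linarith
    have h4 : (2 : ℝ) ^ ((j : ℝ) * (1 - γ)) = 2 ^ j * 2 ^ ((j : ℝ) * (-γ)) := by
      rw [← Real.rpow_natCast, ← Real.rpow_add (by norm_num)]
      congr 1
      ring
    rw [h4]
    calc _ ≤ ((2 + b₁) * (2 ^ j * r * min 1 ((2 ^ j * r)⁻¹)))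
          * (cfat D * (2 ^ ((j : ℝ) * (-γ)) * M)) :=
          mul_le_mul h3 h2 (norm_nonneg _) (by positivity)
      _ = _ := by ring
  rw [← hdiff.tsum_eq]
  have hsd : Summable fun j => ‖f j x - f j y‖ := by
    refine Summable.of_nonneg_of_le (fun _ => norm_nonneg _) (fun j => (norm_sub_le _ _).trans
      (add_le_add ((f j).norm_coe_le_norm x) ((f j).norm_coe_le_norm y))) (hs.add hs)
  refine (norm_tsum_le_tsum_norm hsd).trans ?_
  rw [hsd.tsum_eq_zero_add]
  have htail : ∑' j : ℕ, ‖f (j + 1) x - f (j + 1) y‖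
      ≤ (2 + b₁) * cfat D * cdy (1 - γ) * M * r ^ γ := by
    refine Real.tsum_le_of_sum_range_le (fun _ => norm_nonneg _) fun n => ?_
    refine (Finset.sum_le_sum fun j _ => hdj j).trans ?_
    rw [← Finset.mul_sum]
    have h5 := sum_min_rpow_le (a := 1 - γ) (by linarith) (by linarith) hr0 n
    refine (mul_le_mul_of_nonneg_left h5 (by positivity)).trans (le_of_eq ?_)
    have h6 : r * r ^ (-(1 - γ)) = r ^ γ := by
      nth_rewrite 1 [← Real.rpow_one r]
      rw [← Real.rpow_add hr0]
      congr 1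
      ring
    rw [← h6, cdy]
    ring
  have : 0 ≤ C₁ * M * r ^ γ := by positivity
  calc _ ≤ (2 + b₀) * (cfat D * 2 ^ γ) * M * r ^ γ
        + (2 + b₁) * cfat D * cdy (1 - γ) * M * r ^ γ := add_le_add hd0 htail
    _ = C₂ * M * r ^ γ := by rw [hC₂]; ring
    _ ≤ _ := by rw [add_mul, add_mul]; linarith

/-- The Hölder space of order `η ∈ (0, 1]` embeds into `C^η`. -/
theorem besovNorm_le_of_HB (D : DyadicPartition) {η : ℝ} (hη : 0 < η) (hη1 : η ≤ 1) :
    ∃ C, 0 ≤ C ∧ ∀ (g : ℝ →ᵇ ℂ) (K : ℝ), HB η K g →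
      besovNorm D η (bdist g) ≤ ENNReal.ofReal (C * K) := by
  have h1 := L1_nonneg D.lowKernel
  have h2 := mom_nonneg η D.annulusKernel
  refine ⟨L1 D.lowKernel + mom η D.annulusKernel, by positivity, fun g K hg => ?_⟩
  have hK := hg.nonneg
  refine besovNorm_le_of_blocks D (f := fun j => conv (D.blockKernel j) g)
    (fun j => by rw [D.block_eq_cv, cv_bdist]) fun j => ?_
  cases j with
  | zero =>
    have h3 : (2 : ℝ) ^ ((((0 : ℕ) : ℝ) - 1) * η) ≤ 1 :=
      Real.rpow_le_one_of_one_le_of_nonpos (by norm_num) (by simp; linarith)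
    have h4 : ‖conv (D.blockKernel 0) g‖ ≤ L1 D.lowKernel * K :=
      (norm_conv_le_L1 _ g).trans (mul_le_mul_of_nonneg_left hg.norm_le h1)
    have := mul_le_mul h3 h4 (norm_nonneg _) zero_le_one
    nlinarith [mul_nonneg h2 hK]
  | succ j =>
    have hl : (0 : ℝ) < 2 ^ j := by positivity
    -- the symbol vanishes at the origin, so the kernel annihilates constants
    have h0 : ∫ y, dil (2 ^ j) D.annulusKernel y = 0 := by
      have h5 := D.fourier_blockKernel (j + 1) 0
      have hφ : D.symbol (j + 1) (2 * Real.pi * 0) = 0 := by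
        change D.φ _ = 0
        exact D.φ_eq_zero (by norm_num)
      rw [SchwartzMap.fourier_coe, Real.fourier_eq', hφ] at h5
      simpa [DyadicPartition.blockKernel] using h5
    have h6 : ‖conv (dil (2 ^ j) D.annulusKernel) g‖
        ≤ K * ((2 ^ j) ^ (-η) * mom η D.annulusKernel) := by
      refine (BoundedContinuousFunction.norm_le (by positivity)).mpr fun x => ?_
      have h7 : conv (dil (2 ^ j) D.annulusKernel) g x
          = ∫ y, dil (2 ^ j) D.annulusKernel y * (g (x - y) - g x) := by
        simp_rw [mul_sub]
        rw [integral_sub (integrable_kernel_mul _ _ _)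
          ((dil (2 ^ j) D.annulusKernel).integrable.mul_const _), integral_mul_const, h0, zero_mul,
          sub_zero, conv_apply']
      have h8 : ∫ y, ‖dil (2 ^ j) D.annulusKernel y‖ * |y| ^ η * K
          = K * ((2 ^ j) ^ (-η) * mom η D.annulusKernel) := by
        rw [integral_mul_const, ← mom_dil hl, mom, mul_comm]
      rw [h7, ← h8]
      refine norm_integral_le_of_norm_le
        ((integrable_mom hη.le (by linarith) _).mul_const _) (ae_of_all _ fun y => ?_)
      have h9 := hg.2 (x - y) x
      rw [show x - y - x = -y by ring, abs_neg] at h9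
      rw [norm_mul, mul_assoc, mul_comm _ K]
      gcongr
    have h10 : (2 : ℝ) ^ ((((j + 1 : ℕ) : ℝ) - 1) * η) * (2 ^ j) ^ (-η) = 1 := by
      rw [← Real.rpow_natCast, ← Real.rpow_mul (by norm_num), ← Real.rpow_add (by norm_num)]
      push_cast
      rw [show ((j : ℝ) + 1 - 1) * η + j * -η = 0 by ring, Real.rpow_zero]
    calc _ ≤ (2 : ℝ) ^ ((((j + 1 : ℕ) : ℝ) - 1) * η) *
          (K * ((2 ^ j) ^ (-η) * mom η D.annulusKernel)) := by gcongr; exact h6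
      _ = ((2 : ℝ) ^ ((((j + 1 : ℕ) : ℝ) - 1) * η) * (2 ^ j) ^ (-η)) *
          (mom η D.annulusKernel * K) := by ring
      _ ≤ _ := by rw [h10, one_mul]; nlinarith [mul_nonneg h1 hK]

/-! ### The heat semigroup on distributions -/

theorem heat_eq_cv {τ : ℝ} (h : 0 < τ) (u : 𝓢'(ℝ, ℂ)) : heat τ u = cv (gk τ) u := by
  rw [heat, cv]
  congr 2
  ext ξ
  rw [fourier_gk h]

theorem heat_zero (u : 𝓢'(ℝ, ℂ)) : heat 0 u = u := by
  rw [heat]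
  have : (fun ξ : ℝ => ((Real.exp (-2 * Real.pi ^ 2 * 0 * ξ ^ 2) : ℝ) : ℂ)) = fun _ => 1 := by
    ext ξ; simp
  rw [this]
  simp

theorem heat_sub (τ : ℝ) (u v : 𝓢'(ℝ, ℂ)) : heat τ (u - v) = heat τ u - heat τ v := map_sub _ u v

theorem heat_hasTemperateGrowth {t : ℝ} (ht : 0 ≤ t) :
    (fun ξ : ℝ => ((Real.exp (-2 * Real.pi ^ 2 * t * ξ ^ 2) : ℝ) : ℂ)).HasTemperateGrowth := by
  rcases eq_or_lt_of_le ht with h | h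
  · have : (fun ξ : ℝ => ((Real.exp (-2 * Real.pi ^ 2 * t * ξ ^ 2) : ℝ) : ℂ)) = fun _ => 1 := by
      ext ξ; simp [← h]
    rw [this]
    exact Function.HasTemperateGrowth.const 1
  · have : (fun ξ : ℝ => ((Real.exp (-2 * Real.pi ^ 2 * t * ξ ^ 2) : ℝ) : ℂ))
        = ((𝓕 (gk t) : 𝓢(ℝ, ℂ)) : ℝ → ℂ) := funext fun ξ => (fourier_gk h ξ).symm
    rw [this]
    exact SchwartzMap.hasTemperateGrowth _

/-- Testing `P_t u` against a Gaussian amounts to testing `u` against a wider Gaussian. -/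
theorem heat_refl_gk {t ε : ℝ} (ht : 0 ≤ t) (hε : 0 < ε) (u : 𝓢'(ℝ, ℂ)) (x : ℝ) :
    heat t u (refl x (gk ε)) = u (refl x (gk (ε + t))) := by
  rw [heat, TemperedDistribution.fourierMultiplierCLM_apply_apply,
    fourier_smulLeft_fourierInv_refl _ (heat_hasTemperateGrowth ht) x (l := gk (ε + t))]
  intro ξ
  rw [fourier_gk hε, fourier_gk (by linarith), ← Complex.ofReal_mul, ← Real.exp_add]
  congr 2
  ring

/-- A distribution of negative regularity becomes a bounded function under the heat semigroup. -/
theorem exists_heat_of_besovNorm_le (D : DyadicPartition) {a S : ℝ} (ha0 : 0 < a) (ha1 : a < 1)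
    (hS : 0 ≤ S) :
    ∃ C, 0 ≤ C ∧ ∀ (u : 𝓢'(ℝ, ℂ)) (M : ℝ), 0 ≤ M → besovNorm D (-a) u ≤ ENNReal.ofReal M →
      ∀ τ, 0 < τ → τ ≤ S → ∃ g : ℝ →ᵇ ℂ, bdist g = heat τ u ∧ ‖g‖ ≤ C * M * τ ^ (-(a / 2)) := by
  have hF := cfat_nonneg D
  have hc := c1_nonneg
  set b := L1 D.antiKernel with hb
  have hb0 : 0 ≤ b := L1_nonneg _
  have hcd := cdy_nonneg ha0 ha1
  refine ⟨cfat D * S ^ (a / 2) + (1 + c1 * b) * cfat D * cdy a, by positivity,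
    fun u M hM hu τ hτ hτS => ?_⟩
  obtain ⟨f, hf⟩ := exists_blocks D hM hu
  have hp : 0 < √τ := Real.sqrt_pos.mpr hτ
  have h0 : ‖P τ (f 0)‖ ≤ cfat D * S ^ (a / 2) * M * τ ^ (-(a / 2)) := by
    refine (norm_P_le hτ _).trans ((hf 0).2.2.trans ?_)
    have h1 : (2 : ℝ) ^ (-((((0 : ℕ) : ℝ) - 1) * -a)) ≤ 1 :=
      Real.rpow_le_one_of_one_le_of_nonpos (by norm_num) (by simp; linarith)
    have h2 : 1 ≤ S ^ (a / 2) * τ ^ (-(a / 2)) := by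
      rw [Real.rpow_neg hτ.le, ← div_eq_mul_inv, one_le_div (by positivity)]
      exact Real.rpow_le_rpow hτ.le hτS (by linarith)
    calc _ ≤ cfat D * (1 * M) * 1 := by rw [mul_one]; gcongr
      _ ≤ cfat D * (1 * M) * (S ^ (a / 2) * τ ^ (-(a / 2))) := by gcongr
      _ = _ := by ring
  have hj : ∀ j : ℕ, ‖P τ (f (j + 1))‖ ≤ ((1 + c1 * b) * cfat D * M) *
      ((2 : ℝ) ^ ((j : ℝ) * a) * min 1 ((2 ^ j * √τ)⁻¹)) := by
    intro j
    have hl : (0 : ℝ) < 2 ^ j := by positivity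
    have h2 : ‖f (j + 1)‖ ≤ cfat D * (2 ^ ((j : ℝ) * a) * M) := by
      refine (hf (j + 1)).2.2.trans (le_of_eq ?_)
      congr 3
      push_cast
      ring
    -- the block is `2 ^ (-j)` times a derivative, which is moved onto the Gaussian
    have h3 : P τ (f (j + 1)) = (((2 ^ j : ℝ)⁻¹ : ℝ) : ℂ) •
        Q τ (conv (dil (2 ^ j) D.antiKernel) (f (j + 1))) := by
      have e1 : conv (dil (2 ^ j) (dk D.antiKernel)) (f (j + 1)) = f (j + 1) := (hf (j + 1)).2.1
      have e2 : ∀ g : ℝ →ᵇ ℂ, P τ (conv (dk (dil (2 ^ j) D.antiKernel)) g)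
          = Q τ (conv (dil (2 ^ j) D.antiKernel) g) := by
        intro g
        apply bdist_injective
        have hm : ∀ ξ, 𝓕 (dk (SchwartzMap.convolution (ContinuousLinearMap.mul ℂ ℂ) (gk τ)
            (dil (2 ^ j) D.antiKernel))) ξ
            = 2 * Real.pi * Complex.I * ξ * (𝓕 (gk τ) ξ * 𝓕 (dil (2 ^ j) D.antiKernel) ξ) := by
          intro ξ
          rw [fourier_dk, SchwartzMap.fourier_convolution]
          simp
        rw [P, Q, ← cv_bdist, ← cv_bdist, ← cv_bdist, ← cv_bdist,
          cv_cv (m := dk (SchwartzMap.convolution (ContinuousLinearMap.mul ℂ ℂ) (gk τ)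
            (dil (2 ^ j) D.antiKernel))) (fun ξ => by rw [hm, fourier_dk]; ring),
          cv_cv (m := dk (SchwartzMap.convolution (ContinuousLinearMap.mul ℂ ℂ) (gk τ)
            (dil (2 ^ j) D.antiKernel))) (fun ξ => by rw [hm, fourier_dk]; ring)]
      rw [← e2, dk_dil hl, smul_conv, e1, show P τ (((2 ^ j : ℝ) : ℂ) • f (j + 1))
        = ((2 ^ j : ℝ) : ℂ) • P τ (f (j + 1)) from conv_smul _ _ _, smul_smul, ← Complex.ofReal_mul,
        inv_mul_cancel₀ hl.ne', Complex.ofReal_one, one_smul]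
    have h4 : ‖P τ (f (j + 1))‖ ≤ (1 + c1 * b) * min 1 ((2 ^ j * √τ)⁻¹) * ‖f (j + 1)‖ := by
      have hm1 : ‖P τ (f (j + 1))‖ ≤ (1 + c1 * b) * 1 * ‖f (j + 1)‖ := by
        have := norm_P_le hτ (f (j + 1))
        have : 0 ≤ c1 * b * ‖f (j + 1)‖ := by positivity
        linarith
      have hm2 : ‖P τ (f (j + 1))‖ ≤ (1 + c1 * b) * (2 ^ j * √τ)⁻¹ * ‖f (j + 1)‖ := by
        rw [h3, norm_smul, Complex.norm_real, Real.norm_of_nonneg (by positivity)]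
        have e1 := norm_Q_le hτ (conv (dil (2 ^ j) D.antiKernel) (f (j + 1)))
        have e2 := norm_conv_le_L1 (dil (2 ^ j) D.antiKernel) (f (j + 1))
        rw [L1_dil hl] at e2
        have e3 : τ ^ (-(1 / 2) : ℝ) = (√τ)⁻¹ := by
          rw [Real.sqrt_eq_rpow, Real.rpow_neg hτ.le]
        rw [e3] at e1
        calc _ ≤ (2 ^ j : ℝ)⁻¹ * (c1 * (√τ)⁻¹ * (b * ‖f (j + 1)‖)) := by
              refine mul_le_mul_of_nonneg_left (e1.trans ?_) (by positivity)
              gcongr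
          _ = (c1 * b) * (2 ^ j * √τ)⁻¹ * ‖f (j + 1)‖ := by rw [mul_inv]; ring
          _ ≤ _ := by gcongr; linarith
      rcases le_total 1 ((2 ^ j * √τ)⁻¹) with h | h
      · rwa [min_eq_left h]
      · rwa [min_eq_right h]
    calc _ ≤ (1 + c1 * b) * min 1 ((2 ^ j * √τ)⁻¹) * (cfat D * (2 ^ ((j : ℝ) * a) * M)) :=
          h4.trans (by gcongr)
      _ = _ := by ring
  have hsum : ∀ n, ∑ j ∈ Finset.range n, ‖P τ (f (j + 1))‖
      ≤ (1 + c1 * b) * cfat D * cdy a * M * τ ^ (-(a / 2)) := by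
    intro n
    refine (Finset.sum_le_sum fun j _ => hj j).trans ?_
    rw [← Finset.mul_sum]
    refine (mul_le_mul_of_nonneg_left (sum_min_rpow_le ha0 ha1 hp n) (by positivity)).trans
      (le_of_eq ?_)
    rw [Real.sqrt_eq_rpow, ← Real.rpow_mul hτ.le, cdy]
    ring_nf
  have hs' : Summable fun j => ‖P τ (f (j + 1))‖ :=
    summable_of_sum_range_le (fun _ => norm_nonneg _) hsum
  have hs : Summable fun j => ‖P τ (f j)‖ := (summable_nat_add_iff 1).mp hs'
  refine ⟨∑' j, P τ (f j), bdist_tsum_eq D _ _ (fun j => ?_) hs, ?_⟩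
  · rw [P, ← cv_bdist, (hf j).1, D.block_eq_cv, D.block_eq_cv, heat_eq_cv hτ, cv_comm]
  · refine (norm_tsum_le_tsum_norm hs).trans ?_
    rw [hs.tsum_eq_zero_add]
    have := Real.tsum_le_of_sum_range_le (fun _ => norm_nonneg _) hsum
    calc _ ≤ cfat D * S ^ (a / 2) * M * τ ^ (-(a / 2))
          + (1 + c1 * b) * cfat D * cdy a * M * τ ^ (-(a / 2)) := add_le_add h0 this
      _ = _ := by ring

/-- Time regularity of the heat flow of an element of `C^{1+ν}`. -/
theorem besovNorm_heat_sub_le (D : DyadicPartition) {η ν : ℝ} (hην : η ≤ ν) :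
    ∃ C, 0 ≤ C ∧ ∀ (u : 𝓢'(ℝ, ℂ)) (M : ℝ), 0 ≤ M → besovNorm D (1 + ν) u ≤ ENNReal.ofReal M →
      ∀ s t, 0 ≤ s → s < t → besovNorm D η (heat t u - heat s u)
        ≤ ENNReal.ofReal (C * M * (t - s) ^ (1 / 2 : ℝ)) := by
  have hF := cfat_nonneg D
  have hm := mom_nonneg 1 g1
  set b := 4 * L1 (dk D.lowKernel) + L1 (dk (dk D.antiKernel)) with hb
  have hb1 := L1_nonneg (dk D.lowKernel)
  have hb2 := L1_nonneg (dk (dk D.antiKernel))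
  have hb0 : 0 ≤ b := by positivity
  refine ⟨b * cfat D * mom 1 g1 * 2 ^ (ν - η), by positivity, fun u M hM hu s t hs hst => ?_⟩
  obtain ⟨f, hf⟩ := exists_blocks D hM hu
  set d := t - s with hd
  have hd0 : 0 < d := by linarith
  have hL : ∀ j : ℕ, L1 (dk (D.fatKernel j)) ≤ b * 2 ^ ((j : ℝ) - 1) := by
    intro j
    cases j with
    | zero =>
      rw [DyadicPartition.fatKernel, L1_dk_dil two_pos, Nat.cast_zero, zero_sub, Real.rpow_neg_one]
      linarith
    | succ j =>
      rw [DyadicPartition.fatKernel, L1_dk_dil (by positivity), Nat.cast_add, Nat.cast_one,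
        add_sub_cancel_right, Real.rpow_natCast, mul_comm]
      have : (0 : ℝ) < 2 ^ j := by positivity
      gcongr
      linarith
  have hw : ∀ j, ∃ w : ℝ →ᵇ ℂ, bdist w = D.block j (heat t u - heat s u) ∧
      ‖w‖ ≤ ‖P d (f j) - f j‖ := by
    intro j
    have e1 : ∀ τ, 0 < τ → D.block j (heat τ u) = bdist (P τ (f j)) := fun τ hτ => by
      rw [P, ← cv_bdist, (hf j).1, D.block_eq_cv, D.block_eq_cv, heat_eq_cv hτ, cv_comm]
    rcases eq_or_lt_of_le hs with h | h
    · refine ⟨P d (f j) - f j, ?_, le_rfl⟩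
      rw [block_sub, ← h, heat_zero, e1 t (by linarith), ← (hf j).1, bdist_sub, hd, ← h, sub_zero]
    · refine ⟨P s (P d (f j) - f j), ?_, norm_P_le h _⟩
      rw [block_sub, e1 t (by linarith), e1 s h, ← bdist_sub, P_sub, P_P h hd0, hd,
        add_sub_cancel]
  choose w hw using hw
  refine besovNorm_le_of_blocks D (fun j => (hw j).1) fun j => ?_
  have h1 := norm_P_sub_le_of_lipschitz hd0 (v := f j)
    (L := L1 (dk (D.fatKernel j)) * ‖f j‖) (mul_nonneg (L1_nonneg _) (norm_nonneg _))
    (fun x y => by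
      have := norm_conv_sub_le (D.fatKernel j) (f j) x y
      rwa [(hf j).2.1] at this)
  have h2 := (hf j).2.2
  have h3 := hL j
  have h4 : (2 : ℝ) ^ (((j : ℝ) - 1) * η) * (2 ^ ((j : ℝ) - 1) * 2 ^ (-(((j : ℝ) - 1) * (1 + ν))))
      ≤ 2 ^ (ν - η) := by
    rw [← Real.rpow_add (by norm_num), ← Real.rpow_add (by norm_num)]
    refine Real.rpow_le_rpow_of_exponent_le (by norm_num) ?_
    have : (0 : ℝ) ≤ j := by positivity
    nlinarith [mul_nonneg this (sub_nonneg.mpr hην)]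
  calc _ ≤ (2 : ℝ) ^ (((j : ℝ) - 1) * η) * ((b * 2 ^ ((j : ℝ) - 1)) *
        (cfat D * (2 ^ (-(((j : ℝ) - 1) * (1 + ν))) * M)) * (mom 1 g1 * d ^ (1 / 2 : ℝ))) := by
        refine mul_le_mul_of_nonneg_left (((hw j).2.trans h1).trans ?_) (by positivity)
        gcongr
    _ = (b * cfat D * mom 1 g1) * ((2 : ℝ) ^ (((j : ℝ) - 1) * η) *
        (2 ^ ((j : ℝ) - 1) * 2 ^ (-(((j : ℝ) - 1) * (1 + ν))))) * M * d ^ (1 / 2 : ℝ) := by ring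
    _ ≤ _ := by gcongr

/-! ### Real functions, their distributions, and curves of distributions -/

/-- A bounded continuous real function, regarded as complex-valued. -/
def cB (f : ℝ →ᵇ ℝ) : ℝ →ᵇ ℂ :=
  BoundedContinuousFunction.ofNormedAddCommGroup (fun x => (f x : ℂ)) (by fun_prop) ‖f‖
    fun x => by simpa using f.norm_coe_le_norm x

@[simp] theorem cB_apply (f : ℝ →ᵇ ℝ) (x : ℝ) : cB f x = (f x : ℂ) := rfl

theorem cB_sub (f g : ℝ →ᵇ ℝ) : cB (f - g) = cB f - cB g := by
  ext x; simp

theorem toDist_eq {f : ℝ → ℝ} {g : ℝ →ᵇ ℂ} (h : ∀ x, (f x : ℂ) = g x) : toDist f = bdist g := by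
  have h1 : (fun x => (f x : ℂ)) = g := funext h
  have hm : MemLp (fun x => (f x : ℂ)) ⊤ (volume : Measure ℝ) := by rw [h1]; exact g.memLp_top
  rw [toDist, dif_pos hm, bdist]
  congr 1
  exact MemLp.toLp_congr _ _ (by rw [h1])

theorem toDist_coe (f : ℝ →ᵇ ℝ) : toDist f = bdist (cB f) := toDist_eq fun _ => rfl

theorem funNorm_eq (D : DyadicPartition) (γ : ℝ) (f : ℝ →ᵇ ℝ) :
    funNorm D γ f = besovNorm D γ (bdist (cB f)) := by rw [funNorm, toDist_coe]

theorem linftyNorm_le (f : ℝ →ᵇ ℝ) : linftyNorm f ≤ ENNReal.ofReal ‖cB f‖ := by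
  rw [linftyNorm, eLpNorm_exponent_top]
  refine eLpNormEssSup_le_of_ae_bound (ae_of_all _ fun x => ?_)
  simpa using (cB f).norm_coe_le_norm x

theorem distLinftyNorm_neg_le (u : 𝓢'(ℝ, ℂ)) : distLinftyNorm (-u) ≤ distLinftyNorm u := by
  by_cases hu : distLinftyNorm u < ⊤
  swap
  · rw [not_lt_top_iff.mp hu]; exact le_top
  obtain ⟨f, hf, hf'⟩ := exists_Lp_of_distLinftyNorm_lt hu
  have h : Lp.toTemperedDistribution (-f) = -u := by
    rw [← hf]
    exact map_neg (Lp.toTemperedDistributionCLM ℂ (volume : Measure ℝ) ⊤) f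
  rw [hf', ← h, ← norm_neg f]
  exact distLinftyNorm_toTemperedDistribution_le (-f)

theorem besovNorm_neg (D : DyadicPartition) (γ : ℝ) (u : 𝓢'(ℝ, ℂ)) :
    besovNorm D γ (-u) = besovNorm D γ u := by
  have h : ∀ v, besovNorm D γ (-v) ≤ besovNorm D γ v := fun v => by
    refine iSup_mono fun j => mul_le_mul_right ?_ _
    rw [show D.block j (-v) = -D.block j v from map_neg _ v]
    exact distLinftyNorm_neg_le _
  exact le_antisymm (h u) (by simpa using h (-u))

/-- The spaces `C^γ` decrease in `γ`. -/
theorem besovNorm_lt_top_of_le (D : DyadicPartition) {γ γ' : ℝ} (h : γ ≤ γ') {u : 𝓢'(ℝ, ℂ)}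
    (hu : besovNorm D γ' u < ⊤) : besovNorm D γ u < ⊤ := by
  refine lt_of_le_of_lt (b := ENNReal.ofReal (2 ^ (γ' - γ)) * besovNorm D γ' u) ?_
    (ENNReal.mul_lt_top ENNReal.ofReal_lt_top hu)
  refine iSup_le fun j => ?_
  refine le_trans ?_ (mul_le_mul_right (le_iSup (fun j : ℕ =>
    ENNReal.ofReal ((2 : ℝ) ^ (((j : ℝ) - 1) * γ')) * distLinftyNorm (D.block j u)) j) _)
  rw [← mul_assoc, ← ENNReal.ofReal_mul (by positivity), ← Real.rpow_add (by norm_num)]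
  refine mul_le_mul_left (ENNReal.ofReal_le_ofReal
    (Real.rpow_le_rpow_of_exponent_le (by norm_num) ?_)) _
  have : (0 : ℝ) ≤ j := by positivity
  nlinarith [mul_nonneg this (sub_nonneg.mpr h)]

/-- A bound on increments turns continuity in an extended norm into continuity in sup norm. -/
theorem continuousOn_of_memC {X : Type*} [AddCommGroup X] {n : X → ℝ≥0∞} {T C : ℝ} {f : ℝ → X}
    (hf : MemC T n f) (g : ℝ → ℝ →ᵇ ℂ)
    (h : ∀ s ∈ Icc 0 T, ∀ t ∈ Icc 0 T, ∀ M : ℝ, 0 ≤ M → n (f s - f t) ≤ ENNReal.ofReal M →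
      ‖g s - g t‖ ≤ C * M) : ContinuousOn g (Icc 0 T) := by
  intro t ht
  have h1 := (hf t ht).2
  refine tendsto_iff_norm_sub_tendsto_zero.mpr ?_
  have h2 : Tendsto (fun s => C * (n (f s - f t)).toReal) (𝓝[Icc 0 T] t) (𝓝 0) := by
    simpa using ((ENNReal.tendsto_toReal ENNReal.zero_ne_top).comp h1).const_mul C
  refine squeeze_zero' (Eventually.of_forall fun _ => norm_nonneg _) ?_ h2
  filter_upwards [self_mem_nhdsWithin, h1.eventually_lt_const ENNReal.zero_lt_top] with s hs hs'
  exact h s hs t ht _ ENNReal.toReal_nonneg (ENNReal.ofReal_toReal hs'.ne).ge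

theorem le_holderSeminorm_mul {X : Type*} [AddCommGroup X] {n : X → ℝ≥0∞} {T κ : ℝ} {f : ℝ → X}
    {s t : ℝ} (hs : s ∈ Icc 0 T) (ht : t ∈ Icc 0 T) (hst : t ≠ s) :
    n (f t - f s) ≤ holderSeminorm T κ n f * ENNReal.ofReal (|t - s| ^ κ) := by
  have h0 : 0 < |t - s| ^ κ := Real.rpow_pos_of_pos (abs_pos.mpr (sub_ne_zero.mpr hst)) _
  refine (ENNReal.div_le_iff (by simpa using h0) ENNReal.ofReal_ne_top).mp ?_
  exact le_iSup₂_of_le t ht (le_iSup₂_of_le s hs (le_iSup_of_le hst le_rfl))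

theorem holderSeminorm_le {X : Type*} [AddCommGroup X] {n : X → ℝ≥0∞} {T κ : ℝ} {f : ℝ → X}
    {A : ℝ≥0∞} (hneg : ∀ u, n (-u) = n u)
    (h : ∀ s ∈ Icc 0 T, ∀ t ∈ Icc 0 T, s < t →
      n (f t - f s) ≤ A * ENNReal.ofReal ((t - s) ^ κ)) :
    holderSeminorm T κ n f ≤ A := by
  refine iSup₂_le fun t ht => iSup₂_le fun s hs => iSup_le fun hts => ?_
  refine ENNReal.div_le_of_le_mul ?_
  rcases lt_or_gt_of_ne hts with h1 | h1
  · rw [← neg_sub, hneg, abs_sub_comm, abs_of_pos (sub_pos.mpr h1)]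
    exact h t ht s hs h1
  · rw [abs_of_pos (sub_pos.mpr h1)]
    exact h s hs t ht h1

theorem MemCHolder.of_finite {X : Type*} [AddCommGroup X] {n : X → ℝ≥0∞} {T κ : ℝ} {f : ℝ → X}
    (hκ : 0 < κ) (h0 : n 0 = 0) (hn : ∀ t ∈ Icc 0 T, n (f t) < ⊤)
    (h : holderSeminorm T κ n f < ⊤) : MemCHolder T κ n f := by
  refine ⟨fun t ht => ⟨hn t ht, ?_⟩, h⟩
  have h1 : Tendsto (fun s => holderSeminorm T κ n f * ENNReal.ofReal (|s - t| ^ κ))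
      (𝓝[Icc 0 T] t) (𝓝 0) := by
    have h2 : Tendsto (fun s : ℝ => |s - t| ^ κ) (𝓝 t) (𝓝 0) := by
      have : Continuous fun s : ℝ => |s - t| ^ κ :=
        (continuous_id.sub continuous_const).abs.rpow_const fun _ => Or.inr hκ.le
      simpa [hκ.ne'] using this.tendsto t
    have h3 := ENNReal.Tendsto.const_mul (a := holderSeminorm T κ n f)
      (ENNReal.tendsto_ofReal (h2.mono_left (nhdsWithin_le_nhds (s := Icc 0 T)))) (Or.inr h.ne)
    simpa using h3
  refine tendsto_of_tendsto_of_tendsto_of_le_of_le' tendsto_const_nhds h1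
    (Eventually.of_forall fun _ => zero_le) ?_
  filter_upwards [self_mem_nhdsWithin] with s hs
  rcases eq_or_ne s t with rfl | hst
  · rw [sub_self, h0]; exact zero_le
  · exact le_holderSeminorm_mul ht hs hst

theorem MemCHolder.supNorm_lt_top {T κ a : ℝ} (D : DyadicPartition) {b : ℝ → 𝓢'(ℝ, ℂ)}
    (hκ : 0 ≤ κ) (hT : 0 ≤ T) (h : MemCHolder T κ (besovNorm D a) b) :
    supNorm T (besovNorm D a) b < ⊤ := by
  have h0 : (0 : ℝ) ∈ Icc 0 T := ⟨le_rfl, hT⟩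
  refine lt_of_le_of_lt (b := besovNorm D a (b 0) +
    holderSeminorm T κ (besovNorm D a) b * ENNReal.ofReal (T ^ κ)) ?_
    (ENNReal.add_lt_top.mpr ⟨(h.1 0 h0).1, ENNReal.mul_lt_top h.2 ENNReal.ofReal_lt_top⟩)
  refine iSup₂_le fun t ht => ?_
  rcases eq_or_ne t 0 with rfl | ht0
  · exact le_self_add
  have h1 := besovNorm_add_le D a (b 0) (b t - b 0)
  rw [add_sub_cancel] at h1
  refine h1.trans (add_le_add_right ((le_holderSeminorm_mul (κ := κ) h0 ht ht0).trans
    (mul_le_mul_right (ENNReal.ofReal_le_ofReal ?_) _)) _)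
  rw [sub_zero, abs_of_nonneg ht.1]
  exact Real.rpow_le_rpow ht.1 ht.2 hκ

/-! ### The mollified drift -/

/-- The heat flow of a real distribution is real. -/
theorem IsRealDist.im_eq_zero {u : 𝓢'(ℝ, ℂ)} (hu : IsRealDist u) {g : ℝ →ᵇ ℂ} {τ : ℝ} (hτ : 0 < τ)
    (hg : bdist g = heat τ u) (x : ℝ) : (g x).im = 0 := by
  have h1 : Tendsto (fun ε => (P ε g x).im) (𝓝[>] 0) (𝓝 (g x).im) :=
    (Complex.continuous_im.tendsto _).comp (tendsto_P g x)
  refine tendsto_nhds_unique h1 (tendsto_const_nhds.congr' ?_)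
  filter_upwards [self_mem_nhdsWithin] with ε hε
  have hε : 0 < ε := hε
  rw [P, ← bdist_refl, hg, heat_refl_gk hτ.le hε, hu]
  intro y
  rw [refl_apply, gk_apply (by linarith), Complex.ofReal_im]

/-- The choice in `reprFun` recovers the function that represents `P_{1/N} b(t)`. -/
theorem cB_mollified {b : ℝ → 𝓢'(ℝ, ℂ)} {t N : ℝ} (hb : IsRealDist (b t)) (hN : 0 < N)
    {g : ℝ →ᵇ ℂ} (hg : bdist g = heat (1 / N) (b t)) : cB (mollified N b t) = g := by
  have hex : ∃ f : ℝ →ᵇ ℝ, toDist f = heat (1 / N) (b t) := by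
    refine ⟨BoundedContinuousFunction.ofNormedAddCommGroup (fun x => (g x).re) (by fun_prop) ‖g‖
      fun x => (Complex.abs_re_le_norm _).trans (g.norm_coe_le_norm x), ?_⟩
    rw [← hg]
    refine toDist_eq fun x => ?_
    refine Complex.ext ?_ ?_
    · simp
    · simp [hb.im_eq_zero (by positivity) hg x]
  apply bdist_injective
  rw [hg, ← hex.choose_spec, ← toDist_coe, mollified, reprFun, dif_pos hex]

/-- The mollified drift is uniformly bounded in the negative Hölder scale, and its positive
Hölder norms grow like a power of `N`. -/
theorem drift_bounds (D : DyadicPartition) {a η S : ℝ} (ha0 : 0 < a) (ha1 : a < 1)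
    (hη0 : 0 ≤ η) (hη1 : η ≤ 1) (hS : 1 ≤ S) :
    ∃ C, 0 ≤ C ∧ ∀ (b : ℝ → 𝓢'(ℝ, ℂ)) (t N M : ℝ), IsRealDist (b t) → 1 ≤ N → 0 ≤ M →
      besovNorm D (-a) (b t) ≤ ENNReal.ofReal M →
      (∀ τ, 0 < τ → τ ≤ S → ‖P τ (cB (mollified N b t))‖ ≤ C * M * τ ^ (-(a / 2))) ∧
      HB η (C * M * N ^ ((η + a) / 2)) (cB (mollified N b t)) := by
  obtain ⟨C, hC, h⟩ := exists_heat_of_besovNorm_le D ha0 ha1 (by linarith : (0 : ℝ) ≤ S)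
  have hc := c1_nonneg
  have hge : C ≤ C * ((3 + c1) * 2 ^ ((η + a) / 2)) := by
    refine le_mul_of_one_le_right hC ?_
    have : (1 : ℝ) ≤ 2 ^ ((η + a) / 2) :=
      Real.one_le_rpow (by norm_num) (by linarith)
    nlinarith
  refine ⟨C * ((3 + c1) * 2 ^ ((η + a) / 2)), hC.trans hge, fun b t N M hb hN hM hu => ?_⟩
  have hN0 : 0 < N := by linarith
  have hN1 : 1 / N ≤ 1 := (div_le_one hN0).mpr hN
  have key : ∀ σ, 0 < σ → σ ≤ S → ∀ ρ, 0 < ρ → ∀ g' : ℝ →ᵇ ℂ, bdist g' = heat σ (b t) →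
      bdist (P ρ g') = heat (ρ + σ) (b t) := by
    intro σ hσ hσS ρ hρ g' hg'
    rw [P, ← cv_bdist, hg', heat_eq_cv hσ, heat_eq_cv (by positivity)]
    refine cv_cv (fun ξ => ?_) _
    rw [fourier_gk hρ, fourier_gk hσ, fourier_gk (by positivity), ← Complex.ofReal_mul,
      ← Real.exp_add]
    congr 2
    ring
  obtain ⟨g, hg, hgn⟩ := h (b t) M hM hu (1 / N) (by positivity) (by linarith)
  rw [cB_mollified hb hN0 hg]
  constructor
  · intro τ hτ hτS
    obtain ⟨f, hf, hfn⟩ := h (b t) M hM hu τ hτ hτS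
    have e : P τ g = P (1 / N) f := by
      apply bdist_injective
      rw [key _ (by positivity) (by linarith) _ hτ _ hg, key _ hτ hτS _ (by positivity) _ hf,
        add_comm]
    rw [e]
    refine (norm_P_le (by positivity) _).trans (hfn.trans ?_)
    gcongr
  · have h2 : 1 / (2 * N) ≤ S := by
      have : 1 / (2 * N) ≤ 1 := (div_le_one (by positivity)).mpr (by linarith)
      linarith
    have h3 : 0 < 1 / (2 * N) := by positivity
    -- half of the mollification is spent on the negative regularity, half on the Hölder norm
    obtain ⟨f, hf, hfn⟩ := h (b t) M hM hu _ h3 h2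
    have e : g = P (1 / (2 * N)) f := by
      apply bdist_injective
      rw [key _ h3 h2 _ h3 _ hf, hg]
      congr 1
      field_simp
      norm_num
    have h4 : ∀ p : ℝ, (1 / (2 * N)) ^ (-p) = 2 ^ p * N ^ p := by
      intro p
      rw [one_div, Real.inv_rpow (by positivity), Real.rpow_neg (by positivity), inv_inv,
        Real.mul_rpow (by norm_num) hN0.le]
    rw [h4] at hfn
    set X := (2 : ℝ) ^ ((η + a) / 2) with hX
    set Y := N ^ ((η + a) / 2) with hY
    have hXs : (2 : ℝ) ^ (η / 2) * 2 ^ (a / 2) = X := by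
      rw [← Real.rpow_add (by norm_num), hX]; ring_nf
    have hYs : N ^ (η / 2) * N ^ (a / 2) = Y := by
      rw [← Real.rpow_add hN0, hY]; ring_nf
    have hX1 : (2 : ℝ) ^ (a / 2) ≤ X :=
      Real.rpow_le_rpow_of_exponent_le (by norm_num) (by linarith)
    have hY1 : N ^ (a / 2) ≤ Y := Real.rpow_le_rpow_of_exponent_le hN (by linarith)
    rw [e]
    refine HB.of_shift ?_ fun y => ?_
    · refine (norm_P_le h3 _).trans (hfn.trans ?_)
      calc C * M * (2 ^ (a / 2) * N ^ (a / 2)) ≤ C * M * (X * Y) := by gcongr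
        _ = 1 * (C * M * (X * Y)) := by ring
        _ ≤ (3 + c1) * (C * M * (X * Y)) := by gcongr; linarith
        _ = _ := by ring
    · refine (norm_shift_P_sub_le hη0 hη1 h3 f y).trans ?_
      rw [h4]
      calc (2 + c1) * (2 ^ (η / 2) * N ^ (η / 2)) * ‖f‖ * |y| ^ η
          ≤ (2 + c1) * (2 ^ (η / 2) * N ^ (η / 2)) * (C * M * (2 ^ (a / 2) * N ^ (a / 2)))
            * |y| ^ η := by gcongr
        _ = (2 + c1) * (C * M * (X * Y)) * |y| ^ η := by rw [← hXs, ← hYs]; ring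
        _ ≤ (3 + c1) * (C * M * (X * Y)) * |y| ^ η := by gcongr; norm_num
        _ = _ := by ring

theorem continuousOn_mollified (D : DyadicPartition) {a T N : ℝ} (ha0 : 0 < a) (ha1 : a < 1)
    (hN : 1 ≤ N) {b : ℝ → 𝓢'(ℝ, ℂ)} (hr : ∀ t ∈ Icc 0 T, IsRealDist (b t))
    (hb : MemC T (besovNorm D (-a)) b) :
    ContinuousOn (fun t => cB (mollified N b t)) (Icc 0 T) := by
  obtain ⟨C, hC, h⟩ := exists_heat_of_besovNorm_le D ha0 ha1 zero_le_one
  have hN0 : 0 < 1 / N := by positivity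
  have hN1 : 1 / N ≤ 1 := (div_le_one (by linarith)).mpr hN
  refine continuousOn_of_memC (C := C * (1 / N) ^ (-(a / 2))) hb _ fun s hs t ht M hM hM' => ?_
  obtain ⟨f, hf, -⟩ := h (b s) _ ENNReal.toReal_nonneg
    (ENNReal.ofReal_toReal (hb s hs).1.ne).ge _ hN0 hN1
  obtain ⟨g, hg, -⟩ := h (b t) _ ENNReal.toReal_nonneg
    (ENNReal.ofReal_toReal (hb t ht).1.ne).ge _ hN0 hN1
  obtain ⟨k, hk, hk'⟩ := h (b s - b t) M hM hM' _ hN0 hN1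
  rw [cB_mollified (hr s hs) (by linarith) hf, cB_mollified (hr t ht) (by linarith) hg]
  have : f - g = k := bdist_injective (by rw [bdist_sub, hf, hg, hk, heat_sub])
  rw [this]
  exact hk'.trans (le_of_eq (by ring))

/-! ### Hölder bounds of integrals -/

theorem HB.sub {γ K L : ℝ} {f g : ℝ →ᵇ ℂ} (hf : HB γ K f) (hg : HB γ L g) :
    HB γ (K + L) (f - g : ℝ →ᵇ ℂ) := by
  refine ⟨fun x => ?_, fun x y => ?_⟩
  · exact (norm_sub_le _ _).trans (add_le_add (hf.1 x) (hg.1 x))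
  · have e : (f - g : ℝ →ᵇ ℂ) x - (f - g : ℝ →ᵇ ℂ) y = (f x - f y) - (g x - g y) := by
      simp only [BoundedContinuousFunction.sub_apply]; ring
    rw [e, add_mul]
    exact (norm_sub_le _ _).trans (add_le_add (hf.2 x y) (hg.2 x y))

theorem HB.integral {γ a b : ℝ} {q : ℝ → ℝ →ᵇ ℂ} {G : ℝ → ℝ} (hab : a ≤ b)
    (hq : IntervalIntegrable q volume a b) (hG : IntervalIntegrable G volume a b)
    (h : ∀ s ∈ Ioo a b, HB γ (G s) (q s)) :
    HB γ (∫ s in a..b, G s) (∫ s in a..b, q s : ℝ →ᵇ ℂ) := by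
  have hae : ∀ᵐ s ∂volume, s ∈ Ioc a b → HB γ (G s) (q s) := by
    filter_upwards [Measure.ae_ne volume b] with s hs hs'
    exact h s ⟨hs'.1, lt_of_le_of_ne hs'.2 hs⟩
  have ev : ∀ x, (∫ s in a..b, q s : ℝ →ᵇ ℂ) x = ∫ s in a..b, q s x := fun x =>
    ((BoundedContinuousFunction.evalCLM ℂ x).intervalIntegral_comp_comm hq).symm
  have evi : ∀ x, IntervalIntegrable (fun s => q s x) volume a b := fun x =>
    ⟨(BoundedContinuousFunction.evalCLM ℂ x : (ℝ →ᵇ ℂ) →L[ℂ] ℂ).integrable_comp hq.1,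
      (BoundedContinuousFunction.evalCLM ℂ x : (ℝ →ᵇ ℂ) →L[ℂ] ℂ).integrable_comp hq.2⟩
  refine ⟨fun x => ?_, fun x y => ?_⟩
  · rw [ev]
    refine intervalIntegral.norm_integral_le_of_norm_le hab ?_ hG
    filter_upwards [hae] with s hs hs'
    exact (hs hs').1 x
  · rw [ev, ev, ← intervalIntegral.integral_sub (evi x) (evi y),
      ← intervalIntegral.integral_mul_const]
    refine intervalIntegral.norm_integral_le_of_norm_le hab ?_ (hG.mul_const _)
    filter_upwards [hae] with s hs hs'
    exact (hs hs').2 x y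

/-- Hölder bounds are preserved in the limit `ε → 0` of `P_ε f`. -/
theorem HB.of_forall_P {γ K : ℝ} {f : ℝ →ᵇ ℂ} (h : ∀ ε, 0 < ε → ε < 1 → HB γ K (SingularFP.P ε f)) :
    HB γ K f := by
  refine ⟨fun x => norm_le_of_forall_P one_pos fun ε h0 h1 => (h ε h0 h1).1 x, fun x y => ?_⟩
  have h2 : ‖(shift (x - y) f - f) y‖ ≤ K * |x - y| ^ γ := by
    refine norm_le_of_forall_P one_pos fun ε h0 h1 => ?_
    rw [P_sub, P_shift]
    simpa using (h ε h0 h1).2 x y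
  simpa using h2

/-! ### The smoothed mild equation -/

theorem norm_Q_sub_le {ε τ τ' : ℝ} (hε : 0 < ε) (h : ε ≤ τ) (h' : ε ≤ τ') (f : ℝ →ᵇ ℂ) :
    ‖Q τ f - Q τ' f‖ ≤ cQ * (ε⁻¹ * ε ^ (-(1 / 2) : ℝ)) * |τ - τ'| * ‖f‖ := by
  wlog hlt : τ' < τ generalizing τ τ' with H
  · rcases eq_or_lt_of_le (not_lt.mp hlt) with rfl | h1
    · simp
    · rw [norm_sub_rev, abs_sub_comm]
      exact H h' h h1
  have hc := cQ_nonneg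
  have h1 := norm_Q_add_sub_le (hε.trans_le h') (sub_pos.mpr hlt) f
  rw [add_sub_cancel] at h1
  refine h1.trans ?_
  rw [abs_of_pos (sub_pos.mpr hlt)]
  have h0 : 0 < τ' := hε.trans_le h'
  have h2 : min 1 ((τ - τ') / τ') * τ' ^ (-(1 / 2) : ℝ)
      ≤ (τ - τ') * ε⁻¹ * ε ^ (-(1 / 2) : ℝ) := by
    have h3 : min 1 ((τ - τ') / τ') ≤ (τ - τ') * ε⁻¹ := by
      refine (min_le_right _ _).trans ?_
      rw [div_eq_mul_inv]
      have := sub_pos.mpr hlt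
      gcongr
    have h4 : τ' ^ (-(1 / 2) : ℝ) ≤ ε ^ (-(1 / 2) : ℝ) :=
      Real.rpow_le_rpow_of_nonpos hε h' (by norm_num)
    have := sub_pos.mpr hlt
    exact mul_le_mul h3 h4 (by positivity) (by positivity)
  calc _ ≤ cQ * ((τ - τ') * ε⁻¹ * ε ^ (-(1 / 2) : ℝ)) * ‖f‖ := by gcongr
    _ = _ := by ring

/-- The integrand of the mild equation is continuous as long as `c - s` stays away from `0`. -/
theorem continuousOn_Q {T t c : ℝ} (htT : t ≤ T) (hc : t < c) {H : ℝ → ℝ →ᵇ ℂ}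
    (hH : ContinuousOn H (Icc 0 T)) : ContinuousOn (fun s => Q (c - s) (H s)) (Icc 0 t) := by
  intro s₀ hs₀
  set ε := c - t with hε
  have hε0 : 0 < ε := by linarith
  have hH' : Tendsto H (𝓝[Icc 0 t] s₀) (𝓝 (H s₀)) := (hH.mono (Icc_subset_Icc_right htT)) s₀ hs₀
  refine tendsto_iff_norm_sub_tendsto_zero.mpr ?_
  have h1 : Tendsto (fun s => c1 * ε ^ (-(1 / 2) : ℝ) * ‖H s - H s₀‖
      + cQ * (ε⁻¹ * ε ^ (-(1 / 2) : ℝ)) * |(c - s) - (c - s₀)| * ‖H s₀‖) (𝓝[Icc 0 t] s₀) (𝓝 0) := by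
    have h2 := (tendsto_iff_norm_sub_tendsto_zero.mp hH').const_mul (c1 * ε ^ (-(1 / 2) : ℝ))
    have h3 : Tendsto (fun s => cQ * (ε⁻¹ * ε ^ (-(1 / 2) : ℝ)) * |(c - s) - (c - s₀)| * ‖H s₀‖)
        (𝓝[Icc 0 t] s₀) (𝓝 0) := by
      have : Continuous fun s : ℝ =>
        cQ * (ε⁻¹ * ε ^ (-(1 / 2) : ℝ)) * |(c - s) - (c - s₀)| * ‖H s₀‖ := by fun_prop
      simpa using (this.tendsto s₀).mono_left nhdsWithin_le_nhds
    simpa using h2.add h3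
  refine squeeze_zero' (Eventually.of_forall fun _ => norm_nonneg _) ?_ h1
  filter_upwards [self_mem_nhdsWithin] with s hs
  have e : Q (c - s) (H s) - Q (c - s₀) (H s₀)
      = Q (c - s) (H s - H s₀) + (Q (c - s) (H s₀) - Q (c - s₀) (H s₀)) := by
    rw [Q_sub]; abel
  have hcs : ε ≤ c - s := by linarith [hs.2]
  have hc1 := c1_nonneg
  rw [e]
  refine (norm_add_le _ _).trans (add_le_add ?_ ?_)
  · refine (norm_Q_le (hε0.trans_le hcs) _).trans ?_
    have : (c - s) ^ (-(1 / 2) : ℝ) ≤ ε ^ (-(1 / 2) : ℝ) :=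
      Real.rpow_le_rpow_of_nonpos hε0 hcs (by norm_num)
    gcongr
  · exact norm_Q_sub_le hε0 hcs (by linarith [hs₀.2]) _

/-- The curve `r` solves `r(t) = P_t r₀ - ∫_0^t ∂_x P_{t-s} H(s) ds` after smoothing by `P_ε` for
every `ε > 0`. The integrand is then continuous in sup norm, up to the endpoint `s = t`. -/
structure SmoothedMild (T : ℝ) (r₀ : ℝ →ᵇ ℂ) (H r : ℝ → ℝ →ᵇ ℂ) : Prop where
  cont : ContinuousOn H (Icc 0 T)
  eq : ∀ t ∈ Icc 0 T, ∀ ε, 0 < ε →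
    P ε (r t) = P (ε + t) r₀ - ∫ s in (0 : ℝ)..t, Q (ε + t - s) (H s)

namespace SmoothedMild

variable {T : ℝ} {r₀ : ℝ →ᵇ ℂ} {H r : ℝ → ℝ →ᵇ ℂ}

theorem intervalIntegrable_Q (h : SmoothedMild T r₀ H r) {t c u v : ℝ} (hu : 0 ≤ u) (huv : u ≤ v)
    (hv : v ≤ t) (htT : t ≤ T) (hc : t < c) :
    IntervalIntegrable (fun s => Q (c - s) (H s)) volume u v := by
  refine ContinuousOn.intervalIntegrable ?_
  rw [uIcc_of_le huv]
  exact (continuousOn_Q htT hc h.cont).mono (Icc_subset_Icc hu hv)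

end SmoothedMild

theorem intervalIntegrable_sub_rpow {σ : ℝ} (hσ : σ < 1) (t : ℝ) :
    IntervalIntegrable (fun s => (t - s) ^ (-σ)) volume 0 t := by
  have := (intervalIntegral.intervalIntegrable_rpow' (a := t) (b := 0)
    (by linarith : -1 < -σ)).comp_sub_left t
  simpa using this

theorem integral_sub_rpow {σ : ℝ} (hσ : σ < 1) (t : ℝ) :
    ∫ s in (0 : ℝ)..t, (t - s) ^ (-σ) = t ^ (1 - σ) / (1 - σ) := by
  rw [intervalIntegral.integral_comp_sub_left (fun x => x ^ (-σ)), sub_self, sub_zero,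
    integral_rpow (Or.inl (by linarith)), Real.zero_rpow (by linarith), sub_zero,
    show -σ + 1 = 1 - σ by ring]

/-- The convolution of an exponential with the singular kernel of the mild equation. -/
theorem integral_exp_mul_sub_rpow_le {σ l t : ℝ} (hσ : σ < 1) (hl : 0 < l) (ht : 0 ≤ t) :
    ∫ s in (0 : ℝ)..t, Real.exp (l * s) * (t - s) ^ (-σ)
      ≤ Real.exp (l * t) * ((1 / l) ^ (1 - σ) * Real.Gamma (1 - σ)) := by
  have hG := Real.integral_rpow_mul_exp_neg_mul_Ioi (by linarith : 0 < 1 - σ) hl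
  have hpos : 0 < (1 / l) ^ (1 - σ) * Real.Gamma (1 - σ) :=
    mul_pos (by positivity) (Real.Gamma_pos_of_pos (by linarith))
  have hi : IntegrableOn (fun u : ℝ => u ^ (1 - σ - 1) * Real.exp (-(l * u))) (Ioi 0) :=
    Integrable.of_integral_ne_zero (by rw [hG]; exact hpos.ne')
  have e1 : ∀ s, Real.exp (l * s) * (t - s) ^ (-σ)
      = Real.exp (l * t) * ((t - s) ^ (1 - σ - 1) * Real.exp (-(l * (t - s)))) := by
    intro s
    rw [show l * s = l * t + -(l * (t - s)) by ring, Real.exp_add, show 1 - σ - 1 = -σ by ring]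
    ring
  simp_rw [e1]
  rw [intervalIntegral.integral_const_mul, intervalIntegral.integral_comp_sub_left
    (fun u => u ^ (1 - σ - 1) * Real.exp (-(l * u))), sub_self, sub_zero, ← hG,
    intervalIntegral.integral_of_le ht]
  refine mul_le_mul_of_nonneg_left ?_ (Real.exp_pos _).le
  refine setIntegral_mono_set hi ?_ (Ioc_subset_Ioi_self.eventuallyLE)
  filter_upwards [self_mem_ae_restrict measurableSet_Ioi] with u hu
  have hu : 0 < u := hu
  change 0 ≤ _
  positivity

namespace SmoothedMild

variable {T : ℝ} {r₀ : ℝ →ᵇ ℂ} {H r : ℝ → ℝ →ᵇ ℂ}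

/-- A Hölder bound for `∂_x P_τ H(s)` with an integrable singularity at `τ = 0` bounds `r`. -/
theorem HB_of_flux (h : SmoothedMild T r₀ H r) {γ R σ t : ℝ} (hσ0 : 0 ≤ σ) (hσ1 : σ < 1)
    (hR : HB γ R r₀) {k : ℝ → ℝ} (hk : Continuous k) (hk0 : ∀ s, 0 ≤ k s) (ht : t ∈ Icc 0 T)
    (hQ : ∀ s ∈ Icc 0 T, ∀ τ, 0 < τ → τ ≤ T + 1 → HB γ (k s * τ ^ (-σ)) (Q τ (H s))) :
    HB γ (R + ∫ s in (0 : ℝ)..t, k s * (t - s) ^ (-σ)) (r t) := by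
  refine HB.of_forall_P fun ε h0 h1 => ?_
  rw [h.eq t ht ε h0]
  refine (hR.P (by linarith [ht.1])).sub (HB.integral ht.1
    (h.intervalIntegrable_Q le_rfl ht.1 le_rfl ht.2 (by linarith))
    ((intervalIntegrable_sub_rpow hσ1 t).continuousOn_mul hk.continuousOn) fun s hs => ?_)
  refine (hQ s ⟨hs.1.le, hs.2.le.trans ht.2⟩ _ (by linarith [hs.2])
    (by linarith [hs.1, ht.2])).mono ?_
  refine mul_le_mul_of_nonneg_left ?_ (hk0 s)
  exact Real.rpow_le_rpow_of_nonpos (by linarith [hs.2]) (by linarith) (by linarith)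

/-- A rough bound, with a constant that depends on the sup norm of the flux. -/
theorem exists_HB (h : SmoothedMild T r₀ H r) {γ R : ℝ} (h0 : 0 ≤ γ) (h1 : γ < 1)
    (hR : HB γ R r₀) : ∃ K, 0 ≤ K ∧ ∀ t ∈ Icc 0 T, HB γ K (r t) := by
  obtain ⟨M, hM⟩ := isCompact_Icc.exists_bound_of_continuousOn h.cont
  set k := c1 * (1 + (2 + c1)) * (1 + (T + 1) ^ (γ / 2)) * 3 ^ (1 / 2 + 0 + γ / 2) * |M| with hk
  set σ := 1 / 2 + 0 + γ / 2 with hσ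
  have hσ1 : 0 < 1 - σ := by linarith
  have hc := c1_nonneg
  by_cases hT : 0 ≤ T
  swap
  · exact ⟨0, le_rfl, fun t ht => absurd (ht.1.trans ht.2) hT⟩
  have hk0 : 0 ≤ k := by positivity
  have hRn := hR.nonneg
  refine ⟨R + k * (T ^ (1 - σ) / (1 - σ)), by positivity, fun t ht => ?_⟩
  refine (h.HB_of_flux (k := fun _ => k) (σ := σ) (by positivity) (by linarith) hR
    continuous_const (fun _ => hk0) ht fun s hs τ hτ hτ' => ?_).mono ?_
  · refine HB_Q h0 h1.le (abs_nonneg M) (S := T + 1) (a := 0) (fun τ' hτ'' _ => ?_) hτ hτ'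
    rw [neg_zero, Real.rpow_zero, mul_one]
    exact (norm_P_le hτ'' _).trans ((hM s hs).trans (le_abs_self M))
  · rw [intervalIntegral.integral_const_mul, integral_sub_rpow (by linarith)]
    have : t ^ (1 - σ) ≤ T ^ (1 - σ) := Real.rpow_le_rpow ht.1 ht.2 hσ1.le
    gcongr

/-- A singular Gronwall argument: if the Hölder norm of `∂_x P_τ H(s)` is at most
`C τ^{-σ}` times that of `r(s)`, then `r` is bounded in terms of `r₀`. The exponential weight
`e^{lt}` turns the integral operator into a contraction with factor `1/2`. -/
theorem HB_of_singular_gronwall (h : SmoothedMild T r₀ H r) {γ R σ C l : ℝ} (h0 : 0 ≤ γ)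
    (h1 : γ < 1) (hσ0 : 0 ≤ σ) (hσ1 : σ < 1) (hR : HB γ R r₀) (hC : 0 ≤ C) (hl : 0 < l)
    (hCl : C * ((1 / l) ^ (1 - σ) * Real.Gamma (1 - σ)) ≤ 1 / 2)
    (hQ : ∀ s ∈ Icc 0 T, ∀ K, HB γ K (r s) → ∀ τ, 0 < τ → τ ≤ T + 1 →
      HB γ (C * K * τ ^ (-σ)) (Q τ (H s))) :
    ∀ t ∈ Icc 0 T, HB γ (2 * R * Real.exp (l * T)) (r t) := by
  obtain ⟨K₀, hK₀, hap⟩ := h.exists_HB h0 h1 hR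
  have hRn := hR.nonneg
  have step : ∀ K, 0 ≤ K → (∀ t ∈ Icc 0 T, HB γ (K * Real.exp (l * t)) (r t)) →
      ∀ t ∈ Icc 0 T, HB γ ((R + K / 2) * Real.exp (l * t)) (r t) := by
    intro K hK hr t ht
    refine (h.HB_of_flux (k := fun s => C * (K * Real.exp (l * s))) hσ0 hσ1 hR
      (by fun_prop) (fun s => by positivity) ht
      fun s hs τ hτ hτ' => hQ s hs _ (hr s hs) τ hτ hτ').mono ?_
    have e1 : ∫ s in (0 : ℝ)..t, C * (K * Real.exp (l * s)) * (t - s) ^ (-σ)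
        = C * K * ∫ s in (0 : ℝ)..t, Real.exp (l * s) * (t - s) ^ (-σ) := by
      rw [← intervalIntegral.integral_const_mul]
      congr 1
      ext s
      ring
    rw [e1]
    have e2 : 1 ≤ Real.exp (l * t) := Real.one_le_exp (mul_nonneg hl.le ht.1)
    calc _ ≤ R * Real.exp (l * t) + C * K *
          (Real.exp (l * t) * ((1 / l) ^ (1 - σ) * Real.Gamma (1 - σ))) := by
          refine add_le_add (le_mul_of_one_le_right hRn e2) (mul_le_mul_of_nonneg_left
            (integral_exp_mul_sub_rpow_le hσ1 hl ht.1) (by positivity))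
      _ = R * Real.exp (l * t) + K * Real.exp (l * t) *
          (C * ((1 / l) ^ (1 - σ) * Real.Gamma (1 - σ))) := by ring
      _ ≤ R * Real.exp (l * t) + K * Real.exp (l * t) * (1 / 2) := by gcongr
      _ = _ := by ring
  have iter : ∀ n : ℕ, ∀ t ∈ Icc 0 T,
      HB γ ((2 * R + K₀ * (1 / 2) ^ n) * Real.exp (l * t)) (r t) := by
    intro n
    induction n with
    | zero =>
      intro t ht
      refine (hap t ht).mono ?_
      have e2 : 1 ≤ Real.exp (l * t) := Real.one_le_exp (mul_nonneg hl.le ht.1)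
      have := le_mul_of_one_le_right (by positivity : 0 ≤ 2 * R + K₀ * (1 / 2) ^ 0) e2
      refine le_trans ?_ this
      rw [pow_zero]
      linarith
    | succ n ih =>
      intro t ht
      refine (step _ (by positivity) ih t ht).mono (le_of_eq ?_)
      ring
  intro t ht
  have hlim : Tendsto (fun n : ℕ => (2 * R + K₀ * (1 / 2) ^ n) * Real.exp (l * t)) atTop
      (𝓝 (2 * R * Real.exp (l * t))) := by
    have := (((tendsto_pow_atTop_nhds_zero_of_lt_one (by norm_num : (0 : ℝ) ≤ 1 / 2)
      (by norm_num)).const_mul K₀).const_add (2 * R)).mul_const (Real.exp (l * t))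
    simpa using this
  have hlast : HB γ (2 * R * Real.exp (l * t)) (r t) :=
    ⟨fun x => ge_of_tendsto' hlim fun n => (iter n t ht).1 x,
      fun x y => ge_of_tendsto' (hlim.mul_const _) fun n => (iter n t ht).2 x y⟩
  refine hlast.mono ?_
  have : l * t ≤ l * T := mul_le_mul_of_nonneg_left ht.2 hl.le
  gcongr

end SmoothedMild

/-! ### Time regularity of the mild equation -/

/-- `∂_x P_τ` commutes with translations, so it acts on Hölder spaces as on bounded functions. -/
theorem HB_Q_of_HB {η K τ : ℝ} {H : ℝ →ᵇ ℂ} (h : HB η K H) (hτ : 0 < τ) :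
    HB η (c1 * τ ^ (-(1 / 2) : ℝ) * K) (Q τ H) := by
  have hc := c1_nonneg
  refine HB.of_shift ((norm_Q_le hτ H).trans ?_) fun a => ?_
  · have := h.norm_le
    gcongr
  · rw [← Q_shift, ← Q_sub, mul_assoc]
    refine (norm_Q_le hτ _).trans ?_
    have := h.shift_le a
    gcongr

/-- The time increments of `∂_x P_τ H` are controlled by the increments of `τ ↦ τ^{-1/2}`. -/
theorem HB_Q_sub_of_HB {η K τ τ' : ℝ} {H : ℝ →ᵇ ℂ} (h : HB η K H) (hτ : 0 < τ) (hd : τ < τ') :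
    HB η (6 * cQ * K * (τ ^ (-(1 / 2) : ℝ) - τ' ^ (-(1 / 2) : ℝ))) (Q τ H - Q τ' H) := by
  have hc := cQ_nonneg
  have hK := h.nonneg
  have key : ∀ f : ℝ →ᵇ ℂ, ‖Q τ f - Q τ' f‖
      ≤ cQ * (6 * (τ ^ (-(1 / 2) : ℝ) - τ' ^ (-(1 / 2) : ℝ))) * ‖f‖ := by
    intro f
    have h1 := norm_Q_add_sub_le hτ (sub_pos.mpr hd) f
    have h2 := min_mul_rpow_le hτ (sub_pos.mpr hd)
    rw [add_sub_cancel] at h1 h2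
    rw [norm_sub_rev]
    exact h1.trans (by gcongr)
  have hpos : 0 ≤ τ ^ (-(1 / 2) : ℝ) - τ' ^ (-(1 / 2) : ℝ) :=
    sub_nonneg.mpr (Real.rpow_le_rpow_of_nonpos hτ hd.le (by norm_num))
  refine HB.of_shift ((key H).trans ?_) fun a => ?_
  · have := h.norm_le
    calc _ ≤ cQ * (6 * (τ ^ (-(1 / 2) : ℝ) - τ' ^ (-(1 / 2) : ℝ))) * K := by gcongr
      _ = _ := by ring
  · have e : shift a (Q τ H - Q τ' H) - (Q τ H - Q τ' H)
        = Q τ (shift a H - H) - Q τ' (shift a H - H) := by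
      rw [Q_sub, Q_sub, Q_shift, Q_shift]
      ext x
      simp only [BoundedContinuousFunction.sub_apply, shift_apply]
      ring
    rw [e]
    refine (key _).trans ?_
    have := h.shift_le a
    calc _ ≤ cQ * (6 * (τ ^ (-(1 / 2) : ℝ) - τ' ^ (-(1 / 2) : ℝ))) * (K * |a| ^ η) := by gcongr
      _ = _ := by ring

theorem integral_sub_rpow_neg_half (a b c : ℝ) :
    ∫ u in a..b, (c - u) ^ (-(1 / 2) : ℝ) = 2 * (√(c - a) - √(c - b)) := by
  rw [intervalIntegral.integral_comp_sub_left (fun x => x ^ (-(1 / 2) : ℝ)),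
    integral_rpow (Or.inl (by norm_num)), Real.sqrt_eq_rpow, Real.sqrt_eq_rpow,
    show (-(1 / 2) + 1 : ℝ) = 1 / 2 by norm_num]
  ring

theorem intervalIntegrable_sub_rpow_neg_half (a b c : ℝ) :
    IntervalIntegrable (fun u => (c - u) ^ (-(1 / 2) : ℝ)) volume a b := by
  have := (intervalIntegral.intervalIntegrable_rpow' (a := c - a) (b := c - b)
    (by norm_num : (-1 : ℝ) < -(1 / 2))).comp_sub_left c
  simpa using this

/-- The solution minus the free evolution is `1/2`-Hölder in time with values in any Hölder space
that contains the flux. The telescoping bound `HB_Q_sub_of_HB` avoids a logarithmic loss. -/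
theorem SmoothedMild.HB_time {T : ℝ} {r₀ : ℝ →ᵇ ℂ} {H r : ℝ → ℝ →ᵇ ℂ}
    (h : SmoothedMild T r₀ H r) {η K s t : ℝ} (hH : ∀ s ∈ Icc 0 T, HB η K (H s))
    (hs : s ∈ Icc 0 T) (ht : t ∈ Icc 0 T) (hst : s < t) {p q : ℝ →ᵇ ℂ}
    (hp : ∀ ε, 0 < ε → P ε p = P (ε + t) r₀) (hq : ∀ ε, 0 < ε → P ε q = P (ε + s) r₀) :
    HB η ((2 * c1 + 12 * cQ) * K * √(t - s)) ((r t - r s) - (p - q) : ℝ →ᵇ ℂ) := by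
  have hc := c1_nonneg
  have hcQ := cQ_nonneg
  have hK := (hH s hs).nonneg
  refine HB.of_forall_P fun ε h0 h1 => ?_
  have hi1 := h.intervalIntegrable_Q (c := ε + t) le_rfl hs.1 hst.le ht.2 (by linarith)
  have hi2 := h.intervalIntegrable_Q (c := ε + t) hs.1 hst.le le_rfl ht.2 (by linarith)
  have hi3 := h.intervalIntegrable_Q (c := ε + s) le_rfl hs.1 le_rfl hs.2 (by linarith)
  have e : P ε ((r t - r s) - (p - q))
      = (∫ u in (0 : ℝ)..s, (Q (ε + s - u) (H u) - Q (ε + t - u) (H u)))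
        - ∫ u in s..t, Q (ε + t - u) (H u) := by
    rw [P_sub, P_sub, P_sub, h.eq t ht ε h0, h.eq s hs ε h0, hp ε h0, hq ε h0,
      intervalIntegral.integral_sub hi3 hi1,
      ← intervalIntegral.integral_add_adjacent_intervals hi1 hi2]
    abel
  have j1 := intervalIntegrable_sub_rpow_neg_half 0 s (ε + s)
  have j2 := intervalIntegrable_sub_rpow_neg_half 0 s (ε + t)
  have j3 := intervalIntegrable_sub_rpow_neg_half s t (ε + t)
  rw [e]
  refine ((HB.integral (γ := η) hs.1 (hi3.sub hi1) ((j1.sub j2).const_mul (6 * cQ * K))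
    fun u hu => ?_).sub (HB.integral (γ := η) hst.le hi2 (j3.const_mul (c1 * K))
    fun u hu => ?_)).mono ?_
  · exact HB_Q_sub_of_HB (hH u ⟨hu.1.le, hu.2.le.trans hs.2⟩) (by linarith [hu.2]) (by linarith)
  · refine (HB_Q_of_HB (hH u ⟨hs.1.trans hu.1.le, hu.2.le.trans ht.2⟩)
      (by linarith [hu.2] : 0 < ε + t - u)).mono (le_of_eq (by ring))
  · rw [intervalIntegral.integral_const_mul, intervalIntegral.integral_const_mul,
      intervalIntegral.integral_sub j1 j2, integral_sub_rpow_neg_half, integral_sub_rpow_neg_half,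
      integral_sub_rpow_neg_half, show ε + s - s = ε by ring, show ε + t - t = ε by ring,
      sub_zero, sub_zero]
    have m1 : √(ε + s) ≤ √(ε + t) := Real.sqrt_le_sqrt (by linarith)
    have m2 : √(ε + t - s) ≤ √ε + √(t - s) := by
      rw [show ε + t - s = ε + (t - s) by ring]
      have d0 : 0 ≤ t - s := by linarith
      refine Real.sqrt_le_iff.mpr ⟨by positivity, ?_⟩
      nlinarith [Real.sq_sqrt h0.le, Real.sq_sqrt d0, Real.sqrt_nonneg ε, Real.sqrt_nonneg (t - s),
        mul_nonneg (Real.sqrt_nonneg ε) (Real.sqrt_nonneg (t - s))]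
    have n1 := mul_nonneg hcQ hK
    have n2 := mul_nonneg hc hK
    calc _ ≤ 6 * cQ * K * (2 * √(t - s)) + c1 * K * (2 * √(t - s)) := by
          gcongr <;> linarith
      _ = _ := by ring

/-! ### The flux and the equation tested against Gaussians -/

theorem HasBoundedLipschitzDeriv.exists_lipschitzWith {G : ℝ → ℝ} (h : HasBoundedLipschitzDeriv G) :
    ∃ L : ℝ≥0, LipschitzWith L G := by
  obtain ⟨C, hC⟩ := h.bounded
  refine ⟨C.toNNReal, lipschitzWith_of_nnnorm_deriv_le h.diff fun x => ?_⟩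
  rw [← NNReal.coe_le_coe, coe_nnnorm, Real.norm_eq_abs]
  exact (hC x).trans (Real.le_coe_toNNReal C)

/-- The composition of a bounded continuous function with a Lipschitz function, complex-valued. -/
def lipComp {G : ℝ → ℝ} {L : ℝ≥0} (hG : LipschitzWith L G) (f : ℝ →ᵇ ℝ) : ℝ →ᵇ ℂ :=
  cB (f.comp G hG)

theorem norm_lipComp_sub_le {G : ℝ → ℝ} {L : ℝ≥0} (hG : LipschitzWith L G) (f g : ℝ →ᵇ ℝ) :
    ‖lipComp hG f - lipComp hG g‖ ≤ L * ‖cB f - cB g‖ := by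
  refine (BoundedContinuousFunction.norm_le (by positivity)).mpr fun x => ?_
  have h1 := hG.dist_le_mul (f x) (g x)
  have h2 := (cB f - cB g).norm_coe_le_norm x
  rw [Real.dist_eq, Real.dist_eq] at h1
  simp only [BoundedContinuousFunction.sub_apply, lipComp, cB_apply,
    BoundedContinuousFunction.comp_apply, ← Complex.ofReal_sub, Complex.norm_real,
    Real.norm_eq_abs] at h2 ⊢
  exact h1.trans (by gcongr)

theorem HB_lipComp {G : ℝ → ℝ} {L : ℝ≥0} (hG : LipschitzWith L G) (hG0 : G 0 = 0) {γ K : ℝ}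
    {f : ℝ →ᵇ ℝ} (hf : HB γ K (cB f)) : HB γ (L * K) (lipComp hG f) := by
  refine ⟨fun x => ?_, fun x y => ?_⟩
  · have h1 := hG.dist_le_mul (f x) 0
    have h2 := hf.1 x
    simp only [Real.dist_eq, hG0, sub_zero, lipComp, cB_apply,
      BoundedContinuousFunction.comp_apply, Complex.norm_real, Real.norm_eq_abs] at h1 h2 ⊢
    exact h1.trans (by gcongr)
  · have h1 := hG.dist_le_mul (f x) (f y)
    have h2 := hf.2 x y
    simp only [Real.dist_eq, lipComp, cB_apply, BoundedContinuousFunction.comp_apply,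
      ← Complex.ofReal_sub, Complex.norm_real, Real.norm_eq_abs] at h1 h2 ⊢
    rw [mul_assoc]
    exact h1.trans (by gcongr)

theorem heat_deriv_refl_gk {τ ε : ℝ} (hτ : 0 ≤ τ) (hε : 0 < ε) (f : ℝ →ᵇ ℂ) (x : ℝ) :
    heat τ (TemperedDistribution.derivCLM ℂ (bdist f)) (refl x (gk ε)) = Q (ε + τ) f x := by
  rw [heat_refl_gk hτ hε, TemperedDistribution.derivCLM_apply_apply, dk_refl, neg_neg, bdist_refl, Q]

/-- The free evolution at time `t ≥ 0`; the operator `P t` is the heat semigroup only for `t > 0`. -/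
theorem exists_bdist_eq_heat {t : ℝ} (ht : 0 ≤ t) (f : ℝ →ᵇ ℂ) :
    ∃ p, bdist p = heat t (bdist f) ∧ ∀ ε, 0 < ε → P ε p = P (ε + t) f := by
  rcases eq_or_lt_of_le ht with rfl | h
  · exact ⟨f, (heat_zero _).symm, fun ε _ => by rw [add_zero]⟩
  · exact ⟨P t f, by rw [heat_eq_cv h, cv_bdist, P], fun ε hε => P_P hε h f⟩

/-- A mild solution satisfies the smoothed mild equation: the smoothing `P_ε` amounts to testing
with Gaussians. -/
theorem IsMildSolution.smoothedMild {D : DyadicPartition} {T β a N : ℝ} {F : ℝ → ℝ}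
    {b : ℝ → 𝓢'(ℝ, ℂ)} {ρ₀ : ℝ →ᵇ ℝ} {ρ : ℝ → ℝ →ᵇ ℝ} (h : IsMildSolution D T β F N b ρ₀ ρ)
    (hβ : 0 < β) {L : ℝ≥0} (hL : LipschitzWith L fun z => z * F z) (hN : 1 ≤ N)
    (ha0 : 0 < a) (ha1 : a < 1) (hr : ∀ t ∈ Icc 0 T, IsRealDist (b t))
    (hb : MemC T (besovNorm D (-a)) b) :
    SmoothedMild T (cB ρ₀) (fun s => lipComp hL (ρ s) * cB (mollified N b s))
      (fun s => cB (ρ s)) := by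
  have hcont : ContinuousOn (fun s => lipComp hL (ρ s) * cB (mollified N b s)) (Icc 0 T) := by
    obtain ⟨α, hα, hα'⟩ := h.mem
    obtain ⟨C, hC, hsup⟩ := norm_le_of_besovNorm_le D (hβ.trans hα)
    refine ContinuousOn.mul ?_ (continuousOn_mollified D ha0 ha1 hN hr hb)
    refine continuousOn_of_memC (C := L * C) hα' _ fun s _ t _ M hM hM' => ?_
    refine (norm_lipComp_sub_le hL _ _).trans ?_
    rw [funNorm_eq] at hM'
    have := hsup _ M hM hM'
    rw [cB_sub] at this
    rw [mul_assoc]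
    gcongr
  refine ⟨hcont, fun t ht ε hε => ?_⟩
  have hi : IntervalIntegrable (fun s => Q (ε + t - s) (lipComp hL (ρ s) * cB (mollified N b s)))
      volume 0 t := by
    refine ContinuousOn.intervalIntegrable ?_
    rw [uIcc_of_le ht.1]
    exact continuousOn_Q ht.2 (by linarith) hcont
  ext x
  have h1 := h.eq t ht (refl x (gk ε))
  rw [toDist_coe, toDist_coe, bdist_refl, heat_refl_gk ht.1 hε, bdist_refl] at h1
  have h2 : ∫ s in (0 : ℝ)..t, heat (t - s) (TemperedDistribution.derivCLM ℂ
        (toDist (flux F N b ρ s))) (refl x (gk ε))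
      = ∫ s in (0 : ℝ)..t, Q (ε + t - s) (lipComp hL (ρ s) * cB (mollified N b s)) x := by
    refine intervalIntegral.integral_congr fun s hs => ?_
    rw [uIcc_of_le ht.1] at hs
    have h3 : toDist (flux F N b ρ s) = bdist (lipComp hL (ρ s) * cB (mollified N b s)) :=
      toDist_eq fun x => by simp [flux, lipComp]
    rw [h3, heat_deriv_refl_gk (by linarith [hs.2]) hε, add_sub_assoc]
  rw [h2] at h1
  have h4 := (BoundedContinuousFunction.evalCLM ℂ x : (ℝ →ᵇ ℂ) →L[ℂ] ℂ).intervalIntegral_comp_comm hi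
  simp only [BoundedContinuousFunction.evalCLM_apply] at h4
  rw [BoundedContinuousFunction.sub_apply, ← h4]
  exact h1

/-! ### The Hölder bound in time -/

/-- A rate `l` with `C ∫_0^∞ u^{-σ} e^{-lu} du ≤ 1/2`. -/
def gronwallRate (σ C : ℝ) : ℝ := (2 * C * Real.Gamma (1 - σ) + 1) ^ (1 / (1 - σ))

theorem gronwallRate_spec {σ C : ℝ} (hσ : σ < 1) (hC : 0 ≤ C) : 0 < gronwallRate σ C ∧
    C * ((1 / gronwallRate σ C) ^ (1 - σ) * Real.Gamma (1 - σ)) ≤ 1 / 2 := by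
  have hG : 0 < Real.Gamma (1 - σ) := Real.Gamma_pos_of_pos (by linarith)
  have hp : 0 < 2 * C * Real.Gamma (1 - σ) + 1 := by positivity
  refine ⟨Real.rpow_pos_of_pos hp _, ?_⟩
  rw [gronwallRate, one_div (_ ^ _), Real.inv_rpow (by positivity), ← Real.rpow_mul hp.le,
    one_div_mul_cancel (by linarith), Real.rpow_one, ← div_eq_inv_mul, ← mul_div_assoc,
    div_le_iff₀ hp]
  linarith

/-- The constant of `HB_Q`. -/
def cHQ (γ a S : ℝ) : ℝ := c1 * (1 + (2 + c1)) * (1 + S ^ (γ / 2)) * 3 ^ (1 / 2 + a + γ / 2)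

theorem cHQ_nonneg {γ a S : ℝ} (hS : 0 ≤ S) : 0 ≤ cHQ γ a S := by
  have := c1_nonneg
  unfold cHQ
  positivity

/-- The bound in `C^η`, with the dependence on the initial datum through `C^γ` for any admissible
`γ ≥ max(1/2, η)`. -/
theorem exists_funNorm_sub_le (D : DyadicPartition) {T ν η : ℝ} (hT : 0 < T) (hη : 0 < η)
    (hην : η < ν) :
    ∃ cS : ℝ≥0, ∀ (β' γ : ℝ) (F : ℝ → ℝ), 0 < β' → β' < 1 / 2 → 1 / 2 ≤ γ → η ≤ γ → γ < 1 - β' →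
      γ ≤ 1 + ν → IsNonlinearity F →
      ∃ c6 : ℝ≥0∞ → ℝ≥0∞ → ℝ≥0, ∀ (ρ₀ : ℝ →ᵇ ℝ) (b : ℝ → 𝓢'(ℝ, ℂ)),
        funNorm D (1 + ν) ρ₀ < ⊤ → IsDrift D T β' b → ∀ N : ℝ, 1 ≤ N → ∀ β, 0 < β →
        ∀ ρ : ℝ → ℝ →ᵇ ℝ, IsMildSolution D T β F N b ρ₀ ρ →
          (∀ t ∈ Icc 0 T, funNorm D η (ρ t) < ⊤) ∧
          ∀ s ∈ Icc 0 T, ∀ t ∈ Icc 0 T, s < t → funNorm D η (ρ t - ρ s) ≤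
            (cS * funNorm D (1 + ν) ρ₀ + c6 (funNorm D γ ρ₀) (supNorm T (besovNorm D (-β')) b)
              * ENNReal.ofReal (N ^ ((η + β') / 2))) * ENNReal.ofReal ((t - s) ^ (1 / 2 : ℝ)) := by
  obtain ⟨Ch, hCh, hheat⟩ := besovNorm_heat_sub_le D hην.le
  -- the first constant is fixed before `β'`, `γ` and `F`
  refine ⟨Ch.toNNReal, fun β' γ F hβ0 hβ1 hγ2 hηγ hγ1 hγν hF => ?_⟩
  have hγ0 : 0 < γ := by linarith
  have hγlt : γ < 1 := by linarith
  obtain ⟨Cγ, hCγ, hHB⟩ := HB_of_besovNorm_le D hγ0 hγlt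
  obtain ⟨Cη, hCη, hbes⟩ := besovNorm_le_of_HB D hη (hηγ.trans hγlt.le)
  obtain ⟨Cb, hCb, hdrift⟩ := drift_bounds D (a := β') (η := η) (S := T + 1) hβ0 (by linarith)
    hη.le (hηγ.trans hγlt.le) (by linarith)
  obtain ⟨L, hL⟩ := hF.right.exists_lipschitzWith
  set σ : ℝ := 1 / 2 + β' / 2 + γ / 2 with hσ
  have hσ1 : σ < 1 := by linarith
  have hcp : 0 ≤ cprod γ (β' / 2) (T + 1) := cprod_nonneg (by linarith) (by linarith)
  have hcH : 0 ≤ cHQ γ (β' / 2) (T + 1) := cHQ_nonneg (by linarith)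
  have hc := c1_nonneg
  have hcQ := cQ_nonneg
  -- the constant of the Gronwall argument, as a function of the norm of the drift
  set G : ℝ → ℝ := fun M =>
    cHQ γ (β' / 2) (T + 1) * (cprod γ (β' / 2) (T + 1) * L * (Cb * M)) with hG
  -- the resulting bound of the solution in the Hölder space of order `γ`
  set K : ℝ → ℝ → ℝ := fun m M => 2 * (Cγ * m) * Real.exp (gronwallRate σ (G M) * T) with hK
  set W : ℝ → ℝ → ℝ := fun m M =>
    Cη * ((2 * c1 + 12 * cQ) * (2 * (L * (2 * K m M)) * (Cb * M))) with hW
  refine ⟨fun m M => (W m.toReal M.toReal).toNNReal, fun ρ₀ b hρ₀ hb N hN β hβ ρ hρ => ?_⟩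
  have hmild := hρ.smoothedMild hβ hL hN hβ0 (by linarith) hb.real hb.mem.1
  have hsup := hb.mem.supNorm_lt_top D (by norm_num) hT.le
  have hγfin : funNorm D γ ρ₀ < ⊤ := besovNorm_lt_top_of_le D hγν hρ₀
  set m := (funNorm D γ ρ₀).toReal with hm
  set M := (supNorm T (besovNorm D (-β')) b).toReal with hM
  have hm0 : 0 ≤ m := ENNReal.toReal_nonneg
  have hM0 : 0 ≤ M := ENNReal.toReal_nonneg
  have hbM : ∀ s ∈ Icc 0 T, besovNorm D (-β') (b s) ≤ ENNReal.ofReal M := fun s hs => by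
    rw [hM, ENNReal.ofReal_toReal hsup.ne]
    exact le_iSup₂_of_le s hs le_rfl
  have hd := fun s hs => hdrift b s N M (hb.real s hs) hN hM0 (hbM s hs)
  have hG0 : 0 ≤ G M := by positivity
  have hR : HB γ (Cγ * m) (cB ρ₀) := hHB _ _ hm0 (by
    rw [← funNorm_eq, hm, ENNReal.ofReal_toReal hγfin.ne])
  obtain ⟨hl0, hl⟩ := gronwallRate_spec hσ1 hG0
  have hr : ∀ t ∈ Icc 0 T, HB γ (K m M) (cB (ρ t)) := by
    refine hmild.HB_of_singular_gronwall hγ0.le hγlt (by positivity) hσ1 hR hG0 hl0 hl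
      fun s hs κ hκ τ hτ hτ' => ?_
    have hκ0 := hκ.nonneg
    refine (HB_Q (γ := γ) (a := β' / 2) (S := T + 1) hγ0.le hγlt.le
      (A := cprod γ (β' / 2) (T + 1) * (L * κ) * (Cb * M)) (by positivity)
      (fun τ' h1 h2 => ?_) hτ hτ').mono (le_of_eq ?_)
    · exact norm_P_mul_le (by linarith) (by linarith) (by linarith) (by positivity)
        (HB_lipComp hL (by simp) hκ) (hd s hs).1 h1 h2
    · simp only [hG, cHQ, hσ]
      ring
  have hK0 : 0 ≤ K m M := by positivity
  have hr' : ∀ t ∈ Icc 0 T, HB η (2 * K m M) (cB (ρ t)) := fun t ht =>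
    (hr t ht).lower hη.le hηγ
  have hH : ∀ s ∈ Icc 0 T, HB η (2 * (L * (2 * K m M)) * (Cb * M * N ^ ((η + β') / 2)))
      (lipComp hL (ρ s) * cB (mollified N b s) : ℝ →ᵇ ℂ) := fun s hs =>
    (HB_lipComp hL (by simp) (hr' s hs)).mul (hd s hs).2
  refine ⟨fun t ht => ?_, fun s hs t ht hst => ?_⟩
  · rw [funNorm_eq]
    exact (hbes _ _ (hr' t ht)).trans_lt ENNReal.ofReal_lt_top
  · obtain ⟨p, hp, hp'⟩ := exists_bdist_eq_heat ht.1 (cB ρ₀)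
    obtain ⟨q, hq, hq'⟩ := exists_bdist_eq_heat hs.1 (cB ρ₀)
    have hw := hmild.HB_time hH hs ht hst hp' hq'
    simp only [← cB_sub] at hw
    have h1 := hbes _ _ hw
    have h2 := hheat (bdist (cB ρ₀)) (funNorm D (1 + ν) ρ₀).toReal ENNReal.toReal_nonneg
      (by rw [← funNorm_eq, ENNReal.ofReal_toReal hρ₀.ne]) s t hs.1 hst
    rw [← hp, ← hq, ← bdist_sub] at h2
    have h3 := besovNorm_add_le D η (bdist (p - q)) (bdist ((cB (ρ t) - cB (ρ s)) - (p - q)))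
    rw [← bdist_add, add_sub_cancel, ← cB_sub, ← funNorm_eq] at h3
    refine h3.trans ((add_le_add h2 h1).trans (le_of_eq ?_))
    have hd0 : 0 ≤ (t - s) ^ (1 / 2 : ℝ) := Real.rpow_nonneg (by linarith) _
    have e1 : Cη * ((2 * c1 + 12 * cQ) * (2 * (L * (2 * K m M)) * (Cb * M * N ^ ((η + β') / 2)))
        * √(t - s)) = W m M * N ^ ((η + β') / 2) * (t - s) ^ (1 / 2 : ℝ) := by
      rw [hW, Real.sqrt_eq_rpow]
      ring
    have hW0 : 0 ≤ W m M := by positivity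
    have hN0 : 0 ≤ N ^ ((η + β') / 2) := by positivity
    rw [e1, ENNReal.ofReal_mul (mul_nonneg hW0 hN0), ENNReal.ofReal_mul hW0,
      ENNReal.ofReal_mul (mul_nonneg hCh ENNReal.toReal_nonneg), ENNReal.ofReal_mul hCh, ENNReal.ofReal_toReal hρ₀.ne,
      ← add_mul]
    rfl

/-- `C^η` with `η > 0` embeds into `L^∞`, for the extended norms. -/
theorem exists_linftyNorm_le (D : DyadicPartition) {η : ℝ} (hη : 0 < η) :
    ∃ C : ℝ≥0, ∀ f : ℝ →ᵇ ℝ, linftyNorm f ≤ C * funNorm D η f := by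
  obtain ⟨C, hC, h⟩ := norm_le_of_besovNorm_le D hη
  -- a positive constant is needed for `f ∉ C^η`, where the right-hand side has to be `∞`
  refine ⟨(C + 1).toNNReal, fun f => ?_⟩
  have hC1 : (0 : ℝ) < C + 1 := by linarith
  rcases eq_or_ne (funNorm D η f) ⊤ with hf | hf
  · rw [hf, ENNReal.mul_top (by simpa using hC1)]
    exact le_top
  · have h1 := h (cB f) (funNorm D η f).toReal ENNReal.toReal_nonneg
      (by rw [← funNorm_eq, ENNReal.ofReal_toReal hf])
    refine (linftyNorm_le f).trans ?_
    calc ENNReal.ofReal ‖cB f‖ ≤ ENNReal.ofReal ((C + 1) * (funNorm D η f).toReal) := by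
          refine ENNReal.ofReal_le_ofReal (h1.trans ?_)
          have : 0 ≤ (funNorm D η f).toReal := ENNReal.toReal_nonneg
          gcongr
          linarith
      _ = _ := by rw [ENNReal.ofReal_mul hC1.le, ENNReal.ofReal_toReal hf]; rfl

theorem linftyNorm_neg (f : ℝ →ᵇ ℝ) : linftyNorm (-f) = linftyNorm f :=
  eLpNorm_neg (f := f) (μ := volume) (p := ⊤)

theorem linftyNorm_zero : linftyNorm 0 = 0 := eLpNorm_zero (μ := volume) (p := ⊤)

theorem funNorm_neg (D : DyadicPartition) (γ : ℝ) (f : ℝ →ᵇ ℝ) :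
    funNorm D γ (-f) = funNorm D γ f := by
  have : cB (-f) = (-1 : ℂ) • cB f := by ext x; simp
  have h : (-1 : ℂ) • bdist (cB f) = -bdist (cB f) := by ext ψ; simp
  rw [funNorm_eq, funNorm_eq, this, bdist_smul, h, besovNorm_neg]

theorem funNorm_zero (D : DyadicPartition) {η : ℝ} (hη : 0 < η) (hη1 : η ≤ 1) :
    funNorm D η 0 = 0 := by
  obtain ⟨C, -, h⟩ := besovNorm_le_of_HB D hη hη1
  have := h (cB 0) 0 ⟨fun x => by simp, fun x y => by simp⟩
  rw [mul_zero, ENNReal.ofReal_zero] at this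
  rw [funNorm_eq]
  exact le_antisymm this zero_le

end

end SingularFP

/-- Part one is the bound in `L^∞`, part two the bound in `C^η` with the loss `δ`. In both, the
constant `cS` is chosen before `β, β', F, ρ₀, b, N, ρ`, and `c6` (a function of a norm of `ρ₀` and
the norm of `b`) before `ρ₀, b, N, ρ`. In part two an admissible `θ ∈ (0, δ]` always exists; it
records through which norm of `ρ₀` the constant depends on `ρ₀`. -/
theorem lemma5p2 (D : DyadicPartition) (T ν : ℝ) (hT : 0 < T) (hν : 0 < ν) :
    (∀ η : ℝ, 0 < η → η < ν →
      ∃ cS : ℝ≥0, ∀ (β β' : ℝ) (F : ℝ → ℝ),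
        0 < β → β < 1 / 2 → 0 < β' → β' < β → β - β' < ν → IsNonlinearity F →
        η < 1 - β →
        ∃ c6 : ℝ≥0∞ → ℝ≥0∞ → ℝ≥0, ∀ (ρ₀ : ℝ →ᵇ ℝ) (b : ℝ → 𝓢'(ℝ, ℂ)),
          IsInitialDensity D ν ρ₀ → IsDrift D T β' b →
          ∀ N : ℝ, 1 ≤ N → ∀ ρ : ℝ → ℝ →ᵇ ℝ, IsMildSolution D T β F N b ρ₀ ρ →
            MemCHolder T (1 / 2) linftyNorm ρ ∧
            holderSeminorm T (1 / 2) linftyNorm ρ ≤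
              cS * funNorm D (1 + ν) ρ₀
                + c6 (funNorm D (max (1 / 2) η) ρ₀) (supNorm T (besovNorm D (-β')) b)
                  * ENNReal.ofReal (N ^ ((η + β') / 2)))
    ∧
    (∀ η δ : ℝ, 0 < η → η < ν → 0 < δ →
      ∃ cS : ℝ≥0, ∀ (β β' : ℝ) (F : ℝ → ℝ),
        0 < β → β < 1 / 2 → 0 < β' → β' < β → β - β' < ν → IsNonlinearity F →
        η < 1 - β → ∀ θ : ℝ, 0 < θ → θ ≤ δ → η + θ < min (1 - β) ν →
        ∃ c6 : ℝ≥0∞ → ℝ≥0∞ → ℝ≥0, ∀ (ρ₀ : ℝ →ᵇ ℝ) (b : ℝ → 𝓢'(ℝ, ℂ)),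
          IsInitialDensity D ν ρ₀ → IsDrift D T β' b →
          ∀ N : ℝ, 1 ≤ N → ∀ ρ : ℝ → ℝ →ᵇ ℝ, IsMildSolution D T β F N b ρ₀ ρ →
            MemCHolder T (1 / 2) (funNorm D η) ρ ∧
            holderSeminorm T (1 / 2) (funNorm D η) ρ ≤
              cS * funNorm D (1 + ν) ρ₀
                + c6 (funNorm D (max (1 / 2) (η + θ)) ρ₀) (supNorm T (besovNorm D (-β')) b)
                  * ENNReal.ofReal (N ^ ((η + β' + δ) / 2))) := by
  constructor
  · intro η hη hην
    obtain ⟨cS, h⟩ := exists_funNorm_sub_le D hT hη hην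
    obtain ⟨C, hC⟩ := exists_linftyNorm_le D hη
    refine ⟨C * cS, fun β β' F hβ0 hβ1 hβ'0 hβ' _ hF hηβ => ?_⟩
    obtain ⟨c6, h6⟩ := h β' (max (1 / 2) η) F hβ'0 (by linarith) (le_max_left _ _)
      (le_max_right _ _) (max_lt (by linarith) (by linarith)) (max_le (by linarith) (by linarith)) hF
    refine ⟨fun m M => C * c6 m M, fun ρ₀ b hρ₀ hb N hN ρ hρ => ?_⟩
    have h1 := (h6 ρ₀ b hρ₀.mem hb N hN β hβ0 ρ hρ).2
    have h2 := holderSeminorm_le (κ := 1 / 2) (T := T) (f := ρ) linftyNorm_neg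
      (fun s hs t ht hst => (hC _).trans ((mul_le_mul_right (h1 s hs t ht hst) _).trans
        (mul_assoc _ _ _).ge))
    have h3 : holderSeminorm T (1 / 2) linftyNorm ρ ≤ ↑(C * cS) * funNorm D (1 + ν) ρ₀
        + ↑(C * c6 (funNorm D (max (1 / 2) η) ρ₀) (supNorm T (besovNorm D (-β')) b))
          * ENNReal.ofReal (N ^ ((η + β') / 2)) := by
      refine h2.trans (le_of_eq ?_)
      push_cast
      ring
    refine ⟨MemCHolder.of_finite (by norm_num) linftyNorm_zero
      (fun t _ => (linftyNorm_le _).trans_lt ENNReal.ofReal_lt_top) (h3.trans_lt ?_), h3⟩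
    exact ENNReal.add_lt_top.mpr ⟨ENNReal.mul_lt_top ENNReal.coe_lt_top hρ₀.mem,
      ENNReal.mul_lt_top ENNReal.coe_lt_top ENNReal.ofReal_lt_top⟩
  · intro η δ hη hην hδ
    obtain ⟨cS, h⟩ := exists_funNorm_sub_le D hT hη hην
    refine ⟨cS, fun β β' F hβ0 hβ1 hβ'0 hβ' _ hF hηβ θ hθ _ hθη => ?_⟩
    have hθβ := hθη.trans_le (min_le_left _ _)
    have hθν := hθη.trans_le (min_le_right _ _)
    obtain ⟨c6, h6⟩ := h β' (max (1 / 2) (η + θ)) F hβ'0 (by linarith) (le_max_left _ _)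
      (le_max_of_le_right (by linarith)) (max_lt (by linarith) (by linarith))
      (max_le (by linarith) (by linarith)) hF
    refine ⟨c6, fun ρ₀ b hρ₀ hb N hN ρ hρ => ?_⟩
    obtain ⟨h0, h1⟩ := h6 ρ₀ b hρ₀.mem hb N hN β hβ0 ρ hρ
    have h2 := holderSeminorm_le (κ := 1 / 2) (T := T) (f := ρ) (funNorm_neg D η) h1
    have h3 := h2.trans (add_le_add_right (mul_le_mul_right (ENNReal.ofReal_le_ofReal
      (Real.rpow_le_rpow_of_exponent_le hN
        (by linarith : (η + β') / 2 ≤ (η + β' + δ) / 2))) _) _)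
    refine ⟨MemCHolder.of_finite (by norm_num) (funNorm_zero D hη (by linarith)) h0
      (h3.trans_lt ?_), h3⟩
    exact ENNReal.add_lt_top.mpr ⟨ENNReal.mul_lt_top ENNReal.coe_lt_top hρ₀.mem,
      ENNReal.mul_lt_top ENNReal.coe_lt_top ENNReal.ofReal_lt_top⟩
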